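/- **Diagrams.** Consider the red-green graphical calculus for Spekkens' toy bit theory. A diagram consists of green and red nodes (spiders) with phase labels $xy\in\{0,1\}^2$ and any number $\ge 0$ of legs, of nodes $H$ with two legs, and of wires, each of which joins two points among the legs, the inputs and the outputs of the diagram (closed wires are allowed). Diagrams are considered up to topology, i.e. only the connectivity matters. A toy bit has the ontic states $1,2,3,4$, and a diagram with $m$ inputs and $n$ outputs denotes a relation from $\{1,2,3,4\}^m$ to $\{1,2,3,4\}^n$, obtained by composing the relations of its parts: a wire is the identity; $H$ is the permutation $(2\,3)$; a green node with phase $xy$ relates states on its legs iff all of them are in $\{1,2\}$ and the number of legs in state $2$ is congruent to $x$ mod $2$, or all of them are in $\{3,4\}$ and the number of legs in state $4$ is congruent to $y$ mod $2$; a red node is a green node of the same phase with $H$ on each leg. **Rewrite rules.** Two diagrams are equal within the graphical calculus if they are related by finitely many applications, inside larger diagrams and in either direction, of the following rules and of the same rules with red and green exchanged. Unlabelled nodes have phase $00$. 1. Spider: two green nodes joined by a wire merge, and their phases add bitwise modulo $2$. Loop: a wire from a node to itself may be removed. 2. Identity: a node with phase $00$ and two legs is a wire. 3. Bialgebra: two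 green nodes with one input and two outputs each, followed by two red nodes each of which joins one output of the first and one output of the second green node to one new output, equal one red node with two inputs whose single output is the input of one green node with two outputs. 4. Copy: a green node with one input and two outputs, applied to a red state of phase $00$, equals two red states of phase $00$. 5. $11$-copy: a green $11$ phase shift on the input of a red node with one input and any number of outputs equals the red node followed by a green $11$ phase shift on each output. 6. $11$-commutation: a green phase shift $xy$ followed by the red phase shift $11$ equals the red phase shift $11$ followed by the green phase shift $yx$. 7. Colour change: a red node equals the green node of the same phase with $H$ on each leg. 8. Euler decomposition: $H$ equals the sequence of phase shifts green $01$, red $01$, green $01$. 9. Scalars: a subdiagram without inputs and outputs, not connected to the rest, may be dropped if it does not denote the empty relation. **Reduced GS-LO diagrams.** A GS-LO diagram on $n$ toy bits is given by a finite simple graph $G$ with vertices $1,\dots,n$ and a reversible single-toy-bit operator (a finite sequence of phase shifts and copies of $H$) for each vertex, its vertex operator. It has a green node of phase $00$ for each vertex, a node $H$ for each edge, connected to the green nodes of the two end points, and for each vertex $v$ one further wire at its green node, which passes through the vertex operator of $v$ and ends in the $v$-th output. Let $R$ be the set consisting of the green phase shifts $ab$ with $a,b\in\{0,1\}$ and of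 the operators "green phase shift $e\bar e$, followed, further away from the graph, by the red phase shift $01$", with $e\in\{0,1\}$ and $\bar e=1\oplus e$. A GS-LO diagram is reduced if all its vertex operators belong to $R$ and no two adjacent vertices both have vertex operators that contain a red node. **Theorem.** Every state diagram (a diagram with no inputs and any number $n\ge 0$ of outputs) that does not denote the empty relation is equal, within the graphical calculus, to some reduced GS-LO diagram. -/

import Mathlib

namespace ToyCalculus

/-- Phase labels `xy`; merging spiders adds them bitwise modulo 2. -/
abbrev Phase := ZMod 2 × ZMod 2

inductive Colour
  | green
  | red
  deriving DecidableEq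

def Colour.swap : Colour → Colour
  | .green => .red
  | .red => .green

/-- The four ontic states of a toy bit. The state numbered `1 + 2 * u + v` is the pair `(u, v)`,
so that `1, 2, 3, 4` are `(0,0), (0,1), (1,0), (1,1)`. -/
abbrev Ontic := ZMod 2 × ZMod 2

/-- A node of a diagram together with the wires on which its legs sit; wires are named by natural
numbers. A spider has any number of legs, a Hadamard-like node has two. The legs of a node are not
ordered, and there is no distinction between its inputs and its outputs: only the topology
matters. -/
inductive Node
  | spider (c : Colour) (p : Phase) (legs : Multiset ℕ)
  | had (legs : Sym2 ℕ)

namespace Node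

/-- The wires at which a node sits, with multiplicity. -/
def legs : Node → Multiset ℕ
  | .spider _ _ l => l
  | .had e => e.toMultiset

/-- Rename the wires. -/
def rename (f : ℕ → ℕ) : Node → Node
  | .spider c p l => .spider c p (l.map f)
  | .had e => .had (e.map f)

end Node

/-- The relation denoted by a green spider with phase `xy`, as a condition on the ontic states on
its legs: all of them lie in `{1, 2}` or all of them lie in `{3, 4}`, and the number of legs in an
even-numbered state is congruent modulo 2 to `x` in the first case and to `y` in the second. -/
def GreenSpider (p : Phase) (s : Multiset Ontic) : Prop :=
  ∃ u : ZMod 2, (∀ t ∈ s, t.1 = u) ∧ (s.map Prod.snd).sum = if u = 0 then p.1 else p.2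

/-- The condition which a node imposes on an assignment of ontic states to wires. The
Hadamard-like node is the permutation `(2 3)`, i.e. `Prod.swap`, and a red spider is a green spider
with `(2 3)` on each of its legs. -/
def Node.Holds (f : ℕ → Ontic) : Node → Prop
  | .spider .green p l => GreenSpider p (l.map f)
  | .spider .red p l => GreenSpider p (l.map fun e => (f e).swap)
  | .had e => ∃ s : Ontic, e.map f = s(s, s.swap)

/-- A diagram with `m` inputs and `n` outputs, up to rearrangement in the plane. Every wire in use
has exactly two ends, each of which is an input of the diagram, an output of the diagram, or a leg
of a node. Closed wires without ends are counted by `circles`. -/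
structure Diagram (m n : ℕ) where
  input : Fin m → ℕ
  output : Fin n → ℕ
  nodes : Multiset Node
  circles : ℕ
  two_ends : ∀ e : ℕ,
    (Finset.univ.val.map input + Finset.univ.val.map output + nodes.bind Node.legs).count e = 0 ∨
    (Finset.univ.val.map input + Finset.univ.val.map output + nodes.bind Node.legs).count e = 2

/-- The relation between ontic states of the inputs and of the outputs denoted by a diagram. -/
def Diagram.interp {m n : ℕ} (D : Diagram m n) : Set ((Fin m → Ontic) × (Fin n → Ontic)) :=
  {x | ∃ f : ℕ → Ontic, (∀ i, f (D.input i) = x.1 i) ∧ (∀ j, f (D.output j) = x.2 j) ∧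
    ∀ N ∈ D.nodes, N.Holds f}

/-- The rewrite rules that replace some nodes by others with the same outer wires. Each rule is
given in both colourings. -/
inductive LocalRule : Multiset Node → Multiset Node → Prop
  /-- Adjacent spiders of the same colour merge, adding their phases. -/
  | spider (c : Colour) (p q : Phase) (e : ℕ) (S T : Multiset ℕ) :
      LocalRule {.spider c p (e ::ₘ S), .spider c q (e ::ₘ T)} {.spider c (p + q) (S + T)}
  /-- Self-loops can be removed. -/
  | loop (c : Colour) (p : Phase) (e : ℕ) (S : Multiset ℕ) :
      LocalRule {.spider c p (e ::ₘ e ::ₘ S)} {.spider c p S}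
  /-- Bialgebra rule with outer wires `a₁ a₂` (inputs) and `b₁ b₂` (outputs). -/
  | bialgebra (c : Colour) (a₁ a₂ b₁ b₂ e₁₁ e₁₂ e₂₁ e₂₂ e : ℕ) :
      LocalRule
        {.spider c 0 {a₁, e₁₁, e₁₂}, .spider c 0 {a₂, e₂₁, e₂₂},
          .spider c.swap 0 {e₁₁, e₂₁, b₁}, .spider c.swap 0 {e₁₂, e₂₂, b₂}}
        {.spider c.swap 0 {a₁, a₂, e}, .spider c 0 {e, b₁, b₂}}
  /-- A spider with two outputs copies the zero phase state of the other colour. -/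
  | copy (c : Colour) (a b e : ℕ) :
      LocalRule {.spider c.swap 0 {e}, .spider c 0 {e, a, b}}
        {.spider c.swap 0 {a}, .spider c.swap 0 {b}}
  /-- A `11` phase shift is copied by a spider of the other colour, with any number of outputs.
  The second components of the members of `L` are the outer wires at these outputs. -/
  | copy11 (c : Colour) (a e : ℕ) (L : Multiset (ℕ × ℕ)) :
      LocalRule {.spider c (1, 1) {a, e}, .spider c.swap 0 (e ::ₘ L.map Prod.snd)}
        (.spider c.swap 0 (a ::ₘ L.map Prod.fst) ::ₘ
          L.map fun l => .spider c (1, 1) {l.1, l.2})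
  /-- A `11` phase shift passes a phase shift of the other colour and swaps its two bits. -/
  | comm11 (c : Colour) (x y : ZMod 2) (a b e e' : ℕ) :
      LocalRule {.spider c (x, y) {a, e}, .spider c.swap (1, 1) {e, b}}
        {.spider c.swap (1, 1) {a, e'}, .spider c (y, x) {e', b}}
  /-- A spider equals the spider of the other colour with a Hadamard-like node on each leg. -/
  | colour (c : Colour) (p : Phase) (L : Multiset (ℕ × ℕ)) :
      LocalRule {.spider c p (L.map Prod.snd)}
        (.spider c.swap p (L.map Prod.fst) ::ₘ L.map fun l => .had s(l.1, l.2))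
  /-- Euler decomposition of the Hadamard-like node. -/
  | euler (c : Colour) (a b e e' : ℕ) :
      LocalRule {.had s(a, b)}
        {.spider c (0, 1) {a, e}, .spider c.swap (0, 1) {e, e'}, .spider c (0, 1) {e', b}}

/-- One application of a rewrite rule inside a diagram. As wires of diagrams have exactly two ends,
the inner wires of a rule do not occur in the rest `C` of the diagram. -/
inductive Step {m n : ℕ} : Diagram m n → Diagram m n → Prop
  /-- The names of the wires are irrelevant. -/
  | relabel (D D' : Diagram m n) (f : Equiv.Perm ℕ)
      (hi : D'.input = f ∘ D.input) (ho : D'.output = f ∘ D.output)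
      (hn : D'.nodes = D.nodes.map (Node.rename f)) (hc : D'.circles = D.circles) : Step D D'
  /-- A local rule is applied, with the rest of the diagram unchanged. -/
  | rule (D D' : Diagram m n) (A B C : Multiset Node) (h : LocalRule A B)
      (hi : D'.input = D.input) (ho : D'.output = D.output)
      (hA : D.nodes = A + C) (hB : D'.nodes = B + C) (hc : D'.circles = D.circles) : Step D D'
  /-- Identity rule: a node with two legs and phase `00` is removed and its two wires `a`, `b`
  become one. -/
  | identity (D D' : Diagram m n) (c : Colour) (a b : ℕ) (C : Multiset Node) (hab : a ≠ b)
      (hi : D'.input = Function.update id b a ∘ D.input)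
      (ho : D'.output = Function.update id b a ∘ D.output)
      (hn : D.nodes = .spider c 0 {a, b} ::ₘ C)
      (hn' : D'.nodes = C.map (Node.rename (Function.update id b a)))
      (hc : D'.circles = D.circles) : Step D D'
  /-- A scalar subdiagram `s` that does not denote the empty relation is dropped. -/
  | scalar (D D' : Diagram m n) (s : Diagram 0 0) (hs : s.interp.Nonempty)
      (hi : D'.input = D.input) (ho : D'.output = D.output)
      (hn : D.nodes = s.nodes + D'.nodes) (hc : D.circles = s.circles + D'.circles) : Step D D'

/-- Equality of diagrams within the graphical calculus: the rewrite rules can be applied any number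
of times and in both directions. -/
def Derivable {m n : ℕ} (D D' : Diagram m n) : Prop := Relation.EqvGen Step D D'

/-- The components of reversible single-toy-bit operators. -/
inductive Op
  | phase (c : Colour) (p : Phase)
  | had

/-- The node for `op` between the wires `a` and `b`. -/
def Op.node : Op → ℕ → ℕ → Node
  | .phase c p, a, b => .spider c p {a, b}
  | .had, a, b => .had s(a, b)

/-- The nodes of a sequence of operators, where the `k`-th of them sits between the wires `w k` and
`w (k + 1)`. -/
def chain : List Op → (ℕ → ℕ) → Multiset Node
  | [], _ => 0
  | op :: l, w => op.node (w 0) (w 1) ::ₘ chain l fun k => w (k + 1)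

open Classical in
/-- `D` is the GS-LO diagram with graph `G` and vertex operators `U`. It has a green node for each
vertex, a Hadamard-like node for each edge, connected to the green nodes of both end points, and on
the output of each vertex `v` the sequence `U v`, written from the graph state outwards.
Here `h v u` is the wire from the green node of `v` to the node of the edge `{v, u}`, and `w v k`
is the wire above the first `k` components of `U v`. -/
def IsGSLOWith {n : ℕ} (D : Diagram 0 n) (G : SimpleGraph (Fin n)) (U : Fin n → List Op) : Prop :=
  ∃ (h : Fin n → Fin n → ℕ) (w : Fin n → ℕ → ℕ),
    D.circles = 0 ∧
    (∀ v, D.output v = w v (U v).length) ∧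
    D.nodes =
      (Finset.univ.val.map fun v : Fin n =>
        Node.spider .green 0 (w v 0 ::ₘ (Finset.univ.filter fun u => G.Adj v u).val.map (h v))) +
      ((Finset.univ.filter fun e : Fin n × Fin n => e.1 < e.2 ∧ G.Adj e.1 e.2).val.map fun e =>
        Node.had s(h e.1 e.2, h e.2 e.1)) +
      ∑ v : Fin n, chain (U v) (w v)

/-- The set `R` of reduced vertex operators: the green phase shifts, and a green phase shift `01`
or `10` followed by the red phase shift `01`. -/
def R : Set (List Op) :=
  {l | (∃ a b : ZMod 2, l = [.phase .green (a, b)]) ∨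
    ∃ e : ZMod 2, l = [.phase .green (e, e + 1), .phase .red (0, 1)]}

/-- A vertex operator contains a red node. -/
def HasRed (l : List Op) : Prop := ∃ p : Phase, Op.phase .red p ∈ l

/-- Reduced GS-LO diagrams. -/
def IsReducedGSLO {n : ℕ} (D : Diagram 0 n) : Prop :=
  ∃ (G : SimpleGraph (Fin n)) (U : Fin n → List Op), IsGSLOWith D G U ∧
    (∀ v, U v ∈ R) ∧ ∀ u v, G.Adj u v → ¬ (HasRed (U u) ∧ HasRed (U v))

end ToyCalculus

namespace ToyCalculus

/-! ### Wires of nodes and diagrams -/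

/-! The argument is Gaussian elimination, in the manner of stabiliser states of qubits. State
diagrams modulo the calculus form the quotient `St n`, and fragments attached to the outputs act on
it: phase shifts, the node H, the controlled phase `cz`, the controlled permutation `cx`, and `cap`,
which closes the last output with a red `00` state.

The predicate `NF B` describes a normal form: a product of red states at the outputs in `B` and
green states elsewhere, acted on by `cz` and green phase shifts outside `B`, by `cx` with control
outside `B` and target in `B`, and by red `11` phase shifts in `B`. One should think of the outputs
outside `B` as free variables over the field with two elements, of those in `B` as affine functions
of the free ones, and of the phases and `cz` as a quadratic form in the free variables.

The normal forms are closed under all these reversible operations. A phase shift or a `cz` at a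
dependent output is pushed inwards through each `cx`, leaving phases and `cz` at the control
(`ph_cx_target`, `cz_cx`), until the red state absorbs it. The node H makes a dependent output free
(`NF.hd_mem`). At a free output `a`, `NF.exists_cxs` isolates the dependence on `a`. If a dependent
output `b` involves `a`, then `NF.pivot` exchanges their roles; otherwise H and the phase at `a`
combine to a red phase shift at a dependent output (`IsNF.hd`). The projection `cap` sets a free
variable to zero. For a dependent output it pivots first, unless the output is constant; then the
result is a normal form again or contains a legless spider of phase `11`, that is, it `Vanishes`
(`NF.cap_mem`, `Good.cap`).

Every diagram is reached by these operations. Cutting off a spider turns its legs into extra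
outputs, and a spider on outputs is a composite of phase shifts, H, `cx` and `cap`; nodes H are
three spiders by the Euler rule; without nodes only bare wires and circles remain, and a bare wire
is H applied to a `cz` of two green states. So each state has a normal form or vanishes (`allGood`).
The rules preserve satisfiability of the conditions of all nodes (`Step.sat_iff`), which excludes
the second case for a nonempty relation.

A normal form becomes a graph state with phases when H is applied to all outputs in `B`: each `cx`
becomes a `cz` with at most one end in `B`, and each red `11` a green `11`. The red phase shift `01`
equals green `01`, H, green `01`; applying these three operators to `B` and undoing them by the
self-inverse red shift leaves red nodes exactly on the independent set `B`, preceded by phases `01`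
or `10` (`NF.exists_graph`). This is a reduced GS-LO diagram. -/

@[simp] theorem toMultiset_mk (a b : ℕ) : (s(a, b) : Sym2 ℕ).toMultiset = {a, b} := rfl

theorem Node.legs_rename (f : ℕ → ℕ) (N : Node) : (N.rename f).legs = N.legs.map f := by
  cases N with
  | spider c p l => rfl
  | had e => induction e using Sym2.ind with
    | _ a b => simp [Node.rename, Node.legs]

theorem Node.rename_rename (f g : ℕ → ℕ) (N : Node) :
    (N.rename f).rename g = N.rename (g ∘ f) := by
  cases N <;> simp [Node.rename, Sym2.map_map]

theorem Node.rename_congr {f g : ℕ → ℕ} {N : Node} (h : ∀ x ∈ N.legs, f x = g x) :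
    N.rename f = N.rename g := by
  cases N with
  | spider c p l => exact congrArg (Node.spider c p) (Multiset.map_congr rfl h)
  | had e => induction e using Sym2.ind with
    | _ a b =>
      have ha := h a (by simp [Node.legs])
      have hb := h b (by simp [Node.legs])
      simp [Node.rename, ha, hb]

theorem Node.rename_id (N : Node) : N.rename id = N := by
  cases N <;> simp [Node.rename]

/-- The legs of all nodes of a fragment. -/
def legsOf (M : Multiset Node) : Multiset ℕ := M.bind Node.legs

@[simp] theorem legsOf_zero : legsOf 0 = 0 := rfl
@[simp] theorem legsOf_cons (N : Node) (M : Multiset Node) :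
    legsOf (N ::ₘ M) = N.legs + legsOf M := Multiset.cons_bind ..
@[simp] theorem legsOf_singleton (N : Node) : legsOf {N} = N.legs := Multiset.singleton_bind ..
@[simp] theorem legsOf_add (M M' : Multiset Node) : legsOf (M + M') = legsOf M + legsOf M' :=
  Multiset.add_bind ..

theorem legsOf_rename (f : ℕ → ℕ) (M : Multiset Node) :
    legsOf (M.map (Node.rename f)) = (legsOf M).map f := by
  simp only [legsOf, Multiset.bind_map, Multiset.map_bind, Node.legs_rename]

theorem mem_legsOf {M : Multiset Node} {N : Node} {x : ℕ} (hN : N ∈ M) (hx : x ∈ N.legs) :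
    x ∈ legsOf M := Multiset.mem_bind.2 ⟨N, hN, hx⟩

theorem map_rename_congr {f g : ℕ → ℕ} {M : Multiset Node} (h : ∀ x ∈ legsOf M, f x = g x) :
    M.map (Node.rename f) = M.map (Node.rename g) :=
  Multiset.map_congr rfl fun _ hN => Node.rename_congr fun x hx => h x (mem_legsOf hN hx)

theorem map_rename_id {f : ℕ → ℕ} {M : Multiset Node} (h : ∀ x ∈ legsOf M, f x = x) :
    M.map (Node.rename f) = M := by
  rw [map_rename_congr (g := id) h]
  simp [Node.rename_id]

/-- The wires at the outputs. -/
def ends {n : ℕ} (o : Fin n → ℕ) : Multiset ℕ := Finset.univ.val.map o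

theorem ends_comp {n : ℕ} (f : ℕ → ℕ) (o : Fin n → ℕ) : ends (f ∘ o) = (ends o).map f := by
  rw [ends, ends, Multiset.map_map]

theorem mem_ends {n : ℕ} (o : Fin n → ℕ) (i : Fin n) : o i ∈ ends o := by simp [ends]

theorem ends_update {n : ℕ} (o : Fin n → ℕ) (i : Fin n) (e : ℕ) :
    ends (Function.update o i e) + {o i} = ends o + {e} := by
  have h : (Finset.univ : Finset (Fin n)).val = i ::ₘ (Finset.univ.erase i).val := by
    rw [Finset.erase_val, Multiset.cons_erase (Finset.mem_univ_val i)]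
  have h2 : (Finset.univ.erase i).val.map (Function.update o i e) =
      (Finset.univ.erase i).val.map o :=
    Multiset.map_congr rfl fun j hj => by
      have : j ≠ i := Finset.ne_of_mem_erase (Finset.mem_def.2 hj)
      simp [this]
  rw [ends, ends, h, Multiset.map_cons, Multiset.map_cons, h2, Function.update_self,
    ← Multiset.singleton_add, ← Multiset.singleton_add]
  abel

variable {n : ℕ}

/-- All ends of wires of a state diagram. -/
def Diagram.wires (D : Diagram 0 n) : Multiset ℕ := ends D.output + legsOf D.nodes

theorem Diagram.count_wires (D : Diagram 0 n) (e : ℕ) :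
    D.wires.count e = 0 ∨ D.wires.count e = 2 := by
  simpa [Diagram.wires, ends, legsOf] using D.two_ends e

/-- A state diagram from its data. -/
def Diagram.state (o : Fin n → ℕ) (M : Multiset Node) (c : ℕ)
    (h : ∀ e, (ends o + legsOf M).count e = 0 ∨ (ends o + legsOf M).count e = 2) :
    Diagram 0 n where
  input := Fin.elim0
  output := o
  nodes := M
  circles := c
  two_ends e := by simpa [ends, legsOf] using h e

theorem Diagram.ext_state {D D' : Diagram 0 n} (ho : D.output = D'.output)
    (hn : D.nodes = D'.nodes) (hc : D.circles = D'.circles) : D = D' := by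
  cases D; cases D'
  simp only at ho hn hc
  subst ho hn hc
  congr
  exact Subsingleton.elim _ _

/-- State diagrams modulo the graphical calculus. -/
def St (n : ℕ) : Type := Quot (@Step 0 n)

/-- The class of a state diagram. -/
def cls (D : Diagram 0 n) : St n := Quot.mk _ D

theorem cls_step {D D' : Diagram 0 n} (h : Step D D') : cls D = cls D' := Quot.sound h

theorem derivable_of_cls_eq {D D' : Diagram 0 n} (h : cls D = cls D') : Derivable D D' :=
  Quot.eqvGen_exact h

theorem input_eq (f g : Fin 0 → ℕ) : f = g := Subsingleton.elim _ _

/-- The rewrite step demands a permutation of all names. A diagram uses finitely many wires, and an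
injection of a finite set of names into ℕ extends to a permutation. -/
theorem cls_relabel {D D' : Diagram 0 n} (f : ℕ → ℕ) (hf : Set.InjOn f {x | x ∈ D.wires})
    (ho : D'.output = f ∘ D.output) (hn : D'.nodes = D.nodes.map (Node.rename f))
    (hc : D'.circles = D.circles) : cls D = cls D' := by
  have hfin : ({x | x ∈ D.wires} : Set ℕ).Finite :=
    (D.wires.toFinset.finite_toSet).subset fun x hx => by simpa using hx
  obtain ⟨g, hg⟩ := Cardinal.extend_function_of_lt
    (⟨fun x => f x.1, fun x y h => Subtype.ext (hf x.2 y.2 h)⟩ :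
      ({x | x ∈ D.wires} : Set ℕ) ↪ ℕ)
    (lt_of_lt_of_le hfin.lt_aleph0 (by simp)) ⟨Equiv.refl _⟩
  have hg' : ∀ x ∈ D.wires, g x = f x := fun x hx => hg ⟨x, hx⟩
  refine cls_step (Step.relabel D D' g (input_eq _ _) ?_ ?_ hc)
  · rw [ho]; funext i
    exact (hg' _ (Multiset.mem_add.2 (Or.inl (mem_ends _ i)))).symm
  · rw [hn]
    exact map_rename_congr fun x hx => (hg' _ (Multiset.mem_add.2 (Or.inr hx))).symm

theorem Colour.swap_green : Colour.green.swap = .red := rfl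
theorem Colour.swap_red : Colour.red.swap = .green := rfl

@[simp] theorem legs_spider (c : Colour) (p : Phase) (l : Multiset ℕ) :
    (Node.spider c p l).legs = l := rfl
@[simp] theorem legs_had (a b : ℕ) : (Node.had s(a, b)).legs = {a, b} := rfl

/-! ### Equality of fragments in all contexts -/

/-- Two fragments may be replaced by each other in every state diagram. -/
def LEq (A B : Multiset Node) : Prop :=
  ∀ ⦃n : ℕ⦄ (D D' : Diagram 0 n) (C : Multiset Node), D.nodes = A + C → D'.nodes = B + C →
    D'.output = D.output → D'.circles = D.circles → cls D = cls D'

theorem LEq.refl (A : Multiset Node) : LEq A A := fun _ _ _ _ h h' ho hc =>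
  congrArg cls (Diagram.ext_state ho.symm (h.trans h'.symm) hc.symm)

theorem LEq.of_eq {A B : Multiset Node} (h : A = B) : LEq A B := h ▸ LEq.refl A

theorem LEq.symm {A B : Multiset Node} (h : LEq A B) : LEq B A :=
  fun _ D D' C hD hD' ho hc => (h D' D C hD' hD ho.symm hc.symm).symm

theorem LEq.rule {A B : Multiset Node} (h : LocalRule A B) : LEq A B :=
  fun _ D D' C hD hD' ho hc =>
    cls_step (Step.rule D D' A B C h (input_eq _ _) ho hD hD' hc)

theorem exists_fresh (s : Multiset ℕ) : ∃ N, ∀ x ∈ s, x < N :=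
  ⟨s.sum + 1, fun _ hx => Nat.lt_succ_of_le (Multiset.single_le_sum (fun _ _ => Nat.zero_le _) _ hx)⟩

/-- Rewriting a fragment of a diagram, where the result has inner wires `I` with fresh names. -/
theorem LEq.exists_rewrite {A B : Multiset Node} (h : LEq A B) (D : Diagram 0 n)
    (C : Multiset Node) (hD : D.nodes = A + C) (I J : Multiset ℕ)
    (hb : legsOf B + 2 • J = legsOf A + 2 • I) (hI : I.Nodup) (hN : ∀ e ∈ I, e ∉ D.wires) :
    ∃ D' : Diagram 0 n, D'.nodes = B + C ∧ D'.output = D.output ∧ D'.circles = D.circles ∧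
      cls D = cls D' := by
  have hw : D.wires = ends D.output + legsOf A + legsOf C := by
    rw [Diagram.wires, hD, legsOf_add, add_assoc]
  -- The balance `hb` changes the number of ends only by two: the wires in `J` disappear and those
  -- in `I`, which are fresh and distinct, appear with both ends.
  have key : ∀ e, (ends D.output + legsOf (B + C)).count e = 0 ∨
      (ends D.output + legsOf (B + C)).count e = 2 := by
    intro e
    have h1 := congrArg (Multiset.count e) hb
    have h2 := D.count_wires e
    have h3 : e ∈ I → D.wires.count e = 0 := fun he => Multiset.count_eq_zero.2 (hN e he)
    have h4 : I.count e = 0 ∨ (e ∈ I ∧ I.count e = 1) := by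
      by_cases he : e ∈ I
      · exact Or.inr ⟨he, Multiset.count_eq_one_of_mem hI he⟩
      · exact Or.inl (Multiset.count_eq_zero.2 he)
    rw [hw] at h2 h3
    simp only [Multiset.count_add, Multiset.count_nsmul, legsOf_add] at *
    rcases h4 with h4 | ⟨h4, h5⟩
    · omega
    · have := h3 h4
      omega
  exact ⟨.state D.output (B + C) D.circles key, rfl, rfl, rfl, h D _ C hD rfl rfl rfl⟩

/-- Transitivity, where the fragment in the middle has inner wires `I` with fresh names. -/
theorem LEq.trans {A E : Multiset Node} (B : ℕ → Multiset Node) (I J : ℕ → Multiset ℕ)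
    (hI : ∀ N, (I N).Nodup) (hN : ∀ N, ∀ e ∈ I N, N ≤ e)
    (hb : ∀ N, legsOf (B N) + 2 • J N = legsOf A + 2 • I N)
    (h₁ : ∀ N, LEq A (B N)) (h₂ : ∀ N, LEq (B N) E) : LEq A E := by
  intro n D D' C hD hD' ho hc
  obtain ⟨N, hlt⟩ := exists_fresh D.wires
  obtain ⟨F, h1, h2, h3, h4⟩ := (h₁ N).exists_rewrite D C hD (I N) (J N) (hb N) (hI N)
    fun e he hw => absurd (hlt e hw) (not_lt.2 (hN N e he))
  exact h4.trans (h₂ N F D' C h1 hD' (ho.trans h2.symm) (hc.trans h3.symm))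

/-- Transitivity, where the fragment in the middle has no new inner wires. -/
theorem LEq.trans₀ {A E : Multiset Node} (B : Multiset Node) (J : Multiset ℕ)
    (hb : legsOf B + 2 • J = legsOf A) (h₁ : LEq A B) (h₂ : LEq B E) : LEq A E :=
  LEq.trans (fun _ => B) (fun _ => 0) (fun _ => J) (by simp) (by simp) (by simpa using hb)
    (fun _ => h₁) (fun _ => h₂)

/-- Since equality of fragments quantifies over the rest of the diagram, the spectators `C` are
moved into that rest. The default proofs compare fragments up to reordering of nodes and of legs. -/
theorem LEq.sub {A B X Y : Multiset Node} (h : LEq A B) (C : Multiset Node)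
    (hX : X = A + C := by simp only [Multiset.insert_eq_cons, ← Multiset.singleton_add, Colour.swap_green,
      Colour.swap_red, add_zero, zero_add, @add_comm (Multiset ℕ), @add_left_comm (Multiset ℕ),
      @add_assoc (Multiset ℕ), @add_comm Phase] <;> abel)
    (hY : Y = B + C := by simp only [Multiset.insert_eq_cons, ← Multiset.singleton_add, Colour.swap_green,
      Colour.swap_red, add_zero, zero_add, @add_comm (Multiset ℕ), @add_left_comm (Multiset ℕ),
      @add_assoc (Multiset ℕ), @add_comm Phase] <;> abel) : LEq X Y := fun _ D D' C' hD hD' ho hc =>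
  h D D' (C + C') (by rw [hD, hX, add_assoc]) (by rw [hD', hY, add_assoc]) ho hc

/-- Rewriting a part of a fragment, where the result has inner wires `I` with fresh names. -/
theorem LEq.step {X A E : Multiset Node} {B : ℕ → Multiset Node} (h : ∀ N, LEq A (B N))
    (C : Multiset Node) (I : ℕ → Multiset ℕ) (J : Multiset ℕ) (h₂ : ∀ N, LEq (B N + C) E)
    (hX : X = A + C := by simp only [Multiset.insert_eq_cons, ← Multiset.singleton_add, Colour.swap_green,
      Colour.swap_red, add_zero, zero_add, @add_comm (Multiset ℕ), @add_left_comm (Multiset ℕ),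
      @add_assoc (Multiset ℕ), @add_comm Phase] <;> abel)
    (hb : ∀ N, legsOf (B N) + 2 • J = legsOf A + 2 • I N := by
      intro N
      simp only [Multiset.insert_eq_cons, ← Multiset.singleton_add, legsOf_add, legsOf_singleton,
        legsOf_zero, legs_spider, legs_had]
      abel)
    (hI : ∀ N, (I N).Nodup := by simp) (hN : ∀ N, ∀ e ∈ I N, N ≤ e := by simp) : LEq X E :=
  LEq.trans (fun N => B N + C) I (fun _ => J) hI hN
    (fun N => by rw [hX, legsOf_add, legsOf_add, add_right_comm, hb, add_right_comm])
    (fun N => (h N).sub C hX rfl) h₂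

/-- Rewriting a part of a fragment, where the inner wires `J` vanish. -/
theorem LEq.step₀ {X A B E : Multiset Node} (h : LEq A B) (C : Multiset Node) (J : Multiset ℕ)
    (h₂ : LEq (B + C) E)
    (hX : X = A + C := by simp only [Multiset.insert_eq_cons, ← Multiset.singleton_add, Colour.swap_green,
      Colour.swap_red, add_zero, zero_add, @add_comm (Multiset ℕ), @add_left_comm (Multiset ℕ),
      @add_assoc (Multiset ℕ), @add_comm Phase] <;> abel)
    (hb : legsOf B + 2 • J = legsOf A := by
      simp only [Multiset.insert_eq_cons, ← Multiset.singleton_add, legsOf_add, legsOf_singleton,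
        legsOf_zero, legs_spider, legs_had]
      abel) : LEq X E :=
  LEq.step (fun _ => h) C (fun _ => 0) J (fun _ => h₂) hX (fun _ => by simpa using hb)

theorem cls_scalar {D D' : Diagram 0 n} (s : Diagram 0 0) (hs : s.interp.Nonempty)
    (ho : D'.output = D.output) (hn : D.nodes = s.nodes + D'.nodes)
    (hc : D.circles = s.circles + D'.circles) : cls D = cls D' :=
  cls_step (Step.scalar D D' s hs (input_eq _ _) ho hn hc)

/-- Fragments without outer wires are dropped if they do not denote the empty relation. -/
theorem LEq.scalar {A : Multiset Node}
    (h : ∀ e, (legsOf A).count e = 0 ∨ (legsOf A).count e = 2)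
    (f : ℕ → Ontic) (hf : ∀ N ∈ A, N.Holds f) : LEq A 0 := by
  intro n D D' C hD hD' ho hc
  refine cls_scalar (.state Fin.elim0 A 0 fun e => (zero_add (legsOf A)).symm ▸ h e) ?_ ho ?_ ?_
  · exact ⟨(Fin.elim0, Fin.elim0), f, fun i => i.elim0, fun i => i.elim0, hf⟩
  · exact hD.trans (congrArg (A + ·) ((zero_add C).symm.trans hD'.symm))
  · rw [hc]; exact (zero_add _).symm

end ToyCalculus

/-! ### Derived rules: Hopf law, involutivity of H, coincidence of the `01` states -/

namespace ToyCalculus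

@[simp] theorem Colour.swap_swap (c : Colour) : c.swap.swap = c := by cases c <;> rfl

theorem LEq.fuse (c : Colour) (p q : Phase) (e : ℕ) (S T : Multiset ℕ) :
    LEq {.spider c p (e ::ₘ S), .spider c q (e ::ₘ T)} {.spider c (p + q) (S + T)} :=
  .rule (.spider c p q e S T)

theorem count_map_update {a b : ℕ} (hab : a ≠ b) (R : Multiset ℕ) (e : ℕ) :
    (R.map (Function.update id b a)).count e =
      if e = a then R.count a + R.count b else if e = b then 0 else R.count e := by
  induction R using Multiset.induction with
  | empty => simp
  | cons x R ih =>
    rw [Multiset.map_cons, Multiset.count_cons, ih]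
    simp only [Multiset.count_cons, Function.update_apply, id]
    split_ifs <;> (try subst_vars) <;> omega

/-- The contracted diagram is legitimate: each of the distinct wires `a` and `b` has exactly one end
away from the removed node, so the merged wire has two. -/
theorem exists_identity {n : ℕ} (D : Diagram 0 n) (c : Colour) (a b : ℕ) (C : Multiset Node)
    (hab : a ≠ b) (hn : D.nodes = .spider c 0 {a, b} ::ₘ C) :
    ∃ D' : Diagram 0 n, cls D = cls D' ∧ D'.output = Function.update id b a ∘ D.output ∧
      D'.nodes = C.map (Node.rename (Function.update id b a)) ∧ D'.circles = D.circles := by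
  have hw : D.wires = {a} + {b} + (ends D.output + legsOf C) := by
    rw [Diagram.wires, hn, legsOf_cons, legs_spider]
    rw [Multiset.insert_eq_cons, ← Multiset.singleton_add]
    abel
  refine ⟨.state (Function.update id b a ∘ D.output)
    (C.map (Node.rename (Function.update id b a))) D.circles ?_, cls_step (Step.identity D _ c a b C hab (input_eq _ _) rfl hn
    rfl rfl), rfl, rfl, rfl⟩
  intro e
  rw [ends_comp, legsOf_rename, ← Multiset.map_add, count_map_update hab]
  have h1 := D.count_wires a
  have h2 := D.count_wires b
  have h3 := D.count_wires e
  rw [hw] at h1 h2 h3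
  simp only [Multiset.count_add (s := {a} + {b}), Multiset.count_add (s := {a}),
    Multiset.count_singleton, if_true, hab, hab.symm, if_false] at h1 h2 h3
  split_ifs at h3 ⊢ <;> omega

/-- The identity rule needs two distinct wires. On a single wire the loop rule leaves a legless `00`
spider instead, which is a nonempty scalar. -/
theorem cls_remove_loop {n : ℕ} {D D' : Diagram 0 n} (c : Colour) (a : ℕ)
    (hn : D.nodes = .spider c 0 {a, a} ::ₘ D'.nodes) (ho : D'.output = D.output)
    (hc : D'.circles = D.circles) : cls D = cls D' := by
  have h : LEq {.spider c 0 {a, a}} 0 := by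
    refine LEq.trans₀ {.spider c 0 0} {a} (by simp; rfl) (.rule (.loop c 0 a 0)) ?_
    refine LEq.scalar (fun e => by simp) (fun _ => 0) ?_
    intro N hN
    rw [Multiset.mem_singleton] at hN
    subst hN
    cases c <;> exact ⟨0, by simp, by simp⟩
  refine h D D' D'.nodes ?_ (zero_add _).symm ho hc
  rw [hn, Multiset.singleton_add]

/-- An identity node does not depend on its colour. -/
theorem LEq.identity_swap (c c' : Colour) (a b : ℕ) :
    LEq {.spider c 0 {a, b}} {.spider c' 0 {a, b}} := by
  intro n D D' C hD hD' ho hc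
  rw [Multiset.singleton_add] at hD hD'
  by_cases hab : a = b
  · subst hab
    have key : ∀ e, (ends D.output + legsOf C).count e = 0 ∨
        (ends D.output + legsOf C).count e = 2 := by
      intro e
      have h := D.count_wires e
      rw [Diagram.wires, hD, legsOf_cons, legs_spider] at h
      simp only [Multiset.count_add, Multiset.insert_eq_cons, Multiset.count_cons,
        Multiset.count_singleton] at h ⊢
      split_ifs at h <;> omega
    let E : Diagram 0 n := .state D.output C D.circles key
    exact (cls_remove_loop c a (D' := E) hD rfl rfl).trans
      (cls_remove_loop c' a (D' := E) hD' ho.symm hc.symm).symm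
  · obtain ⟨E, h1, h2, h3, h4⟩ := exists_identity D c a b C hab hD
    obtain ⟨E', h1', h2', h3', h4'⟩ := exists_identity D' c' a b C hab hD'
    rw [h1, h1']
    exact congrArg cls (Diagram.ext_state (by rw [h2, h2', ho]) (by rw [h3, h3'])
      (by rw [h4, h4', hc]))

theorem LEq.euler (c : Colour) (a b e e' : ℕ) : LEq {.had s(a, b)}
    {.spider c (0, 1) {a, e}, .spider c.swap (0, 1) {e, e'}, .spider c (0, 1) {e', b}} :=
  .rule (.euler c a b e e')

/-- The Euler decomposition of H begins with a spider of colour `c`, into which the `00` node fuses.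
No wire has to be renamed, unlike in the identity rule. -/
theorem LEq.absorb_had (c : Colour) (a b d : ℕ) :
    LEq {.spider c 0 {a, b}, .had s(b, d)} {.had s(a, d)} := by
  refine LEq.step (fun N => LEq.euler c b d N (N + 1)) {.spider c 0 {a, b}}
    (fun N => {N, N + 1}) 0 fun N => ?_
  refine LEq.step₀ (LEq.fuse c 0 (0, 1) b {a} {N}) {.spider c.swap (0, 1) {N, N + 1},
       .spider c (0, 1) {N + 1, d}} {b} ?_
  exact (LEq.euler c a d N (N + 1)).symm.sub 0

theorem LEq.colour₁ (c : Colour) (p : Phase) (a x : ℕ) :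
    LEq {.spider c p {a}} {.spider c.swap p {x}, .had s(x, a)} :=
  .rule (LocalRule.colour c p {(x, a)})

theorem LEq.colour₂ (c : Colour) (p : Phase) (a b x y : ℕ) :
    LEq {.spider c p {a, b}} {.spider c.swap p {x, y}, .had s(x, a), .had s(y, b)} :=
  .rule (by simpa using LocalRule.colour c p {(x, a), (y, b)})

theorem LEq.colour₃ (c : Colour) (p : Phase) (a b d x y z : ℕ) :
    LEq {.spider c p {a, b, d}}
      {.spider c.swap p {x, y, z}, .had s(x, a), .had s(y, b), .had s(z, d)} :=
  .rule (by simpa using LocalRule.colour c p {(x, a), (y, b), (z, d)})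

/-- The Hadamard-like node is an involution. -/
theorem LEq.had_had (c : Colour) (x m y : ℕ) :
    LEq {.had s(x, m), .had s(m, y)} {.spider c 0 {x, y}} := by
  rw [Sym2.eq_swap (a := x)]
  -- An identity node of the other colour is inserted between the two nodes H. With H on both legs
  -- it is, by colour change, an identity node of colour `c`.
  refine LEq.step (fun N => (LEq.absorb_had c.swap m N x).symm) {.had s(m, y)}
    (fun N => {N}) 0 fun N => ?_
  exact (LEq.colour₂ c 0 x y N m).symm.sub 0

theorem LEq.copy (c : Colour) (a b e : ℕ) : LEq {.spider c.swap 0 {e}, .spider c 0 {e, a, b}}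
    {.spider c.swap 0 {a}, .spider c.swap 0 {b}} := .rule (.copy c a b e)

theorem LEq.copy_swap (c : Colour) (a b e : ℕ) : LEq {.spider c 0 {e}, .spider c.swap 0 {e, a, b}}
    {.spider c 0 {a}, .spider c 0 {b}} := by simpa using LEq.copy c.swap a b e

/-- A legless spider requires one of its two phase bits to vanish, so `11` is the only phase that
denotes the empty relation. -/
theorem LEq.scalar_spider (c : Colour) (p : Phase) (hp : p ≠ (1, 1)) :
    LEq {.spider c p 0} 0 := by
  refine LEq.scalar (fun e => by simp) (fun _ => 0) ?_
  intro N hN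
  rw [Multiset.mem_singleton] at hN
  subst hN
  have hu : ∃ u : ZMod 2, 0 = if u = 0 then p.1 else p.2 := by
    revert p; decide
  obtain ⟨u, hu⟩ := hu
  cases c <;> exact ⟨u, by simp, hu⟩

/-- Seen from colour `c`, the other colour's state only fixes the first bit to be `0`; the second
bit is then free to be the corresponding phase bit. -/
theorem LEq.scalar_pair (c : Colour) (p : Phase) (e : ℕ) :
    LEq {.spider c.swap 0 {e}, .spider c p {e}} 0 := by
  refine LEq.scalar (fun x => ?_) (fun _ => match c with
    | .green => (0, p.1)
    | .red => (p.1, 0)) ?_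
  · simp only [Multiset.insert_eq_cons, legsOf_cons, legsOf_singleton, legs_spider,
      Multiset.count_add, Multiset.count_singleton]
    split_ifs <;> simp
  · intro N hN
    rw [Multiset.insert_eq_cons, Multiset.mem_cons, Multiset.mem_singleton] at hN
    rcases hN with rfl | rfl <;> cases c
    · exact ⟨p.1, by simp, by simp⟩
    · exact ⟨p.1, by simp, by simp⟩
    · exact ⟨0, by simp, by simp⟩
    · exact ⟨0, by simp, by simp⟩

/-- Splitting off an identity node. -/
theorem LEq.split (c : Colour) (p q : Phase) (S T : Multiset ℕ) (e : ℕ) :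
    LEq {.spider c (p + q) (S + T)} {.spider c p (e ::ₘ S), .spider c q (e ::ₘ T)} :=
  (LEq.fuse c p q e S T).symm

/-- One of the two parallel wires is interrupted by an identity node of colour `c`. This node and
the adjacent one of the other colour each receive an extra leg ending in a `00` state of their own
colour, so that the bialgebra rule applies. Both states are then copied, which separates `a` from
`b` and leaves a droppable scalar on the wire between. -/
theorem LEq.hopf₃ (c : Colour) (a b x y : ℕ) :
    LEq {.spider c 0 {a, x, y}, .spider c.swap 0 {x, y, b}}
      {.spider c 0 {a}, .spider c.swap 0 {b}} := by
  refine LEq.step (fun p => LEq.split c.swap 0 0 {x} {y, b} p) {.spider c 0 {a, x, y}}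
    (fun p => {p}) 0 fun p => ?_
  refine LEq.step (fun q => LEq.split c.swap 0 0 {x} {p} q)
    {.spider c 0 {a, x, y}, .spider c.swap 0 {p, y, b}} (fun q => {q}) 0 fun q => ?_
  refine LEq.step₀ (LEq.identity_swap c.swap c q p)
    {.spider c 0 {a, x, y}, .spider c.swap 0 {p, y, b}, .spider c.swap 0 {q, x}} 0 ?_
  refine LEq.step (fun r => LEq.split c.swap 0 0 {q, x} 0 r)
    {.spider c 0 {a, x, y}, .spider c.swap 0 {p, y, b}, .spider c 0 {q, p}}
    (fun r => {r}) 0 fun r => ?_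
  refine LEq.step (fun t => LEq.split c 0 0 {q, p} 0 t)
    {.spider c 0 {a, x, y}, .spider c.swap 0 {p, y, b}, .spider c.swap 0 {r, q, x},
      .spider c.swap 0 {r}} (fun t => {t}) 0 fun t => ?_
  refine LEq.step (fun e => .rule (.bialgebra c a t r b x y q p e))
    {.spider c.swap 0 {r}, .spider c 0 {t}} (fun e => {e}) {x, y, q, p} fun e => ?_
  refine LEq.step₀ (LEq.copy c e b r) {.spider c.swap 0 {a, t, e}, .spider c 0 {t}} {r} ?_
  refine LEq.step₀ (LEq.copy_swap c a e t) {.spider c.swap 0 {e}, .spider c.swap 0 {b}} {t} ?_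
  exact (LEq.scalar_pair c 0 e).sub {.spider c 0 {a}, .spider c.swap 0 {b}}

/-- Two wires between spiders of different colours can be cut. -/
theorem LEq.hopf (c : Colour) (p q : Phase) (x y : ℕ) (S T : Multiset ℕ) :
    LEq {.spider c p (x ::ₘ y ::ₘ S), .spider c.swap q (x ::ₘ y ::ₘ T)}
      {.spider c p S, .spider c.swap q T} := by
  refine LEq.step (fun a => LEq.split c p 0 S {x, y} a) {.spider c.swap q (x ::ₘ y ::ₘ T)}
    (fun a => {a}) 0 fun a => ?_
  refine LEq.step (fun b => LEq.split c.swap q 0 T {x, y} b)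
    {.spider c p (a ::ₘ S), .spider c 0 {a, x, y}} (fun b => {b}) 0 fun b => ?_
  refine LEq.step₀ (LEq.hopf₃ c a b x y)
    {.spider c p (a ::ₘ S), .spider c.swap q (b ::ₘ T)} {x, y} ?_
  refine LEq.step₀ (LEq.fuse c p 0 a S 0)
    {.spider c.swap 0 {b}, .spider c.swap q (b ::ₘ T)} {a} ?_
  exact (LEq.fuse c.swap q 0 b T 0).sub {.spider c p S}

theorem zero_one_add_zero_one : ((0, 1) + (0, 1) : Phase) = 0 := by decide

/-- The phase is moved to a leg of its own; after copying, it meets a `00` state of the other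
colour, and this pair is a nonempty scalar. -/
theorem LEq.copy_phase (c : Colour) (p : Phase) (e a : ℕ) :
    LEq {.spider c.swap 0 {e}, .spider c p {e, a}} {.spider c.swap 0 {a}} := by
  refine LEq.step (fun t => LEq.split c 0 p {e, a} 0 t) {.spider c.swap 0 {e}}
    (fun t => {t}) 0 fun t => ?_
  refine LEq.step₀ (LEq.copy c t a e) {.spider c p {t}} {e} ?_
  exact (LEq.scalar_pair c p t).sub {.spider c.swap 0 {a}}

/-- Writing the `01` state as a `01` phase shift on the `00` state and inserting two cancelling `01`
phase shifts of colour `c` after the other colour's shift produces the Euler form of H on a `00`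
state. That is a `00` state of the other colour, which absorbs the remaining phase shift. -/
theorem LEq.phase_state_aux (c : Colour) (f k : ℕ) :
    LEq {.spider c (0, 1) {f}, .spider c.swap (0, 1) {f, k}} {.spider c.swap 0 {k}} := by
  refine LEq.step (fun g => LEq.split c.swap (0, 1) 0 {f} {k} g) {.spider c (0, 1) {f}}
    (fun g => {g}) 0 fun g => ?_
  refine LEq.step₀ (LEq.identity_swap c.swap c g k)
    {.spider c (0, 1) {f}, .spider c.swap (0, 1) {g, f}} 0 ?_
  refine LEq.step (fun h => LEq.split c (0, 1) (0, 1) {g} {k} h)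
    {.spider c (0, 1) {f}, .spider c.swap (0, 1) {g, f}} (fun h => {h}) 0 (fun h => ?_)
    (by rw [zero_one_add_zero_one]; simp only [Multiset.insert_eq_cons, ← Multiset.singleton_add,
      @add_comm (Multiset ℕ)] <;> abel)
  refine LEq.step (fun e => LEq.split c 0 (0, 1) 0 {f} e)
    {.spider c.swap (0, 1) {g, f}, .spider c (0, 1) {h, g}, .spider c (0, 1) {h, k}}
    (fun e => {e}) 0 fun e => ?_
  refine LEq.step₀ (LEq.euler c e h f g).symm {.spider c 0 {e}, .spider c (0, 1) {h, k}}
    {f, g} ?_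
  refine LEq.step₀ (B := {.spider c.swap 0 {h}})
    (by simpa using (LEq.colour₁ c.swap 0 h e).symm) {.spider c (0, 1) {h, k}} {e} ?_
  exact LEq.copy_phase c (0, 1) h k

/-- The `01` phase states of the two colours agree. -/
theorem LEq.phase_state (c : Colour) (h : ℕ) :
    LEq {.spider c (0, 1) {h}} {.spider c.swap (0, 1) {h}} := by
  refine LEq.step (fun f => LEq.split c (0, 1) 0 0 {h} f) 0 (fun f => {f}) 0 fun f => ?_
  refine LEq.step₀ (LEq.identity_swap c c.swap f h) {.spider c (0, 1) {f}} 0 ?_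
  refine LEq.step (fun k => LEq.split c.swap (0, 1) (0, 1) {f} {h} k) {.spider c (0, 1) {f}}
    (fun k => {k}) 0 (fun k => ?_)
    (by rw [zero_one_add_zero_one]; simp only [Multiset.insert_eq_cons, ← Multiset.singleton_add,
      @add_comm (Multiset ℕ)] <;> abel)
  refine LEq.step₀ (LEq.phase_state_aux c f k) {.spider c.swap (0, 1) {k, h}} {f} ?_
  exact (LEq.fuse c.swap 0 (0, 1) k 0 {h}).sub 0

/-- This is the Euler decomposition solved for its middle factor; the outer `01` phase shifts are
self-inverse. -/
theorem LEq.euler_phase (c : Colour) (x y e f : ℕ) :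
    LEq {.spider c (0, 1) {x, e}, .had s(e, f), .spider c (0, 1) {f, y}}
      {.spider c.swap (0, 1) {x, y}} := by
  refine LEq.step (fun N => LEq.euler c e f N (N + 1))
    {.spider c (0, 1) {x, e}, .spider c (0, 1) {f, y}} (fun N => {N, N + 1}) 0 fun N => ?_
  refine LEq.step₀ (LEq.fuse c (0, 1) (0, 1) e {x} {N}) {.spider c.swap (0, 1) {N, N + 1},
    .spider c (0, 1) {N + 1, f}, .spider c (0, 1) {f, y}} {e} ?_
  refine LEq.step₀ (LEq.fuse c (0, 1) (0, 1) f {N + 1} {y})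
    {.spider c.swap (0, 1) {N, N + 1}, .spider c ((0, 1) + (0, 1)) {x, N}} {f} ?_
  rw [zero_one_add_zero_one]
  refine LEq.step₀ (LEq.identity_swap c c.swap x N)
    {.spider c.swap (0, 1) {N, N + 1}, .spider c 0 {N + 1, y}} 0 ?_
  refine LEq.step₀ (LEq.identity_swap c c.swap (N + 1) y)
    {.spider c.swap (0, 1) {N, N + 1}, .spider c.swap 0 {x, N}} 0 ?_
  refine LEq.step₀ (LEq.fuse c.swap (0, 1) 0 N {N + 1} {x})
    {.spider c.swap 0 {N + 1, y}} {N} ?_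
  exact (LEq.fuse c.swap (0, 1) 0 (N + 1) {x} {y}).sub 0

end ToyCalculus

/-! ### Gates and their action on states modulo the calculus -/

namespace ToyCalculus

variable {n m k : ℕ}

theorem LocalRule.rename {A B : Multiset Node} (h : LocalRule A B) (f : ℕ → ℕ) :
    LocalRule (A.map (Node.rename f)) (B.map (Node.rename f)) := by
  cases h with
  | spider c p q e S T =>
    simpa [Node.rename] using LocalRule.spider c p q (f e) (S.map f) (T.map f)
  | loop c p e S => simpa [Node.rename] using LocalRule.loop c p (f e) (S.map f)
  | bialgebra c a₁ a₂ b₁ b₂ e₁₁ e₁₂ e₂₁ e₂₂ e =>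
    simpa [Node.rename] using LocalRule.bialgebra c (f a₁) (f a₂) (f b₁) (f b₂) (f e₁₁) (f e₁₂)
      (f e₂₁) (f e₂₂) (f e)
  | copy c a b e => simpa [Node.rename] using LocalRule.copy c (f a) (f b) (f e)
  | copy11 c a e L =>
    simpa [Node.rename, Multiset.map_map, Function.comp_def] using
      LocalRule.copy11 c (f a) (f e) (L.map (Prod.map f f))
  | comm11 c x y a b e e' =>
    simpa [Node.rename] using LocalRule.comm11 c x y (f a) (f b) (f e) (f e')
  | colour c p L =>
    simpa [Node.rename, Multiset.map_map, Function.comp_def] using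
      LocalRule.colour c p (L.map (Prod.map f f))
  | euler c a b e e' => simpa [Node.rename] using LocalRule.euler c (f a) (f b) (f e) (f e')

/-- Renaming the wires of a diagram. -/
def Diagram.rename (D : Diagram 0 n) (f : ℕ → ℕ) (hf : f.Injective) : Diagram 0 n :=
  .state (f ∘ D.output) (D.nodes.map (Node.rename f)) D.circles fun e => by
    rw [ends_comp, legsOf_rename, ← Multiset.map_add]
    by_cases he : ∃ x, f x = e
    · obtain ⟨x, rfl⟩ := he
      rw [Multiset.count_map_eq_count' f _ hf]
      exact D.count_wires x
    · left
      rw [Multiset.count_eq_zero, Multiset.mem_map]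
      rintro ⟨x, -, hx⟩
      exact he ⟨x, hx⟩

theorem Diagram.wires_rename (D : Diagram 0 n) (f : ℕ → ℕ) (hf : f.Injective) :
    (D.rename f hf).wires = D.wires.map f := by
  rw [Diagram.wires, Diagram.wires, Multiset.map_add, ← ends_comp, ← legsOf_rename]
  rfl

theorem Node.holds_rename (N : Node) (f : ℕ → ℕ) (g : ℕ → Ontic) :
    (N.rename f).Holds g ↔ N.Holds (g ∘ f) := by
  cases N with
  | spider c p l =>
    cases c <;> simp [Node.rename, Node.Holds, Multiset.map_map]
  | had e => simp [Node.rename, Node.Holds, Sym2.map_map]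

theorem Node.holds_congr {N : Node} {f g : ℕ → Ontic} (h : ∀ x ∈ N.legs, f x = g x) :
    N.Holds f ↔ N.Holds g := by
  cases N with
  | spider c p l =>
    cases c
    · exact iff_of_eq (congrArg (GreenSpider p) (Multiset.map_congr rfl h))
    · exact iff_of_eq (congrArg (GreenSpider p)
        (Multiset.map_congr rfl fun x hx => congrArg Prod.swap (h x hx)))
  | had e => induction e using Sym2.ind with
    | _ a b =>
      have ha := h a (by simp)
      have hb := h b (by simp)
      simp [Node.Holds, ha, hb]

/-- A fragment with `n` inputs and `m` outputs. The wires at the inputs are `0, …, n - 1`, those in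
`inner` have both ends in the fragment or at its outputs. -/
structure Gate (n m : ℕ) where
  out : Fin m → ℕ
  nodes : Multiset Node
  inner : Finset ℕ
  le_inner : ∀ e ∈ inner, n ≤ e
  bal : ends out + legsOf nodes = Multiset.range n + 2 • inner.val

theorem ends_val : ends (Fin.val : Fin n → ℕ) = Multiset.range n := by
  have h := congrArg Finset.val (Fin.map_valEmbedding_univ (n := n))
  rw [Finset.map_val, Nat.Iio_eq_range] at h
  exact h

theorem map_range_eq_ends (ρ : ℕ → ℕ) (o : Fin n → ℕ) (h : ∀ i : Fin n, ρ i = o i) :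
    (Multiset.range n).map ρ = ends o := by
  rw [← ends_val, ← ends_comp]
  exact congrArg ends (funext h)

/-- By `bal` each input of the gate occurs once at its legs and outputs, taking the place of the
output end of `D` to which it is glued, and each inner wire occurs twice. -/
theorem Gate.wires_glue (K : Gate n m) (D : Diagram 0 n) (ρ : ℕ → ℕ)
    (hρ : ∀ i : Fin n, ρ i = D.output i) :
    ends (ρ ∘ K.out) + legsOf (K.nodes.map (Node.rename ρ) + D.nodes) =
      D.wires + 2 • K.inner.val.map ρ := by
  rw [legsOf_add, legsOf_rename, ends_comp, ← add_assoc, ← Multiset.map_add, K.bal,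
    Multiset.map_add, map_range_eq_ends ρ _ hρ, Diagram.wires, Multiset.map_nsmul]
  abel

/-- The diagram where `K` is put on the outputs of `D`, with the wires of `K` named by `ρ`. -/
def Gate.glue (K : Gate n m) (D : Diagram 0 n) (ρ : ℕ → ℕ)
    (hρ : ∀ i : Fin n, ρ i = D.output i) (hinj : Set.InjOn ρ K.inner)
    (hfresh : ∀ e ∈ K.inner, ρ e ∉ D.wires) : Diagram 0 m :=
  .state (ρ ∘ K.out) (K.nodes.map (Node.rename ρ) + D.nodes) D.circles fun e => by
    rw [K.wires_glue D ρ hρ, Multiset.count_add, Multiset.count_nsmul]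
    have hnd : (K.inner.val.map ρ).Nodup :=
      Multiset.Nodup.map_on (fun x hx y hy h => hinj hx hy h) K.inner.nodup
    by_cases he : e ∈ K.inner.val.map ρ
    · rw [Multiset.count_eq_one_of_mem hnd he]
      obtain ⟨x, hx, rfl⟩ := Multiset.mem_map.1 he
      rw [Multiset.count_eq_zero.2 (hfresh x hx)]
      simp
    · rw [Multiset.count_eq_zero.2 he]
      simpa using D.count_wires e

theorem two_mul_injective : (fun x : ℕ => 2 * x).Injective := fun _ _ h => by
  simpa using h

/-- The names of the wires in `Gate.comp`. -/
def Diagram.names (D : Diagram 0 n) (j : ℕ) : ℕ :=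
  -- Wires of the state get even names and inner wires of the gate odd ones, so they never clash,
  -- and the odd names do not depend on the state.
  if h : j < n then 2 * D.output ⟨j, h⟩ else 2 * j + 1

theorem Diagram.names_of_le (D : Diagram 0 n) {j : ℕ} (h : n ≤ j) : D.names j = 2 * j + 1 :=
  dif_neg (not_lt.2 h)

theorem Diagram.names_val (D : Diagram 0 n) (i : Fin n) : D.names i = 2 * D.output i :=
  dif_pos i.2

theorem Diagram.names_comp (D D' : Diagram 0 n) (f g : ℕ → ℕ) (h : D'.output = f ∘ D.output)
    (h0 : ∀ x, g (2 * x) = 2 * f x) (h1 : ∀ x, g (2 * x + 1) = 2 * x + 1) :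
    D'.names = g ∘ D.names := by
  funext j
  by_cases hj : j < n <;> simp [Diagram.names, hj, h, h0, h1]

/-- The diagram where `K` is put on the outputs of `D`, with canonical names. -/
def Gate.comp (K : Gate n m) (D : Diagram 0 n) : Diagram 0 m :=
  K.glue (D.rename (2 * ·) two_mul_injective) D.names D.names_val
    (fun x hx y hy h => by
      have h : D.names x = D.names y := h
      rw [D.names_of_le (K.le_inner x hx), D.names_of_le (K.le_inner y hy)] at h
      omega)
    (fun x hx h => by
      rw [D.names_of_le (K.le_inner x hx), D.wires_rename, Multiset.mem_map] at h
      obtain ⟨y, -, hy⟩ := h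
      omega)

theorem Gate.comp_output (K : Gate n m) (D : Diagram 0 n) :
    (K.comp D).output = D.names ∘ K.out := rfl
theorem Gate.comp_nodes (K : Gate n m) (D : Diagram 0 n) :
    (K.comp D).nodes = K.nodes.map (Node.rename D.names) +
      D.nodes.map (Node.rename (2 * ·)) := rfl

/-- The map on wires of `Gate.comp` which is `f` on the wires of the state. -/
def onEven (f : ℕ → ℕ) (x : ℕ) : ℕ := if x % 2 = 0 then 2 * f (x / 2) else x

theorem onEven_even (f : ℕ → ℕ) (x : ℕ) : onEven f (2 * x) = 2 * f x := by simp [onEven]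
theorem onEven_odd (f : ℕ → ℕ) (x : ℕ) : onEven f (2 * x + 1) = 2 * x + 1 := by
  simp [onEven, Nat.add_mod]

theorem map_rename_onEven (f : ℕ → ℕ) (M : Multiset Node) :
    (M.map (Node.rename f)).map (Node.rename (2 * ·)) =
      (M.map (Node.rename (2 * ·))).map (Node.rename (onEven f)) := by
  rw [Multiset.map_map, Multiset.map_map]
  refine Multiset.map_congr rfl fun N _ => ?_
  simp only [Function.comp_apply, Node.rename_rename]
  refine Node.rename_congr fun x _ => (onEven_even f x).symm

theorem map_rename_names {D D' : Diagram 0 n} (f : ℕ → ℕ) (h : D'.output = f ∘ D.output)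
    (M : Multiset Node) : M.map (Node.rename D'.names) =
      (M.map (Node.rename D.names)).map (Node.rename (onEven f)) := by
  rw [D.names_comp D' f _ h (onEven_even f) (onEven_odd f), Multiset.map_map]
  exact Multiset.map_congr rfl fun N _ => (Node.rename_rename ..).symm

theorem names_congr {D D' : Diagram 0 n} (h : D'.output = D.output) : D'.names = D.names := by
  unfold Diagram.names
  rw [h]

/-- A step on the state lifts to the composite because it only touches even names. Relabellings and
contractions are extended by the identity on the odd names (`onEven`). This makes the action on the
quotient well defined. -/
theorem Gate.cls_comp (K : Gate n m) {D D' : Diagram 0 n} (h : Step D D') :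
    cls (K.comp D) = cls (K.comp D') := by
  cases h with
  | relabel f hi ho hn hc =>
    refine cls_relabel (onEven f) ?_ ?_ ?_ hc
    · intro x _ y _ hxy
      rcases Nat.even_or_odd' x with ⟨x', rfl | rfl⟩ <;>
        rcases Nat.even_or_odd' y with ⟨y', rfl | rfl⟩ <;>
        simp only [onEven_even, onEven_odd] at hxy
      · have : f x' = f y' := by omega
        rw [f.injective this]
      · omega
      · omega
      · exact hxy
    · rw [K.comp_output, K.comp_output, D.names_comp D' f _ ho (onEven_even f) (onEven_odd f)]
      rfl
    · rw [K.comp_nodes, K.comp_nodes, map_rename_names f ho, hn, map_rename_onEven,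
        Multiset.map_add]
  | rule A B C h hi ho hA hB hc =>
    refine cls_step (Step.rule _ _ _ _ (K.nodes.map (Node.rename D.names) +
      C.map (Node.rename (2 * ·))) (h.rename (2 * ·)) (input_eq _ _) ?_ ?_ ?_ hc)
    · rw [K.comp_output, K.comp_output, names_congr ho]
    · rw [K.comp_nodes, hA, Multiset.map_add]
      abel
    · rw [K.comp_nodes, hB, Multiset.map_add, names_congr ho]
      abel
  | identity c a b C hab hi ho hn hn' hc =>
    have hf : onEven (Function.update id b a) = Function.update id (2 * b) (2 * a) := by
      funext x
      rcases Nat.even_or_odd' x with ⟨x', rfl | rfl⟩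
      · rw [onEven_even]
        by_cases hx : x' = b <;> simp [hx]
      · rw [onEven_odd]
        rw [Function.update_of_ne (by omega)]
        rfl
    refine cls_step (Step.identity _ _ c (2 * a) (2 * b) (K.nodes.map (Node.rename D.names) +
      C.map (Node.rename (2 * ·))) (by omega) (input_eq _ _) ?_ ?_ ?_ hc)
    · rw [K.comp_output, K.comp_output,
        D.names_comp D' _ _ ho (onEven_even _) (onEven_odd _), hf]
      rfl
    · rw [K.comp_nodes, hn, Multiset.map_cons, Multiset.add_cons]
      simp [Node.rename]
    · rw [K.comp_nodes, map_rename_names _ ho, hn', map_rename_onEven, hf, Multiset.map_add]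
  | scalar s hs hi ho hn hc =>
    refine cls_scalar (s.rename (2 * ·) two_mul_injective) ?_ ?_ ?_ hc
    · obtain ⟨⟨x, y⟩, f, h1, h2, h3⟩ := hs
      refine ⟨(Fin.elim0, Fin.elim0), fun x => f (x / 2), fun i => i.elim0, fun i => i.elim0, ?_⟩
      intro N hN
      obtain ⟨M, hM, rfl⟩ := Multiset.mem_map.1 hN
      rw [Node.holds_rename]
      refine (Node.holds_congr fun x _ => ?_).1 (h3 M hM)
      simp
    · rw [K.comp_output, K.comp_output, names_congr ho]
    · rw [K.comp_nodes, K.comp_nodes, names_congr ho, hn, Multiset.map_add]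
      change _ = Multiset.map _ _ + _
      abel

/-- The operation of a gate on states. -/
def Gate.act (K : Gate n m) : St n → St m :=
  Quot.lift (fun D => cls (K.comp D)) fun _ _ h => K.cls_comp h

theorem Gate.act_cls (K : Gate n m) (D : Diagram 0 n) : K.act (cls D) = cls (K.comp D) := rfl

/-- The even and odd names of the canonical composite are only a device; any names for the inner
wires that are distinct and fresh give the same class. -/
theorem Gate.act_eq_glue (K : Gate n m) (D : Diagram 0 n) (ρ : ℕ → ℕ)
    (hρ : ∀ i : Fin n, ρ i = D.output i) (hinj : Set.InjOn ρ K.inner)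
    (hfresh : ∀ e ∈ K.inner, ρ e ∉ D.wires) :
    K.act (cls D) = cls (K.glue D ρ hρ hinj hfresh) := by
  -- This renaming undoes the doubling on wires of the state and sends the odd name of the gate's
  -- wire `j` to `ρ j`.
  let F : ℕ → ℕ := fun x => if x % 2 = 0 then x / 2 else ρ (x / 2)
  have F0 : ∀ x, F (2 * x) = x := fun x => by simp [F]
  have F1 : ∀ x, F (2 * x + 1) = ρ x := fun x => by
    simp only [F, Nat.mul_add_mod_self_left, Nat.one_mod, one_ne_zero, if_false]
    congr 1
    omega
  have Fn : F ∘ D.names = ρ := by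
    funext j
    by_cases hj : j < n
    · exact (congrArg F (D.names_val ⟨j, hj⟩)).trans ((F0 _).trans (hρ ⟨j, hj⟩).symm)
    · rw [Function.comp_apply, D.names_of_le (not_lt.1 hj), F1]
  refine cls_relabel F ?_ ?_ ?_ rfl
  · have hw : (K.comp D).wires = D.wires.map (2 * ·) + 2 • K.inner.val.map D.names :=
      (K.wires_glue (D.rename (2 * ·) two_mul_injective) D.names D.names_val).trans
        (by rw [D.wires_rename])
    have hmem : ∀ x ∈ (K.comp D).wires, (∃ y ∈ D.wires, x = 2 * y) ∨
        ∃ y ∈ K.inner, x = 2 * y + 1 := by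
      intro x hx
      rw [hw, Multiset.mem_add, Multiset.mem_nsmul_of_ne_zero two_ne_zero, Multiset.mem_map,
        Multiset.mem_map] at hx
      rcases hx with ⟨y, hy, rfl⟩ | ⟨y, hy, rfl⟩
      · exact Or.inl ⟨y, hy, rfl⟩
      · exact Or.inr ⟨y, hy, D.names_of_le (K.le_inner y hy)⟩
    intro x hx y hy hxy
    rcases hmem x hx with ⟨x', hx', rfl⟩ | ⟨x', hx', rfl⟩ <;>
      rcases hmem y hy with ⟨y', hy', rfl⟩ | ⟨y', hy', rfl⟩ <;>
      simp only [F0, F1] at hxy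
    · rw [hxy]
    · exact absurd (hxy ▸ hx') (hfresh y' hy')
    · exact absurd (hxy ▸ hy') (hfresh x' hx')
    · rw [hinj hx' hy' hxy]
  · rw [K.comp_output, ← Function.comp_assoc, Fn]
    rfl
  · rw [K.comp_nodes, Multiset.map_add, Multiset.map_map, Multiset.map_map]
    change K.nodes.map (Node.rename ρ) + D.nodes = _
    congr 1
    · refine Multiset.map_congr rfl fun N _ => ?_
      rw [Function.comp_apply, Node.rename_rename, Fn]
    · symm
      conv_rhs => rw [← Multiset.map_id D.nodes]
      refine Multiset.map_congr rfl fun N _ => ?_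
      rw [Function.comp_apply, Node.rename_rename]
      exact (Node.rename_congr (g := id) fun x _ => F0 x).trans N.rename_id

end ToyCalculus

/-! ### Circuits with explicit wire names, and equality of their actions -/

namespace ToyCalculus

variable {n m k : ℕ}

/-- A gate together with names for its inner wires, to be added to some large number. -/
structure NamedGate (n m : ℕ) extends Gate n m where
  ν : List ℕ
  inner_eq : inner = Finset.Ico n (n + ν.length)

/-- The names of the wires of a named gate on a state with outputs `o`. -/
def NamedGate.name (K : NamedGate n m) (N : ℕ) (o : Fin n → ℕ) (j : ℕ) : ℕ :=
  if h : j < n then o ⟨j, h⟩ else N + K.ν.getD (j - n) 0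

/-- Sequences of named gates. -/
inductive Circuit : ℕ → ℕ → Type
  | nil {n : ℕ} : Circuit n n
  | cons {n m k : ℕ} (K : NamedGate n m) (C : Circuit m k) : Circuit n k

namespace Circuit

/-- The operation on states. -/
def run : ∀ {n m : ℕ}, Circuit n m → St n → St m
  | _, _, nil, ψ => ψ
  | _, _, cons K C, ψ => C.run (K.act ψ)

def names : ∀ {n m : ℕ}, Circuit n m → List ℕ
  | _, _, nil => []
  | _, _, cons K C => K.ν ++ C.names

def outs : ∀ {n m : ℕ}, Circuit n m → ℕ → (Fin n → ℕ) → Fin m → ℕ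
  | _, _, nil, _, o => o
  | _, _, cons K C, N, o => C.outs N (K.name N o ∘ K.out)

def frag : ∀ {n m : ℕ}, Circuit n m → ℕ → (Fin n → ℕ) → Multiset Node
  | _, _, nil, _, _ => 0
  | _, _, cons K C, N, o =>
    K.nodes.map (Node.rename (K.name N o)) + C.frag N (K.name N o ∘ K.out)

@[simp] theorem run_nil (ψ : St n) : (nil : Circuit n n).run ψ = ψ := rfl
@[simp] theorem run_cons (K : NamedGate n m) (C : Circuit m k) (ψ : St n) :
    (cons K C).run ψ = C.run (K.act ψ) := rfl
@[simp] theorem names_nil : (nil : Circuit n n).names = [] := rfl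
@[simp] theorem names_cons (K : NamedGate n m) (C : Circuit m k) :
    (cons K C).names = K.ν ++ C.names := rfl
@[simp] theorem outs_nil (N : ℕ) (o : Fin n → ℕ) : (nil : Circuit n n).outs N o = o := rfl
@[simp] theorem outs_cons (K : NamedGate n m) (C : Circuit m k) (N : ℕ) (o : Fin n → ℕ) :
    (cons K C).outs N o = C.outs N (K.name N o ∘ K.out) := rfl
@[simp] theorem frag_nil (N : ℕ) (o : Fin n → ℕ) : (nil : Circuit n n).frag N o = 0 := rfl
@[simp] theorem frag_cons (K : NamedGate n m) (C : Circuit m k) (N : ℕ) (o : Fin n → ℕ) :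
    (cons K C).frag N o = K.nodes.map (Node.rename (K.name N o)) +
      C.frag N (K.name N o ∘ K.out) := rfl

end Circuit

theorem NamedGate.exists_act (K : NamedGate n m) (D : Diagram 0 n) (N : ℕ)
    (hν : K.ν.Nodup) (hN : ∀ j ∈ K.ν, N + j ∉ D.wires) :
    ∃ D' : Diagram 0 m, K.act (cls D) = cls D' ∧
      D'.output = K.name N D.output ∘ K.out ∧
      D'.nodes = K.nodes.map (Node.rename (K.name N D.output)) + D.nodes ∧
      D'.circles = D.circles ∧ ∀ j, N + j ∈ D'.wires → N + j ∈ D.wires ∨ j ∈ K.ν := by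
  have h0 : ∀ i : Fin n, K.name N D.output i = D.output i := fun i => dif_pos i.2
  have h1 : ∀ j (hj : j < K.ν.length), K.name N D.output (n + j) = N + K.ν[j] := by
    intro j hj
    rw [NamedGate.name, dif_neg (by omega), Nat.add_sub_cancel_left, List.getD_eq_getElem _ _ hj]
  have hin : ∀ x ∈ K.inner, ∃ j, ∃ _ : j < K.ν.length, x = n + j := by
    intro x hx
    rw [K.inner_eq, Finset.mem_Ico] at hx
    exact ⟨x - n, by omega, by omega⟩
  have hinj : Set.InjOn (K.name N D.output) K.inner := by
    intro x hx y hy hxy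
    obtain ⟨i, hi, rfl⟩ := hin x hx
    obtain ⟨j, hj, rfl⟩ := hin y hy
    rw [h1 i hi, h1 j hj] at hxy
    rw [(hν.getElem_inj_iff).1 (Nat.add_left_cancel hxy)]
  have hfr : ∀ x ∈ K.inner, K.name N D.output x ∉ D.wires := by
    intro x hx
    obtain ⟨i, hi, rfl⟩ := hin x hx
    rw [h1 i hi]
    exact hN _ (List.getElem_mem hi)
  refine ⟨_, K.act_eq_glue D _ h0 hinj hfr, rfl, rfl, rfl, ?_⟩
  intro j hj
  have hj : N + j ∈ D.wires + 2 • K.inner.val.map (K.name N D.output) := by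
    rw [← K.wires_glue D _ h0]
    exact hj
  rw [Multiset.mem_add, Multiset.mem_nsmul_of_ne_zero two_ne_zero, Multiset.mem_map] at hj
  rcases hj with hj | ⟨x, hx, hxj⟩
  · exact Or.inl hj
  · obtain ⟨i, hi, rfl⟩ := hin x hx
    rw [h1 i hi] at hxj
    rw [← Nat.add_left_cancel hxj]
    exact Or.inr (List.getElem_mem hi)

/-- This makes the abstract action explicit: with fresh distinct names, the result has a concrete
list of nodes to which the fragment rules apply. -/
theorem Circuit.exists_run (C : Circuit n m) (D : Diagram 0 n) (N : ℕ)
    (hν : C.names.Nodup) (hN : ∀ j ∈ C.names, N + j ∉ D.wires) :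
    ∃ D' : Diagram 0 m, C.run (cls D) = cls D' ∧ D'.output = C.outs N D.output ∧
      D'.nodes = C.frag N D.output + D.nodes ∧ D'.circles = D.circles := by
  induction C with
  | nil => exact ⟨D, rfl, rfl, (zero_add _).symm, rfl⟩
  | cons K C ih =>
    rw [Circuit.names_cons, List.nodup_append'] at hν
    simp only [Circuit.names_cons, List.mem_append] at hN
    obtain ⟨E, h1, h2, h3, h4, h5⟩ := K.exists_act D N hν.1 fun j hj => hN j (Or.inl hj)
    obtain ⟨F, h1', h2', h3', h4'⟩ := ih E hν.2.1 fun j hj hj' => by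
      rcases h5 j hj' with h | h
      · exact hN j (Or.inr hj) h
      · exact hν.2.2 h hj
    refine ⟨F, ?_, ?_, ?_, ?_⟩
    · rw [Circuit.run_cons, h1, h1']
    · rw [h2', h2]; rfl
    · rw [h3', h3, h2, Circuit.frag_cons, add_assoc, add_left_comm]
    · rw [h4', h4]

/-- A circuit adds every new wire with two ends, whatever the names are. Hence freshness of names
can be deduced from the resulting diagram instead of being assumed. -/
theorem Circuit.exists_wires (C : Circuit n m) (N : ℕ) (o : Fin n → ℕ) :
    ∃ W : Multiset ℕ, ends (C.outs N o) + legsOf (C.frag N o) = ends o + 2 • W := by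
  induction C with
  | nil => exact ⟨0, by simp⟩
  | cons K C ih =>
    obtain ⟨W, hW⟩ := ih (K.name N o ∘ K.out)
    refine ⟨W + K.inner.val.map (K.name N o), ?_⟩
    have h := congrArg (Multiset.map (K.name N o)) K.bal
    rw [Multiset.map_add, Multiset.map_add, ← ends_comp, ← legsOf_rename, Multiset.map_nsmul,
      map_range_eq_ends (K.name N o) o fun i => dif_pos i.2] at h
    rw [Circuit.outs_cons, Circuit.frag_cons, legsOf_add, add_left_comm, hW, nsmul_add,
      add_left_comm, ← add_assoc, ← add_assoc]
    rw [h]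
    abel

/-- The names of the wires in a circuit may be chosen at will, as long as the result is a
diagram. -/
theorem Circuit.run_eq_cls (C : Circuit n m) (N : ℕ) (D : Diagram 0 n) (D' : Diagram 0 m)
    (ho : D'.output = C.outs N D.output) (hn : D'.nodes = C.frag N D.output + D.nodes)
    (hc : D'.circles = D.circles) : C.run (cls D) = cls D' := by
  induction C with
  | nil =>
    exact congrArg cls (Diagram.ext_state ho.symm (hn.trans (zero_add _)).symm hc.symm)
  | cons K C ih =>
    have h0 : ∀ i : Fin _, K.name N D.output i = D.output i := fun i => dif_pos i.2
    obtain ⟨W, hW⟩ := C.exists_wires N (K.name N D.output ∘ K.out)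
    have hw : D'.wires = D.wires + 2 • K.inner.val.map (K.name N D.output) + 2 • W := by
      rw [← K.wires_glue D _ h0, Diagram.wires, hn, ho, Circuit.frag_cons, Circuit.outs_cons]
      simp only [legsOf_add]
      calc _ = (ends (C.outs N (K.name N D.output ∘ K.out)) +
            legsOf (C.frag N (K.name N D.output ∘ K.out))) +
            legsOf (K.nodes.map (Node.rename (K.name N D.output))) + legsOf D.nodes := by abel
        _ = _ := by rw [hW]; abel
    -- Each inner wire already accounts for two ends, the maximum in `D'`, so it can coincide
    -- neither with a wire of `D` nor with another inner wire.
    have hle : ∀ x ∈ K.inner, D.wires.count (K.name N D.output x) = 0 ∧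
        (K.inner.val.map (K.name N D.output)).count (K.name N D.output x) = 1 := by
      intro x hx
      have h1 := D'.count_wires (K.name N D.output x)
      have h2 : 1 ≤ (K.inner.val.map (K.name N D.output)).count (K.name N D.output x) :=
        Multiset.one_le_count_iff_mem.2 (Multiset.mem_map_of_mem _ hx)
      rw [hw, Multiset.count_add, Multiset.count_add, Multiset.count_nsmul,
        Multiset.count_nsmul] at h1
      omega
    have hnd : (K.inner.val.map (K.name N D.output)).Nodup := by
      rw [Multiset.nodup_iff_count_le_one]
      intro e
      by_cases he : e ∈ K.inner.val.map (K.name N D.output)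
      · obtain ⟨x, hx, rfl⟩ := Multiset.mem_map.1 he
        exact (hle x hx).2.le
      · rw [Multiset.count_eq_zero.2 he]
        exact Nat.zero_le 1
    have hinj : Set.InjOn (K.name N D.output) K.inner := fun x hx y hy h =>
      Multiset.inj_on_of_nodup_map hnd x hx y hy h
    rw [Circuit.run_cons, K.act_eq_glue D _ h0 hinj fun x hx =>
      Multiset.count_eq_zero.1 (hle x hx).1]
    refine ih _ D' ho ?_ hc
    rw [hn, Circuit.frag_cons, add_assoc]
    exact add_left_comm _ _ _

/-- Two circuits agree on states if their fragments do. -/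
theorem Circuit.run_eq_on (C C' : Circuit n m) (D D' : Diagram 0 n) (A A' R : Multiset Node)
    (hD : D.nodes = A + R) (hD' : D'.nodes = A' + R) (hDo : D'.output = D.output)
    (hDc : D'.circles = D.circles) (hν : C.names.Nodup) (hν' : C'.names.Nodup)
    (ho : ∀ N, C.outs N D.output = C'.outs N D.output)
    (hf : ∀ N, LEq (C.frag N D.output + A) (C'.frag N D.output + A')) :
    C.run (cls D) = C'.run (cls D') := by
  obtain ⟨N, hN⟩ := exists_fresh (D.wires + D'.wires)
  have hfr : ∀ j, N + j ∉ D.wires ∧ N + j ∉ D'.wires := fun j =>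
    ⟨fun hj => by have := hN _ (Multiset.mem_add.2 (Or.inl hj)); omega,
      fun hj => by have := hN _ (Multiset.mem_add.2 (Or.inr hj)); omega⟩
  obtain ⟨E, h1, h2, h3, h4⟩ := C.exists_run D N hν fun j _ => (hfr j).1
  obtain ⟨E', h1', h2', h3', h4'⟩ := C'.exists_run D' N hν' fun j _ => (hfr j).2
  rw [h1, h1']
  exact hf N E E' R (by rw [h3, hD, add_assoc]) (by rw [h3', hD', hDo, add_assoc])
    (by rw [h2, h2', ho, hDo]) (by rw [h4, h4', hDc])

/-- Two circuits agree if their fragments do. -/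
theorem Circuit.run_eq (C C' : Circuit n m) (hν : C.names.Nodup) (hν' : C'.names.Nodup)
    (ho : ∀ N o, C.outs N o = C'.outs N o) (hf : ∀ N o, LEq (C.frag N o) (C'.frag N o))
    (ψ : St n) : C.run ψ = C'.run ψ := by
  induction ψ using Quot.ind with
  | _ D =>
  exact C.run_eq_on C' D D 0 0 D.nodes (zero_add _).symm (zero_add _).symm rfl rfl hν hν'
    (fun N => ho N _) fun N => by simpa using hf N D.output

/-- The fragment can be rewritten to a fragment with the property `Q`. -/
def Rewrites (A : Multiset Node) (Q : Multiset Node → Prop) : Prop :=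
  ∀ ⦃n : ℕ⦄ (D : Diagram 0 n) (C : Multiset Node), D.nodes = A + C →
    ∃ (B : Multiset Node) (D' : Diagram 0 n), Q B ∧ D'.nodes = B + C ∧ D'.output = D.output ∧
      D'.circles = D.circles ∧ cls D = cls D'

theorem Rewrites.done {A : Multiset Node} {Q : Multiset Node → Prop} (h : Q A) : Rewrites A Q :=
  fun _ D _ hD => ⟨A, D, h, hD, rfl, rfl, rfl⟩

/-- In contrast to `LEq.step`, the final fragment is not fixed in advance, so names of fresh wires
chosen on the way may survive in it. -/
theorem Rewrites.step {X A : Multiset Node} {Q : Multiset Node → Prop} {B : ℕ → Multiset Node}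
    (h : ∀ N, LEq A (B N)) (C : Multiset Node) (I : ℕ → Multiset ℕ) (J : Multiset ℕ)
    (h₂ : ∀ N, Rewrites (B N + C) Q)
    (hX : X = A + C := by simp only [Multiset.insert_eq_cons, ← Multiset.singleton_add, Colour.swap_green,
      Colour.swap_red, add_zero, zero_add, @add_comm (Multiset ℕ), @add_left_comm (Multiset ℕ),
      @add_assoc (Multiset ℕ), @add_comm Phase] <;> abel)
    (hb : ∀ N, legsOf (B N) + 2 • J = legsOf A + 2 • I N := by
      intro N
      simp only [Multiset.insert_eq_cons, ← Multiset.singleton_add, legsOf_add, legsOf_singleton,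
        legsOf_zero, legs_spider, legs_had]
      abel)
    (hI : ∀ N, (I N).Nodup := by simp) (hN : ∀ N, ∀ e ∈ I N, N ≤ e := by simp) :
    Rewrites X Q := by
  intro n D R hD
  obtain ⟨N, hlt⟩ := exists_fresh D.wires
  obtain ⟨E, h1, h2, h3, h4⟩ := (h N).exists_rewrite D (C + R) (by rw [hD, hX, add_assoc])
    (I N) J (hb N) (hI N) fun e he hw => absurd (hlt e hw) (not_lt.2 (hN N e he))
  obtain ⟨B', D', h1', h2', h3', h4', h5'⟩ := h₂ N E R (by rw [h1, add_assoc])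
  exact ⟨B', D', h1', h2', h3'.trans h2, h4'.trans h3, h4.trans h5'⟩

theorem Rewrites.step₀ {X A B : Multiset Node} {Q : Multiset Node → Prop} (h : LEq A B)
    (C : Multiset Node) (J : Multiset ℕ) (h₂ : Rewrites (B + C) Q)
    (hX : X = A + C := by simp only [Multiset.insert_eq_cons, ← Multiset.singleton_add, Colour.swap_green,
      Colour.swap_red, add_zero, zero_add, @add_comm (Multiset ℕ), @add_left_comm (Multiset ℕ),
      @add_assoc (Multiset ℕ), @add_comm Phase] <;> abel)
    (hb : legsOf B + 2 • J = legsOf A := by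
      simp only [Multiset.insert_eq_cons, ← Multiset.singleton_add, legsOf_add, legsOf_singleton,
        legsOf_zero, legs_spider, legs_had]
      abel) : Rewrites X Q :=
  Rewrites.step (fun _ => h) C (fun _ => 0) J (fun _ => h₂) hX (fun _ => by simpa using hb)

/-- A circuit acts as `f` if its fragment can be rewritten to the fragment of a circuit that does. -/
theorem Circuit.run_eq_of_rewrites (C : Circuit n m) (f : St n → St m) (hν : C.names.Nodup)
    (hf : ∀ N o, Rewrites (C.frag N o) fun B => ∃ C' : Circuit n m,
      C'.run = f ∧ C'.outs 0 o = C.outs N o ∧ C'.frag 0 o = B) (ψ : St n) : C.run ψ = f ψ := by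
  induction ψ using Quot.ind with
  | _ D =>
  obtain ⟨N, hN⟩ := exists_fresh D.wires
  obtain ⟨E, h1, h2, h3, h4⟩ := C.exists_run D N hν fun j _ hj => by
    have := hN _ hj
    omega
  obtain ⟨B, E', ⟨C', h5, h6, h7⟩, h8, h9, h10, h11⟩ := hf N D.output E D.nodes h3
  change C.run (cls D) = f (cls D)
  rw [h1, h11, ← h5]
  exact (C'.run_eq_cls 0 D E' (by rw [h9, h2, h6]) (by rw [h8, h7]) (by rw [h10, h4])).symm

/-! ### The gates -/

/-- A single operator at the `i`-th output. -/
def opGate (i : Fin n) (op : Op) : Gate n n where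
  out := Function.update Fin.val i n
  nodes := {op.node i n}
  inner := {n}
  le_inner := by simp
  bal := by
    have h : (op.node i n).legs = {(i : ℕ)} + {n} := by cases op <;> rfl
    rw [legsOf_singleton, h, ← add_assoc, ends_update, ends_val, two_nsmul, add_assoc]
    rfl

/-- A controlled phase between the outputs `i` and `j`. -/
def czGate (i j : Fin n) (h : i ≠ j) : Gate n n where
  out := Function.update (Function.update Fin.val i n) j (n + 1)
  nodes := {.spider .green 0 {(i : ℕ), n, n + 2}, .had s(n + 2, n + 3),
    .spider .green 0 {(j : ℕ), n + 1, n + 3}}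
  inner := Finset.Ico n (n + 4)
  le_inner _ he := (Finset.mem_Ico.1 he).1
  bal := by
    have h1 := ends_update (Function.update (Fin.val : Fin n → ℕ) i n) j (n + 1)
    rw [Function.update_of_ne h.symm] at h1
    have h2 := ends_update (Fin.val : Fin n → ℕ) i n
    rw [ends_val] at h2
    have h3 : (Finset.Ico n (n + 4)).val = {n} + {n + 1} + {n + 2} + {n + 3} := by
      change ((List.range' n (n + 4 - n) : List ℕ) : Multiset ℕ) = _
      rw [Nat.add_sub_cancel_left]
      rfl
    rw [h3]
    simp only [Multiset.insert_eq_cons, ← Multiset.singleton_add, legsOf_add, legsOf_singleton,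
      legs_spider, legs_had]
    calc _ = ends (Function.update (Function.update (Fin.val : Fin n → ℕ) i n) j (n + 1)) +
          {(j : ℕ)} + {(i : ℕ)} + {n} + {n + 2} + {n + 2} + {n + 3} + {n + 3} + {n + 1} := by abel
      _ = ends (Function.update (Fin.val : Fin n → ℕ) i n) + {(i : ℕ)} + {n + 1} + {n} +
          {n + 2} + {n + 2} + {n + 3} + {n + 3} + {n + 1} := by rw [h1]; abel
      _ = _ := by rw [h2]; abel

/-- A controlled permutation with control `i` and target `j`. -/
def cxGate (i j : Fin n) (h : i ≠ j) : Gate n n where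
  out := Function.update (Function.update Fin.val i n) j (n + 1)
  nodes := {.spider .green 0 {(i : ℕ), n, n + 2}, .spider .red 0 {n + 2, (j : ℕ), n + 1}}
  inner := Finset.Ico n (n + 3)
  le_inner _ he := (Finset.mem_Ico.1 he).1
  bal := by
    have h1 := ends_update (Function.update (Fin.val : Fin n → ℕ) i n) j (n + 1)
    rw [Function.update_of_ne h.symm] at h1
    have h2 := ends_update (Fin.val : Fin n → ℕ) i n
    rw [ends_val] at h2
    have h3 : (Finset.Ico n (n + 3)).val = {n} + {n + 1} + {n + 2} := by
      change ((List.range' n (n + 3 - n) : List ℕ) : Multiset ℕ) = _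
      rw [Nat.add_sub_cancel_left]
      rfl
    rw [h3]
    simp only [Multiset.insert_eq_cons, ← Multiset.singleton_add, legsOf_add, legsOf_singleton,
      legs_spider]
    calc _ = ends (Function.update (Function.update (Fin.val : Fin n → ℕ) i n) j (n + 1)) +
          {(j : ℕ)} + {(i : ℕ)} + {n} + {n + 2} + {n + 2} + {n + 1} := by abel
      _ = ends (Function.update (Fin.val : Fin n → ℕ) i n) + {(i : ℕ)} + {n + 1} + {n} +
          {n + 2} + {n + 2} + {n + 1} := by rw [h1]; abel
      _ = _ := by rw [h2]; abel

/-- The projection of the last output to a red state. -/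
def capGate (n : ℕ) : Gate (n + 1) n where
  out := fun i => i
  nodes := {.spider .red 0 {n}}
  inner := ∅
  le_inner := by simp
  bal := by
    have h : ends (fun i : Fin n => (i : ℕ)) = Multiset.range n := ends_val
    rw [h, Multiset.range_succ, ← Multiset.singleton_add]
    simp [add_comm]

/-- An operator with a name for the new wire. -/
def nOp (i : Fin n) (op : Op) (e : ℕ) : NamedGate n n where
  toGate := opGate i op
  ν := [e]
  inner_eq := by simp [opGate]

/-- The names `a` and `b` belong to the new output wires at `i` and `j`, the names `x` and `y` to
the wires on the two sides of the node H. -/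
def nCZ (i j : Fin n) (h : i ≠ j) (a b x y : ℕ) : NamedGate n n where
  toGate := czGate i j h
  ν := [a, b, x, y]
  inner_eq := by simp [czGate]

def nCX (i j : Fin n) (h : i ≠ j) (a b x : ℕ) : NamedGate n n where
  toGate := cxGate i j h
  ν := [a, b, x]
  inner_eq := by simp [cxGate]

def nCap (n : ℕ) : NamedGate (n + 1) n where
  toGate := capGate n
  ν := []
  inner_eq := by simp [capGate]

theorem Op.rename_node (op : Op) (f : ℕ → ℕ) (a b : ℕ) :
    (op.node a b).rename f = op.node (f a) (f b) := by cases op <;> simp [Op.node, Node.rename]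

theorem NamedGate.name_val (K : NamedGate n m) (N : ℕ) (o : Fin n → ℕ) (i : Fin n) :
    K.name N o i = o i := dif_pos i.2

theorem NamedGate.name_comp_val (K : NamedGate n m) (N : ℕ) (o : Fin n → ℕ) :
    K.name N o ∘ Fin.val = o := funext fun i => K.name_val N o i

theorem NamedGate.name_add (K : NamedGate n m) (N : ℕ) (o : Fin n → ℕ) (j : ℕ) :
    K.name N o (n + j) = N + K.ν.getD j 0 := by
  rw [NamedGate.name, dif_neg (by omega), Nat.add_sub_cancel_left]

theorem NamedGate.name_self (K : NamedGate n m) (N : ℕ) (o : Fin n → ℕ) :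
    K.name N o n = N + K.ν.getD 0 0 := K.name_add N o 0

@[simp] theorem nOp_name_out (i : Fin n) (op : Op) (e N : ℕ) (o : Fin n → ℕ) :
    (nOp i op e).name N o ∘ (nOp i op e).out = Function.update o i (N + e) := by
  refine (Function.comp_update ..).trans ?_
  rw [NamedGate.name_comp_val, NamedGate.name_self]
  rfl

@[simp] theorem nOp_frag (i : Fin n) (op : Op) (e N : ℕ) (o : Fin n → ℕ) :
    (nOp i op e).nodes.map (Node.rename ((nOp i op e).name N o)) = {op.node (o i) (N + e)} := by
  change Multiset.map _ {op.node i n} = _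
  rw [Multiset.map_singleton, Op.rename_node, NamedGate.name_val, NamedGate.name_self]
  rfl

@[simp] theorem nCZ_name_out (i j : Fin n) (h : i ≠ j) (a b x y N : ℕ) (o : Fin n → ℕ) :
    (nCZ i j h a b x y).name N o ∘ (nCZ i j h a b x y).out =
      Function.update (Function.update o i (N + a)) j (N + b) := by
  refine (Function.comp_update ..).trans ?_
  rw [Function.comp_update, NamedGate.name_comp_val, NamedGate.name_self, NamedGate.name_add]
  rfl

@[simp] theorem nCZ_frag (i j : Fin n) (h : i ≠ j) (a b x y N : ℕ) (o : Fin n → ℕ) :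
    (nCZ i j h a b x y).nodes.map (Node.rename ((nCZ i j h a b x y).name N o)) =
      {.spider .green 0 {o i, N + a, N + x}, .had s(N + x, N + y),
        .spider .green 0 {o j, N + b, N + y}} := by
  change Multiset.map _ {_, _, _} = _
  simp only [Multiset.insert_eq_cons, Multiset.map_cons, Multiset.map_singleton, Node.rename,
    Sym2.map_mk, NamedGate.name_val, NamedGate.name_self, NamedGate.name_add]
  rfl

@[simp] theorem nCX_name_out (i j : Fin n) (h : i ≠ j) (a b x N : ℕ) (o : Fin n → ℕ) :
    (nCX i j h a b x).name N o ∘ (nCX i j h a b x).out =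
      Function.update (Function.update o i (N + a)) j (N + b) := by
  refine (Function.comp_update ..).trans ?_
  rw [Function.comp_update, NamedGate.name_comp_val, NamedGate.name_self, NamedGate.name_add]
  rfl

@[simp] theorem nCX_frag (i j : Fin n) (h : i ≠ j) (a b x N : ℕ) (o : Fin n → ℕ) :
    (nCX i j h a b x).nodes.map (Node.rename ((nCX i j h a b x).name N o)) =
      {.spider .green 0 {o i, N + a, N + x}, .spider .red 0 {N + x, o j, N + b}} := by
  change Multiset.map _ {_, _} = _
  simp only [Multiset.insert_eq_cons, Multiset.map_cons, Multiset.map_singleton, Node.rename,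
    NamedGate.name_val, NamedGate.name_self, NamedGate.name_add]
  rfl

@[simp] theorem nCap_name_out (N : ℕ) (o : Fin (n + 1) → ℕ) :
    (nCap n).name N o ∘ (nCap n).out = o ∘ Fin.castSucc :=
  funext fun i => (nCap n).name_val N o i.castSucc

@[simp] theorem nCap_frag (N : ℕ) (o : Fin (n + 1) → ℕ) :
    (nCap n).nodes.map (Node.rename ((nCap n).name N o)) =
      {.spider .red 0 {o (Fin.last n)}} := by
  change Multiset.map _ {_} = _
  rw [Multiset.map_singleton, Node.rename, Multiset.map_singleton]
  exact congrArg (fun x => ({.spider .red 0 {x}} : Multiset Node))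
    ((nCap n).name_val N o (Fin.last n))

@[simp] theorem nOp_ν (i : Fin n) (op : Op) (e : ℕ) : (nOp i op e).ν = [e] := rfl
@[simp] theorem nCZ_ν (i j : Fin n) (h : i ≠ j) (a b x y : ℕ) :
    (nCZ i j h a b x y).ν = [a, b, x, y] := rfl
@[simp] theorem nCX_ν (i j : Fin n) (h : i ≠ j) (a b x : ℕ) : (nCX i j h a b x).ν = [a, b, x] := rfl
@[simp] theorem nCap_ν : (nCap n).ν = [] := rfl

/-- The operator `o` on the `i`-th output. -/
def op (i : Fin n) (o : Op) : St n → St n := (opGate i o).act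

/-- Green phase shifts, red phase shifts and Hadamard-like operators at the output `i`. -/
notation:max "𝐆" i:max p:max => op i (Op.phase Colour.green p)
notation:max "𝐑" i:max p:max => op i (Op.phase Colour.red p)
notation:max "𝐇" i:max => op i Op.had

/-- The controlled phase. -/
def cz (i j : Fin n) : St n → St n := if h : i ≠ j then (czGate i j h).act else id

/-- The controlled permutation. -/
def cx (i j : Fin n) : St n → St n := if h : i ≠ j then (cxGate i j h).act else id

/-- The projection of the last output to a red state. -/
def cap : St (n + 1) → St n := (capGate n).act

@[simp] theorem nOp_act (i : Fin n) (o : Op) (e : ℕ) (ψ : St n) :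
    (nOp i o e).act ψ = op i o ψ := rfl
@[simp] theorem nCZ_act (i j : Fin n) (h : i ≠ j) (a b x y : ℕ) (ψ : St n) :
    (nCZ i j h a b x y).act ψ = cz i j ψ := by rw [cz, dif_pos h]; rfl
@[simp] theorem nCX_act (i j : Fin n) (h : i ≠ j) (a b x : ℕ) (ψ : St n) :
    (nCX i j h a b x).act ψ = cx i j ψ := by rw [cx, dif_pos h]; rfl
@[simp] theorem nCap_act (ψ : St (n + 1)) : (nCap n).act ψ = cap ψ := rfl

end ToyCalculus

/-! ### Elementary relations between the gates -/

namespace ToyCalculus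

variable {n : ℕ}

open Circuit

/-- The pattern for most gate relations: both sides are circuits whose names are chosen so that the
final outputs agree, and it remains to compare two small fragments. -/
theorem ph_ph (i : Fin n) (p q : Phase) (ψ : St n) : 𝐆 i p (𝐆 i q ψ) = 𝐆 i (p + q) ψ := by
  refine Circuit.run_eq (.cons (nOp i (.phase .green q) 0) (.cons (nOp i (.phase .green p) 1) .nil))
    (.cons (nOp i (.phase .green (p + q)) 1) .nil) (by simp) (by simp) (fun N o => ?_)
    (fun N o => ?_) ψ
  · simp
  · simp only [frag_cons, frag_nil, nOp_frag, nOp_name_out, Op.node, Function.update_self]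
    exact (LEq.fuse .green q p (N + 0) {o i} {N + 1}).sub 0

theorem hd_hd_eq (i : Fin n) (ψ : St n) : 𝐇 i (𝐇 i ψ) = 𝐆 i 0 ψ := by
  refine Circuit.run_eq (.cons (nOp i .had 0) (.cons (nOp i .had 1) .nil))
    (.cons (nOp i (.phase .green 0) 1) .nil) (by simp) (by simp) (fun N o => ?_)
    (fun N o => ?_) ψ
  · simp
  · simp only [frag_cons, frag_nil, nOp_frag, nOp_name_out, Op.node, Function.update_self]
    exact (LEq.had_had .green (o i) (N + 0) (N + 1)).sub 0

/-- The identity rule changes the names at the outputs, so it is no equality of fragments;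
contracting the fresh wire onto the old output wire recovers the original diagram exactly. -/
theorem ph_zero (i : Fin n) (ψ : St n) : 𝐆 i 0 ψ = ψ := by
  induction ψ using Quot.ind with
  | _ D =>
  obtain ⟨N, hN⟩ := exists_fresh D.wires
  obtain ⟨E, h1, h2, h3, h4⟩ := (cons (nOp i (.phase .green 0) 0) nil).exists_run D N (by simp)
    fun j _ hj => by
      have := hN _ hj
      omega
  have hi : D.output i < N := hN _ (Multiset.mem_add.2 (Or.inl (mem_ends _ i)))
  simp only [run_cons, run_nil, nOp_act, outs_cons, outs_nil, frag_cons, frag_nil, nOp_frag,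
    nOp_name_out, Op.node, add_zero, Multiset.singleton_add] at h1 h2 h3
  obtain ⟨F, h5, h6, h7, h8⟩ := exists_identity E .green (D.output i) N D.nodes (by omega) h3
  change op i _ (cls D) = cls D
  rw [h1, h5]
  refine congrArg cls (Diagram.ext_state ?_ ?_ (h8.trans h4))
  · rw [h6, h2]
    funext j
    have hj : D.output j < N := hN _ (Multiset.mem_add.2 (Or.inl (mem_ends _ j)))
    by_cases h : j = i
    · subst h; simp
    · simp [h, hj.ne]
  · rw [h7]
    refine map_rename_id fun x hx => ?_
    have := hN x (Multiset.mem_add.2 (Or.inr hx))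
    simp [this.ne]

theorem hd_hd (i : Fin n) (ψ : St n) : 𝐇 i (𝐇 i ψ) = ψ := by rw [hd_hd_eq, ph_zero]

theorem rph_eq (i : Fin n) (p : Phase) (ψ : St n) : 𝐑 i p ψ = 𝐇 i (𝐆 i p (𝐇 i ψ)) := by
  refine Circuit.run_eq (.cons (nOp i (.phase .red p) 2) .nil)
    (.cons (nOp i .had 0) (.cons (nOp i (.phase .green p) 1) (.cons (nOp i .had 2) .nil)))
    (by simp) (by simp) (fun N o => ?_) (fun N o => ?_) ψ
  · simp
  · simp only [frag_cons, frag_nil, nOp_frag, nOp_name_out, Op.node, Function.update_self]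
    rw [Sym2.eq_swap (a := o i)]
    exact (LEq.colour₂ .red p (o i) (N + 2) (N + 0) (N + 1)).sub 0

theorem rph_zero_one (i : Fin n) (ψ : St n) :
    𝐑 i (0, 1) ψ = 𝐆 i (0, 1) (𝐇 i (𝐆 i (0, 1) ψ)) := by
  refine Circuit.run_eq (.cons (nOp i (.phase .red (0, 1)) 2) .nil)
    (.cons (nOp i (.phase .green (0, 1)) 0) (.cons (nOp i .had 1)
      (.cons (nOp i (.phase .green (0, 1)) 2) .nil)))
    (by simp) (by simp) (fun N o => ?_) (fun N o => ?_) ψ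
  · simp
  · simp only [frag_cons, frag_nil, nOp_frag, nOp_name_out, Op.node, Function.update_self]
    exact (LEq.euler_phase .green (o i) (N + 2) (N + 0) (N + 1)).symm.sub 0

theorem op_comm {i j : Fin n} (h : i ≠ j) (a b : Op) (ψ : St n) :
    op i a (op j b ψ) = op j b (op i a ψ) := by
  refine Circuit.run_eq (.cons (nOp j b 0) (.cons (nOp i a 1) .nil))
    (.cons (nOp i a 1) (.cons (nOp j b 0) .nil))
    (by simp) (by simp) (fun N o => ?_) (fun N o => ?_) ψ
  · simp [Function.update_comm h]
  · simp only [frag_cons, frag_nil, nOp_frag, nOp_name_out, ne_eq, h, h.symm, not_false_eq_true,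
      Function.update_of_ne]
    exact LEq.of_eq (by abel)

theorem cz_symm (i j : Fin n) (ψ : St n) : cz i j ψ = cz j i ψ := by
  by_cases h : i = j
  · rw [h]
  have h' : i ≠ j := h
  have := Circuit.run_eq (.cons (nCZ i j h' 0 1 2 3) .nil) (.cons (nCZ j i h'.symm 1 0 3 2) .nil)
    (by simp) (by simp) (fun N o => by simp [Function.update_comm h']) (fun N o => ?_) ψ
  · simpa using this
  · simp only [frag_cons, frag_nil, nCZ_frag, nCZ_name_out]
    rw [Sym2.eq_swap (a := N + 2)]
    refine LEq.of_eq ?_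
    simp only [Multiset.insert_eq_cons, ← Multiset.singleton_add]
    abel

/-- Colour change at the red node of the controlled permutation: one of the three new H nodes
becomes the edge to the control, the others sit before and after at `j`. -/
theorem cx_eq (i j : Fin n) (ψ : St n) : cx i j ψ = 𝐇 j (cz i j (𝐇 j ψ)) := by
  by_cases h : i = j
  · subst h
    simp [cx, cz, hd_hd]
  have h' : i ≠ j := h
  have := Circuit.run_eq (.cons (nCX i j h' 0 1 2) .nil)
    (.cons (nOp j .had 3) (.cons (nCZ i j h' 0 5 2 4) (.cons (nOp j .had 1) .nil)))
    (by simp) (by simp) (fun N o => by simp [Function.update_comm h']) (fun N o => ?_) ψ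
  · simpa using this
  · simp only [frag_cons, frag_nil, nOp_frag, nOp_name_out, nCZ_frag, nCZ_name_out, nCX_frag, nCX_name_out, Op.node,
      Function.update_self, Function.update_of_ne h']
    rw [Sym2.eq_swap (a := o j), Sym2.eq_swap (a := N + 2)]
    exact (LEq.colour₃ .red 0 (N + 2) (o j) (N + 1) (N + 4) (N + 3) (N + 5)).sub
      {.spider .green 0 {o i, N + 0, N + 2}}

theorem op_cz {i j k : Fin n} (hi : k ≠ i) (hj : k ≠ j) (a : Op) (ψ : St n) :
    op k a (cz i j ψ) = cz i j (op k a ψ) := by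
  by_cases h : i = j
  · simp [cz, h]
  have h' : i ≠ j := h
  have := Circuit.run_eq (.cons (nCZ i j h' 0 1 2 3) (.cons (nOp k a 4) .nil))
    (.cons (nOp k a 4) (.cons (nCZ i j h' 0 1 2 3) .nil))
    (by simp) (by simp) (fun N o => by
      simp [Function.update_comm hi, Function.update_comm hj]) (fun N o => ?_) ψ
  · simpa using this
  · simp only [frag_cons, frag_nil, nOp_frag, nOp_name_out, nCZ_frag, nCZ_name_out,
      Function.update_of_ne hi, Function.update_of_ne hj, Function.update_of_ne hi.symm,
      Function.update_of_ne hj.symm]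
    exact LEq.of_eq (by abel)

theorem ph_cz (i j : Fin n) (p : Phase) (ψ : St n) :
    𝐆 i p (cz i j ψ) = cz i j (𝐆 i p ψ) := by
  by_cases h : i = j
  · simp [cz, h]
  have h' : i ≠ j := h
  have := Circuit.run_eq (.cons (nCZ i j h' 0 1 2 3) (.cons (nOp i (.phase .green p) 4) .nil))
    (.cons (nOp i (.phase .green p) 0) (.cons (nCZ i j h' 4 1 2 3) .nil))
    (by simp) (by simp) (fun N o => by simp [Function.update_comm h']) (fun N o => ?_) ψ
  · simpa using this
  · simp only [frag_cons, frag_nil, nOp_frag, nOp_name_out, nCZ_frag, nCZ_name_out, Op.node,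
      Function.update_self, Function.update_of_ne h', Function.update_of_ne h'.symm]
    refine LEq.step₀ (LEq.fuse .green 0 p (N + 0) {o i, N + 2} {N + 4})
      {.had s(N + 2, N + 3), .spider .green 0 {o j, N + 1, N + 3}} {N + 0} ?_
    exact (LEq.fuse .green p 0 (N + 0) {o i} {N + 2, N + 4}).symm.sub
      {.had s(N + 2, N + 3), .spider .green 0 {o j, N + 1, N + 3}}

theorem cz_comm_same {i j k : Fin n} (hj : i ≠ j) (hk : i ≠ k) (h : j ≠ k) (ψ : St n) :
    cz i j (cz i k ψ) = cz i k (cz i j ψ) := by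
  have := Circuit.run_eq (.cons (nCZ i k hk 0 1 2 3) (.cons (nCZ i j hj 4 5 6 7) .nil))
    (.cons (nCZ i j hj 0 5 6 7) (.cons (nCZ i k hk 4 1 2 3) .nil))
    (by simp) (by simp) (fun N o => by
      simp [Function.update_comm hk, Function.update_comm hj, Function.update_comm h])
    (fun N o => ?_) ψ
  · simpa using this
  · simp only [frag_cons, frag_nil, nCZ_frag, nCZ_name_out, Function.update_self,
      Function.update_of_ne hj, Function.update_of_ne hj.symm, Function.update_of_ne hk,
      Function.update_of_ne hk.symm, Function.update_of_ne h, Function.update_of_ne h.symm]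
    refine LEq.step₀ (LEq.fuse .green 0 0 (N + 0) {o i, N + 2} {N + 4, N + 6})
      {.had s(N + 2, N + 3), .spider .green 0 {o k, N + 1, N + 3},
       .had s(N + 6, N + 7), .spider .green 0 {o j, N + 5, N + 7}} {N + 0} ?_
    exact (LEq.fuse .green 0 0 (N + 0) {o i, N + 6} {N + 4, N + 2}).symm.sub
      {.had s(N + 2, N + 3), .spider .green 0 {o k, N + 1, N + 3},
       .had s(N + 6, N + 7), .spider .green 0 {o j, N + 5, N + 7}}

theorem cz_comm_disjoint {i j k l : Fin n} (h₁ : i ≠ k) (h₂ : i ≠ l) (h₃ : j ≠ k) (h₄ : j ≠ l)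
    (hij : i ≠ j) (hkl : k ≠ l) (ψ : St n) :
    cz i j (cz k l ψ) = cz k l (cz i j ψ) := by
  have := Circuit.run_eq (.cons (nCZ k l hkl 0 1 2 3) (.cons (nCZ i j hij 4 5 6 7) .nil))
    (.cons (nCZ i j hij 4 5 6 7) (.cons (nCZ k l hkl 0 1 2 3) .nil))
    (by simp) (by simp) (fun N o => by
      simp [Function.update_comm h₁, Function.update_comm h₂, Function.update_comm h₃,
        Function.update_comm h₄])
    (fun N o => ?_) ψ
  · simpa using this
  · simp only [frag_cons, frag_nil, nCZ_frag, nCZ_name_out, Function.update_of_ne h₁,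
      Function.update_of_ne h₂, Function.update_of_ne h₃, Function.update_of_ne h₄,
      Function.update_of_ne h₁.symm, Function.update_of_ne h₂.symm, Function.update_of_ne h₃.symm,
      Function.update_of_ne h₄.symm]
    exact LEq.of_eq (by abel)

theorem cz_comm (i j k l : Fin n) (ψ : St n) :
    cz i j (cz k l ψ) = cz k l (cz i j ψ) := by
  by_cases hij : i = j
  · simp [cz, hij]
  by_cases hkl : k = l
  · simp [cz, hkl]
  by_cases h₁ : i = k
  · subst h₁
    by_cases h : j = l
    · rw [h]
    · exact cz_comm_same hij hkl h ψ
  by_cases h₂ : i = l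
  · subst h₂
    by_cases h : j = k
    · rw [h, cz_symm k i, cz_symm i k, cz_symm k i]
    · rw [cz_symm k i, cz_symm k i]
      exact cz_comm_same hij (Ne.symm hkl) h ψ
  by_cases h₃ : j = k
  · subst h₃
    rw [cz_symm i j, cz_symm i j]
    exact cz_comm_same (Ne.symm hij) hkl h₂ ψ
  by_cases h₄ : j = l
  · subst h₄
    rw [cz_symm i j, cz_symm i j, cz_symm k j, cz_symm k j]
    exact cz_comm_same (Ne.symm hij) (Ne.symm hkl) h₁ ψ
  exact cz_comm_disjoint h₁ h₂ h₃ h₄ hij hkl ψ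

end ToyCalculus

/-! ### Relations from the Hopf law, the copy rule for `11` and the bialgebra rule -/

namespace ToyCalculus

variable {n : ℕ}

open Circuit

/-- Fusion gives two green nodes joined by two edges with H. Colour change of a node split off at
`j` cancels these H, and the Hopf law cuts the two remaining wires between a green and a red node.
-/
theorem cz_cz {i j : Fin n} (ψ : St n) : cz i j (cz i j ψ) = ψ := by
  by_cases h : i = j
  · simp [cz, h]
  have h' : i ≠ j := h
  have := Circuit.run_eq (.cons (nCZ i j h' 0 1 2 3) (.cons (nCZ i j h' 4 5 6 7) .nil))
    (.cons (nOp i (.phase .green 0) 4) (.cons (nOp j (.phase .green 0) 5) .nil))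
    (by simp) (by simp) (fun N o => by simp [Function.update_comm h']) (fun N o => ?_) ψ
  · simpa [ph_zero] using this
  · simp only [frag_cons, frag_nil, nCZ_frag, nCZ_name_out, nOp_frag, nOp_name_out, Op.node,
      Function.update_self, Function.update_of_ne h', Function.update_of_ne h'.symm]
    rw [Sym2.eq_swap (a := N + 2), Sym2.eq_swap (a := N + 6)]
    refine LEq.step₀ (LEq.fuse .green 0 0 (N + 0) {o i, N + 2} {N + 4, N + 6})
      {.had s(N + 3, N + 2), .spider .green 0 {o j, N + 1, N + 3}, .had s(N + 7, N + 6),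
        .spider .green 0 {N + 1, N + 5, N + 7}} {N + 0} ?_
    refine LEq.step₀ (LEq.fuse .green 0 0 (N + 1) {o j, N + 3} {N + 5, N + 7})
      {.had s(N + 3, N + 2), .had s(N + 7, N + 6),
        .spider .green 0 {o i, N + 4, N + 2, N + 6}} {N + 1} ?_
    refine LEq.step (fun z => LEq.split .green 0 0 {o j, N + 5} {N + 3, N + 7} z)
      {.had s(N + 3, N + 2), .had s(N + 7, N + 6),
        .spider .green 0 {o i, N + 4, N + 2, N + 6}} (fun z => {z}) 0 fun z => ?_
    refine LEq.step (fun y => LEq.colour₃ .green 0 z (N + 3) (N + 7) y (y + 1) (y + 2))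
      {.had s(N + 3, N + 2), .had s(N + 7, N + 6), .spider .green 0 {o j, N + 5, z},
        .spider .green 0 {o i, N + 4, N + 2, N + 6}} (fun y => {y, y + 1, y + 2}) 0 fun y => ?_
    refine LEq.step₀ (LEq.had_had .green (y + 1) (N + 3) (N + 2))
      {.had s(N + 7, N + 6), .had s(y, z), .had s(y + 2, N + 7),
        .spider .green 0 {o j, N + 5, z}, .spider .red 0 {y, y + 1, y + 2},
        .spider .green 0 {o i, N + 4, N + 2, N + 6}} {N + 3} ?_
    refine LEq.step₀ (LEq.had_had .green (y + 2) (N + 7) (N + 6))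
      {.spider .green 0 {y + 1, N + 2}, .had s(y, z),
        .spider .green 0 {o j, N + 5, z}, .spider .red 0 {y, y + 1, y + 2},
        .spider .green 0 {o i, N + 4, N + 2, N + 6}} {N + 7} ?_
    refine LEq.step₀ (LEq.fuse .green 0 0 (N + 2) {y + 1} {o i, N + 4, N + 6})
      {.spider .green 0 {y + 2, N + 6}, .had s(y, z),
        .spider .green 0 {o j, N + 5, z}, .spider .red 0 {y, y + 1, y + 2}} {N + 2} ?_
    refine LEq.step₀ (LEq.fuse .green 0 0 (N + 6) {y + 2} {o i, N + 4, y + 1})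
      {.had s(y, z), .spider .green 0 {o j, N + 5, z}, .spider .red 0 {y, y + 1, y + 2}}
      {N + 6} ?_
    refine LEq.step₀ (LEq.hopf .green 0 0 (y + 1) (y + 2) {o i, N + 4} {y})
      {.had s(y, z), .spider .green 0 {o j, N + 5, z}} {y + 1, y + 2} ?_
    refine LEq.step₀ (LEq.colour₁ .green 0 z y).symm
      {.spider .green 0 {o i, N + 4}, .spider .green 0 {o j, N + 5, z}} {y} ?_
    exact (LEq.fuse .green 0 0 z {o j, N + 5} 0).sub {.spider .green 0 {o i, N + 4}}

theorem LEq.copy11₂ (c : Colour) (a e x y x' y' : ℕ) :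
    LEq {.spider c (1, 1) {a, e}, .spider c.swap 0 {e, x, y}}
      {.spider c.swap 0 {a, x', y'}, .spider c (1, 1) {x', x}, .spider c (1, 1) {y', y}} :=
  .rule (by simpa using LocalRule.copy11 c a e {(x', x), (y', y)})

/-- The red `11` is copied through the green node at `i`; the copy on the edge becomes green when it
passes H and fuses into the node at `j`. -/
theorem rph_cz {i j : Fin n} (h : i ≠ j) (ψ : St n) :
    𝐑 i (1, 1) (cz i j ψ) = cz i j (𝐑 i (1, 1) (𝐆 j (1, 1) ψ)) := by
  have := Circuit.run_eq_of_rewrites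
    (.cons (nCZ i j h 0 1 2 3) (.cons (nOp i (.phase .red (1, 1)) 4) .nil))
    (fun ψ => cz i j (𝐑 i (1, 1) (𝐆 j (1, 1) ψ))) (by simp) (fun N o => ?_) ψ
  · simpa using this
  · simp only [frag_cons, frag_nil, nCZ_frag, nCZ_name_out, nOp_frag, nOp_name_out, Op.node,
      outs_cons, outs_nil, Function.update_self, Function.update_of_ne h]
    refine Rewrites.step (fun x => LEq.copy11₂ .red (N + 4) (N + 0) (o i) (N + 2) x (x + 1))
      {.had s(N + 2, N + 3), .spider .green 0 {o j, N + 1, N + 3}} (fun x => {x, x + 1}) {N + 0}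
      fun x => ?_
    refine Rewrites.step (fun s => LEq.colour₂ .red (1, 1) (x + 1) (N + 2) s (s + 1))
      {.had s(N + 2, N + 3), .spider .green 0 {o j, N + 1, N + 3},
        .spider .green 0 {N + 4, x, x + 1}, .spider .red (1, 1) {x, o i}} (fun s => {s, s + 1}) 0
      fun s => ?_
    refine Rewrites.step₀ (LEq.had_had .green (s + 1) (N + 2) (N + 3))
      {.had s(s, x + 1), .spider .green (1, 1) {s, s + 1}, .spider .green 0 {o j, N + 1, N + 3},
        .spider .green 0 {N + 4, x, x + 1}, .spider .red (1, 1) {x, o i}} {N + 2} ?_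
    refine Rewrites.step₀ (LEq.fuse .green 0 (1, 1) (s + 1) {N + 3} {s})
      {.had s(s, x + 1), .spider .green 0 {o j, N + 1, N + 3},
        .spider .green 0 {N + 4, x, x + 1}, .spider .red (1, 1) {x, o i}} {s + 1} ?_
    refine Rewrites.step₀ (LEq.fuse .green 0 (1, 1) (N + 3) {o j, N + 1} {s})
      {.had s(s, x + 1),
        .spider .green 0 {N + 4, x, x + 1}, .spider .red (1, 1) {x, o i}} {N + 3} ?_
    refine Rewrites.step (fun w => LEq.split .green (1, 1) 0 {o j} {N + 1, s} w)
      {.had s(s, x + 1),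
        .spider .green 0 {N + 4, x, x + 1}, .spider .red (1, 1) {x, o i}} (fun w => {w}) 0
      fun w => ?_
    refine Rewrites.done ⟨.cons (nOp j (.phase .green (1, 1)) w)
      (.cons (nOp i (.phase .red (1, 1)) x) (.cons (nCZ i j h (N + 4) (N + 1) (x + 1) s) .nil)),
      funext fun ψ => by simp, ?_, ?_⟩
    · simp [Function.update_comm h]
    · simp only [frag_cons, frag_nil, nCZ_frag, nCZ_name_out, nOp_frag, nOp_name_out, Op.node,
        Function.update_self, Function.update_of_ne h, Function.update_of_ne h.symm]
      rw [Sym2.eq_swap (a := s)]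
      simp only [Multiset.insert_eq_cons, ← Multiset.singleton_add, add_zero, zero_add, @add_comm (Multiset ℕ), @add_left_comm (Multiset ℕ),
        @add_assoc (Multiset ℕ)]
      abel

theorem rph_ph (i : Fin n) (x y : ZMod 2) (ψ : St n) :
    𝐑 i (1, 1) (𝐆 i (x, y) ψ) = 𝐆 i (y, x) (𝐑 i (1, 1) ψ) := by
  refine Circuit.run_eq (.cons (nOp i (.phase .green (x, y)) 0)
      (.cons (nOp i (.phase .red (1, 1)) 1) .nil))
    (.cons (nOp i (.phase .red (1, 1)) 0) (.cons (nOp i (.phase .green (y, x)) 1) .nil))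
    (by simp) (by simp) (fun N o => ?_) (fun N o => ?_) ψ
  · simp
  · simp only [frag_cons, frag_nil, nOp_frag, nOp_name_out, Op.node, Function.update_self]
    exact (LEq.rule (LocalRule.comm11 .green x y (o i) (N + 1) (N + 0) (N + 0))).sub 0

theorem LEq.bialgebra (a₁ a₂ b₁ b₂ e₁₁ e₁₂ e₂₁ e₂₂ e : ℕ) :
    LEq {.spider .red 0 {a₁, a₂, e}, .spider .green 0 {e, b₁, b₂}}
      {.spider .green 0 {a₁, e₁₁, e₁₂}, .spider .green 0 {a₂, e₂₁, e₂₂},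
        .spider .red 0 {e₁₁, e₂₁, b₁}, .spider .red 0 {e₁₂, e₂₂, b₂}} :=
  LEq.symm (.rule (.bialgebra .green a₁ a₂ b₁ b₂ e₁₁ e₁₂ e₂₁ e₂₂ e))

/-- Substituting `x_j + x_i` for `x_j` in a bilinear term gives two terms. Graphically, the
bialgebra rule moves the green node at `j` through the red one and creates a second edge, which
starts at `i`. -/
theorem cz_cx {i j k : Fin n} (hij : i ≠ j) (hjk : j ≠ k) (hik : i ≠ k) (ψ : St n) :
    cz j k (cx i j ψ) = cx i j (cz j k (cz i k ψ)) := by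
  have := Circuit.run_eq_of_rewrites
    (.cons (nCX i j hij 0 1 2) (.cons (nCZ j k hjk 3 4 5 6) .nil))
    (fun ψ => cx i j (cz j k (cz i k ψ))) (by simp) (fun N o => ?_) ψ
  · simpa using this
  · simp only [frag_cons, frag_nil, nCZ_frag, nCZ_name_out, nCX_frag, nCX_name_out,
      outs_cons, outs_nil, Function.update_self, Function.update_of_ne hik.symm,
      Function.update_of_ne hjk.symm]
    refine Rewrites.step (fun p => LEq.bialgebra (N + 2) (o j) (N + 3) (N + 5) p (p + 1) (p + 2)
      (p + 3) (N + 1)) {.spider .green 0 {o i, N + 0, N + 2}, .had s(N + 5, N + 6),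
        .spider .green 0 {o k, N + 4, N + 6}} (fun p => {p, p + 1, p + 2, p + 3}) {N + 1}
      fun p => ?_
    refine Rewrites.step₀ (LEq.fuse .green 0 0 (N + 2) {o i, N + 0} {p, p + 1})
      {.spider .green 0 {o j, p + 2, p + 3}, .spider .red 0 {p, p + 2, N + 3},
        .spider .red 0 {p + 1, p + 3, N + 5}, .had s(N + 5, N + 6),
        .spider .green 0 {o k, N + 4, N + 6}} {N + 2} ?_
    refine Rewrites.step (fun q => LEq.colour₃ .red 0 (p + 1) (p + 3) (N + 5) q (q + 1) (q + 2))
      {.spider .green 0 {o j, p + 2, p + 3}, .spider .red 0 {p, p + 2, N + 3},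
        .spider .green 0 {o i, N + 0, p, p + 1}, .had s(N + 5, N + 6),
        .spider .green 0 {o k, N + 4, N + 6}} (fun q => {q, q + 1, q + 2}) 0 fun q => ?_
    refine Rewrites.step₀ (LEq.had_had .green (q + 2) (N + 5) (N + 6))
      {.spider .green 0 {o j, p + 2, p + 3}, .spider .red 0 {p, p + 2, N + 3},
        .spider .green 0 {o i, N + 0, p, p + 1}, .spider .green 0 {q, q + 1, q + 2},
        .had s(q, p + 1), .had s(q + 1, p + 3),
        .spider .green 0 {o k, N + 4, N + 6}} {N + 5} ?_
    refine Rewrites.step₀ (LEq.fuse .green 0 0 (N + 6) {q + 2} {o k, N + 4})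
      {.spider .green 0 {o j, p + 2, p + 3}, .spider .red 0 {p, p + 2, N + 3},
        .spider .green 0 {o i, N + 0, p, p + 1}, .spider .green 0 {q, q + 1, q + 2},
        .had s(q, p + 1), .had s(q + 1, p + 3)} {N + 6} ?_
    refine Rewrites.step₀ (LEq.fuse .green 0 0 (q + 2) {q, q + 1} {o k, N + 4})
      {.spider .green 0 {o j, p + 2, p + 3}, .spider .red 0 {p, p + 2, N + 3},
        .spider .green 0 {o i, N + 0, p, p + 1},
        .had s(q, p + 1), .had s(q + 1, p + 3)} {q + 2} ?_
    refine Rewrites.step (fun r => LEq.split .green 0 0 {o k, q} {q + 1, N + 4} r)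
      {.spider .green 0 {o j, p + 2, p + 3}, .spider .red 0 {p, p + 2, N + 3},
        .spider .green 0 {o i, N + 0, p, p + 1},
        .had s(q, p + 1), .had s(q + 1, p + 3)} (fun r => {r}) 0 fun r => ?_
    refine Rewrites.step (fun t => LEq.split .green 0 0 {o i, p + 1} {p, N + 0} t)
      {.spider .green 0 {o j, p + 2, p + 3}, .spider .red 0 {p, p + 2, N + 3},
        .spider .green 0 {o k, q, r}, .spider .green 0 {q + 1, N + 4, r},
        .had s(q, p + 1), .had s(q + 1, p + 3)} (fun r => {r}) 0 fun t => ?_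
    refine Rewrites.done ⟨.cons (nCZ i k hik t r (p + 1) q)
      (.cons (nCZ j k hjk (p + 2) (N + 4) (p + 3) (q + 1)) (.cons (nCX i j hij (N + 0) (N + 3) p)
        .nil)), funext fun ψ => by simp, ?_, ?_⟩
    · simp [Function.update_comm hij, Function.update_comm hik, Function.update_comm hjk]
    · simp only [frag_cons, frag_nil, nCZ_frag, nCZ_name_out, nCX_frag, nCX_name_out,
        Function.update_self, Function.update_of_ne hij, Function.update_of_ne hij.symm,
        Function.update_of_ne hjk, Function.update_of_ne hik]
      rw [Sym2.eq_swap (a := q), Sym2.eq_swap (a := q + 1)]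
      simp only [Multiset.insert_eq_cons, ← Multiset.singleton_add, add_zero, zero_add, @add_comm (Multiset ℕ), @add_left_comm (Multiset ℕ),
        @add_assoc (Multiset ℕ)]
      abel

/-- The cross term of the quadratic form. The phase is split off as a green `01` state, which is
also a red `01` state. After the bialgebra rule it fuses into a red phase shift between the nodes at
`i` and `j`, and by `LEq.euler_phase` this is an edge with H and a phase `01` at each end. -/
theorem ph_cx_target {i j : Fin n} (h : i ≠ j) (ψ : St n) :
    𝐆 j (0, 1) (cx i j ψ) = cx i j (𝐆 i (0, 1) (𝐆 j (0, 1) (cz i j ψ))) := by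
  have := Circuit.run_eq_of_rewrites
    (.cons (nCX i j h 0 1 2) (.cons (nOp j (.phase .green (0, 1)) 3) .nil))
    (fun ψ => cx i j (𝐆 i (0, 1) (𝐆 j (0, 1) (cz i j ψ)))) (by simp) (fun N o => ?_) ψ
  · simpa using this
  · simp only [frag_cons, frag_nil, nOp_frag, nOp_name_out, nCX_frag, nCX_name_out, Op.node,
      outs_cons, outs_nil, Function.update_self]
    refine Rewrites.step (fun z => LEq.split .green 0 (0, 1) {N + 1, N + 3} 0 z)
      {.spider .green 0 {o i, N + 0, N + 2}, .spider .red 0 {N + 2, o j, N + 1}}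
      (fun z => {z}) 0 fun z => ?_
    refine Rewrites.step (fun p => LEq.bialgebra (N + 2) (o j) (N + 3) z p (p + 1) (p + 2)
      (p + 3) (N + 1)) {.spider .green 0 {o i, N + 0, N + 2}, .spider .green (0, 1) {z}}
      (fun p => {p, p + 1, p + 2, p + 3}) {N + 1} fun p => ?_
    refine Rewrites.step₀ (LEq.fuse .green 0 0 (N + 2) {o i, N + 0} {p, p + 1})
      {.spider .green 0 {o j, p + 2, p + 3}, .spider .red 0 {p, p + 2, N + 3},
        .spider .red 0 {p + 1, p + 3, z}, .spider .green (0, 1) {z}} {N + 2} ?_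
    refine Rewrites.step₀ (LEq.phase_state .green z)
      {.spider .green 0 {o j, p + 2, p + 3}, .spider .red 0 {p, p + 2, N + 3},
        .spider .red 0 {p + 1, p + 3, z}, .spider .green 0 {o i, N + 0, p, p + 1}} 0 ?_
    refine Rewrites.step₀ (LEq.fuse .red 0 (0, 1) z {p + 1, p + 3} 0)
      {.spider .green 0 {o j, p + 2, p + 3}, .spider .red 0 {p, p + 2, N + 3},
        .spider .green 0 {o i, N + 0, p, p + 1}} {z} ?_
    refine Rewrites.step (fun q => (LEq.euler_phase .green (p + 1) (p + 3) q (q + 1)).symm)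
      {.spider .green 0 {o j, p + 2, p + 3}, .spider .red 0 {p, p + 2, N + 3},
        .spider .green 0 {o i, N + 0, p, p + 1}} (fun q => {q, q + 1}) 0 fun q => ?_
    refine Rewrites.step₀ (LEq.fuse .green (0, 1) 0 (p + 1) {q} {o i, N + 0, p})
      {.spider .green 0 {o j, p + 2, p + 3}, .spider .red 0 {p, p + 2, N + 3}, .had s(q, q + 1),
        .spider .green (0, 1) {q + 1, p + 3}} {p + 1} ?_
    refine Rewrites.step₀ (LEq.fuse .green 0 (0, 1) (p + 3) {o j, p + 2} {q + 1})
      {.spider .green (0, 1) {q, o i, N + 0, p}, .spider .red 0 {p, p + 2, N + 3},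
        .had s(q, q + 1)} {p + 3} ?_
    refine Rewrites.step (fun w => LEq.split .green 0 (0, 1) {o j, q + 1} {p + 2} w)
      {.spider .green (0, 1) {q, o i, N + 0, p}, .spider .red 0 {p, p + 2, N + 3},
        .had s(q, q + 1)} (fun w => {w}) 0 fun w => ?_
    refine Rewrites.step (fun s => LEq.split .green (0, 1) 0 {o i, q} {N + 0, p} s)
      {.spider .green 0 {o j, q + 1, w}, .spider .green (0, 1) {w, p + 2},
        .spider .red 0 {p, p + 2, N + 3}, .had s(q, q + 1)} (fun s => {s}) 0 fun s => ?_
    refine Rewrites.step (fun t => LEq.split .green 0 (0, 1) {o i, q} {s} t)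
      {.spider .green 0 {s, N + 0, p}, .spider .green 0 {o j, q + 1, w},
        .spider .green (0, 1) {w, p + 2},
        .spider .red 0 {p, p + 2, N + 3}, .had s(q, q + 1)} (fun t => {t}) 0 fun t => ?_
    refine Rewrites.done ⟨.cons (nCZ i j h t w q (q + 1))
      (.cons (nOp j (.phase .green (0, 1)) (p + 2)) (.cons (nOp i (.phase .green (0, 1)) s)
        (.cons (nCX i j h (N + 0) (N + 3) p) .nil))), funext fun ψ => by simp, ?_, ?_⟩
    · simp [Function.update_comm h]
    · simp only [frag_cons, frag_nil, nCZ_frag, nCZ_name_out, nCX_frag, nCX_name_out, nOp_frag,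
        nOp_name_out, Op.node, Function.update_self, Function.update_of_ne h,
        Function.update_of_ne h.symm]
      simp only [Multiset.insert_eq_cons, ← Multiset.singleton_add, add_zero, zero_add, @add_comm (Multiset ℕ), @add_left_comm (Multiset ℕ),
        @add_assoc (Multiset ℕ)]
      abel

end ToyCalculus

namespace ToyCalculus

variable {n : ℕ}

open Circuit

/-! ### Product states -/

theorem legsOf_map_singleton {ι : Type*} (s : Multiset ι) (c : ι → Colour) (p : ι → Phase)
    (w : ι → ℕ) : legsOf (s.map fun v => .spider (c v) (p v) {w v}) = s.map w := by
  rw [legsOf, Multiset.bind_map]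
  exact Multiset.bind_singleton s w

/-- The diagram with a red node for each output in `B` and a green node for each other output. -/
def baseD (B : Finset (Fin n)) : Diagram 0 n :=
  .state Fin.val (Finset.univ.val.map fun v : Fin n =>
    Node.spider (if v ∈ B then .red else .green) 0 {(v : ℕ)}) 0 fun e => by
    rw [legsOf_map_singleton, ends, ← two_nsmul, Multiset.count_nsmul]
    have h : (Finset.univ.val.map (Fin.val : Fin n → ℕ)).Nodup :=
      Finset.univ.nodup.map Fin.val_injective
    have := Multiset.nodup_iff_count_le_one.1 h e
    omega

theorem baseD_nodes_eq (B : Finset (Fin n)) : (baseD B).nodes =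
    Finset.univ.val.map fun v : Fin n =>
      Node.spider (if v ∈ B then .red else .green) 0 {(v : ℕ)} := rfl

def base (B : Finset (Fin n)) : St n := cls (baseD B)

theorem univ_val_eq_cons (i : Fin n) :
    (Finset.univ : Finset (Fin n)).val = i ::ₘ (Finset.univ.erase i).val := by
  rw [Finset.erase_val, Multiset.cons_erase (Finset.mem_univ_val i)]

theorem baseD_nodes (B : Finset (Fin n)) (i : Fin n) : (baseD B).nodes =
    {Node.spider (if i ∈ B then .red else .green) 0 {(i : ℕ)}} +
      (Finset.univ.erase i).val.map fun v : Fin n =>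
        Node.spider (if v ∈ B then .red else .green) 0 {(v : ℕ)} := by
  rw [baseD_nodes_eq, univ_val_eq_cons i, Multiset.map_cons, Multiset.singleton_add]

/-- Only the red node at the output `i` matters, so this fact and the next ones allow an arbitrary
remainder `R` of the diagram. -/
theorem hd_cls_red {D D' : Diagram 0 n} {i : Fin n} {R : Multiset Node}
    (hD : D.nodes = {.spider .red 0 {D.output i}} + R)
    (hD' : D'.nodes = {.spider .green 0 {D.output i}} + R) (ho : D'.output = D.output)
    (hc : D'.circles = D.circles) : 𝐇 i (cls D) = cls D' := by
  have := Circuit.run_eq_on (.cons (nOp i .had 0) .nil) (.cons (nOp i (.phase .green 0) 0) .nil)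
    D D' _ _ R hD hD' ho hc (by simp) (by simp) (fun N => by simp) (fun N => ?_)
  · simpa [ph_zero] using this
  · simp only [frag_cons, frag_nil, nOp_frag, Op.node]
    refine LEq.step₀ (B := {.spider .green 0 {N + 0}})
      (LEq.colour₁ .green 0 (N + 0) (D.output i)).symm 0 {D.output i} ?_
    exact (LEq.fuse .green 0 0 (D.output i) 0 {N + 0}).symm.sub 0

theorem ph_cls_red {D : Diagram 0 n} {i : Fin n} {R : Multiset Node} (p : Phase)
    (hD : D.nodes = {.spider .red 0 {D.output i}} + R) : 𝐆 i p (cls D) = cls D := by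
  have := Circuit.run_eq_on (.cons (nOp i (.phase .green p) 0) .nil)
    (.cons (nOp i (.phase .green 0) 0) .nil)
    D D _ _ R hD hD rfl rfl (by simp) (by simp) (fun N => by simp) (fun N => ?_)
  · simpa [ph_zero] using this
  · simp only [frag_cons, frag_nil, nOp_frag, Op.node]
    refine LEq.step₀ (LEq.copy_phase .green p (D.output i) (N + 0)) 0 {D.output i} ?_
    exact (LEq.copy_phase .green 0 (D.output i) (N + 0)).symm.sub 0

theorem cz_cls_red {D : Diagram 0 n} {i j : Fin n} {R : Multiset Node}
    (hD : D.nodes = {.spider .red 0 {D.output i}} + R) : cz i j (cls D) = cls D := by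
  by_cases h : i = j
  · simp [cz, h]
  have h' : i ≠ j := h
  have := Circuit.run_eq_on (.cons (nCZ i j h' 0 1 2 3) .nil)
    (.cons (nOp i (.phase .green 0) 0) (.cons (nOp j (.phase .green 0) 1) .nil))
    D D _ _ R hD hD rfl rfl (by simp) (by simp) (fun N => by simp) (fun N => ?_)
  · simpa [ph_zero] using this
  · simp only [frag_cons, frag_nil, nOp_frag, nOp_name_out, nCZ_frag, Op.node,
      Function.update_of_ne h'.symm]
    refine LEq.step₀ (LEq.copy .green (N + 0) (N + 2) (D.output i))
      {.had s(N + 2, N + 3), .spider .green 0 {D.output j, N + 1, N + 3}} {D.output i} ?_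
    rw [Sym2.eq_swap]
    refine LEq.step₀ (B := {.spider .red 0 {N + 2}, .had s(N + 2, N + 3)})
      (by rw [Sym2.eq_swap]; exact LEq.refl _)
      {.spider .red 0 {N + 0}, .spider .green 0 {D.output j, N + 1, N + 3}} 0 ?_
    refine LEq.step₀ (LEq.colour₁ .green 0 (N + 3) (N + 2)).symm
      {.spider .red 0 {N + 0}, .spider .green 0 {D.output j, N + 1, N + 3}} {N + 2} ?_
    refine LEq.step₀ (LEq.fuse .green 0 0 (N + 3) 0 {D.output j, N + 1})
      {.spider .red 0 {N + 0}} {N + 3} ?_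
    exact (LEq.copy_phase .green 0 (D.output i) (N + 0)).symm.sub
      {.spider .green 0 {D.output j, N + 1}}

theorem LEq.cz_green (a b x y u v : ℕ) : LEq ({.spider .green 0 {a, u, x}, .had s(x, y),
      .spider .green 0 {b, v, y}} + {.spider .green 0 {a}, .spider .green 0 {b}})
    {.had s(u, v)} := by
  refine LEq.step₀ (LEq.fuse .green 0 0 a {u, x} 0)
    {.had s(x, y), .spider .green 0 {b, v, y}, .spider .green 0 {b}} {a} ?_
  refine LEq.step₀ (LEq.fuse .green 0 0 b {v, y} 0)
    {.had s(x, y), .spider .green 0 {u, x}} {b} ?_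
  refine LEq.step₀ (LEq.absorb_had .green u x y) {.spider .green 0 {v, y}} {x} ?_
  rw [Sym2.eq_swap, Sym2.eq_swap (a := u)]
  exact (LEq.absorb_had .green v y u).sub 0

/-- On two green states the controlled phase is a bare wire carrying one H. A further H at either
end cancels it, and the result is the same plain wire. -/
theorem hd_cz_cls_green {D : Diagram 0 n} {a b : Fin n} (hab : a ≠ b) {R : Multiset Node}
    (hD : D.nodes = {.spider .green 0 {D.output a}, .spider .green 0 {D.output b}} + R) :
    𝐇 b (cz a b (cls D)) = 𝐇 a (cz a b (cls D)) := by
  have := Circuit.run_eq_on (.cons (nCZ a b hab 0 1 2 3) (.cons (nOp b .had 4) .nil))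
    (.cons (nCZ a b hab 1 4 2 3) (.cons (nOp a .had 0) .nil))
    D D _ _ R hD hD rfl rfl (by simp) (by simp) (fun N => by simp [Function.update_comm hab])
    (fun N => ?_)
  · simpa using this
  · simp only [frag_cons, frag_nil, nOp_frag, nOp_name_out, nCZ_frag, nCZ_name_out, Op.node,
      Function.update_self, Function.update_of_ne hab]
    refine LEq.step₀ (LEq.cz_green (D.output a) (D.output b) (N + 2) (N + 3) (N + 0) (N + 1)) {.had s(N + 1, N + 4)}
      {D.output a, D.output b, N + 2, N + 3} ?_
    refine LEq.step₀ (LEq.had_had .green (N + 0) (N + 1) (N + 4)) 0 {N + 1} ?_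
    refine LEq.symm ?_
    refine LEq.step₀ (LEq.cz_green (D.output a) (D.output b) (N + 2) (N + 3) (N + 1) (N + 4)) {.had s(N + 1, N + 0)}
      {D.output a, D.output b, N + 2, N + 3} ?_
    rw [Sym2.eq_swap (a := N + 1) (b := N + 0)]
    exact (LEq.had_had .green (N + 0) (N + 1) (N + 4)).sub 0

theorem hd_base {i : Fin n} {B : Finset (Fin n)} (h : i ∈ B) :
    𝐇 i (base B) = base (B.erase i) := by
  refine hd_cls_red (R := (Finset.univ.erase i).val.map fun v : Fin n =>
        Node.spider (if v ∈ B then .red else .green) 0 {(v : ℕ)}) ?_ ?_ rfl rfl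
  · rw [baseD_nodes B i, if_pos h]; rfl
  · rw [baseD_nodes (B.erase i) i, if_neg (Finset.notMem_erase i B)]
    congr 1
    refine Multiset.map_congr rfl fun v hv => ?_
    have hv : v ≠ i := Finset.ne_of_mem_erase (Finset.mem_def.2 hv)
    simp [hv]

theorem hd_base_of_notMem {i : Fin n} {B : Finset (Fin n)} (h : i ∉ B) :
    𝐇 i (base B) = base (insert i B) := by
  rw [← hd_hd i (base (insert i B)), hd_base (Finset.mem_insert_self i B),
    Finset.erase_insert h]

theorem ph_base {i : Fin n} {B : Finset (Fin n)} (h : i ∈ B) (p : Phase) :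
    𝐆 i p (base B) = base B :=
  ph_cls_red p ((baseD_nodes B i).trans (by rw [if_pos h]; rfl))

theorem cz_base {i : Fin n} {B : Finset (Fin n)} (h : i ∈ B) (j : Fin n) :
    cz i j (base B) = base B :=
  cz_cls_red ((baseD_nodes B i).trans (by rw [if_pos h]; rfl))

theorem rph_base {i : Fin n} {B : Finset (Fin n)} (h : i ∉ B) (p : Phase) :
    𝐑 i p (base B) = base B := by
  rw [rph_eq, hd_base_of_notMem h, ph_base (Finset.mem_insert_self i B),
    hd_base (Finset.mem_insert_self i B), Finset.erase_insert h]

theorem hd_cz_base {a b : Fin n} (hab : a ≠ b) {B : Finset (Fin n)} (ha : a ∉ B) (hb : b ∉ B) :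
    𝐇 b (cz a b (base B)) = 𝐇 a (cz a b (base B)) := by
  refine hd_cz_cls_green hab (R := ((Finset.univ.erase a).erase b).val.map fun v : Fin n =>
        Node.spider (if v ∈ B then .red else .green) 0 {(v : ℕ)}) ?_
  have h : (Finset.univ.erase a).val = b ::ₘ ((Finset.univ.erase a).erase b).val := by
    rw [Finset.erase_val _ b, Multiset.cons_erase]
    exact Finset.mem_erase.2 ⟨hab.symm, Finset.mem_univ b⟩
  rw [baseD_nodes B a, if_neg ha, h, Multiset.map_cons, if_neg hb, ← Multiset.singleton_add,
    Multiset.insert_eq_cons, ← Multiset.singleton_add, add_assoc]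
  rfl

/-! ### The projection of the last output -/

theorem cap_op (i : Fin n) (a : Op) (ψ : St (n + 1)) :
    cap (op i.castSucc a ψ) = op i a (cap ψ) := by
  refine Circuit.run_eq (.cons (nOp i.castSucc a 0) (.cons (nCap n) .nil))
    (.cons (nCap n) (.cons (nOp i a 0) .nil)) (by simp) (by simp) (fun N o => ?_)
    (fun N o => ?_) ψ
  · simp only [outs_cons, outs_nil, nOp_name_out, nCap_name_out]
    exact Function.update_comp_eq_of_injective _ (Fin.castSucc_injective n) _ _
  · simp only [frag_cons, frag_nil, nOp_frag, nOp_name_out, nCap_frag, nCap_name_out,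
      Function.update_of_ne (Fin.castSucc_lt_last i).ne', Function.comp_apply]
    exact LEq.of_eq (by abel)

theorem cap_cz (i j : Fin n) (ψ : St (n + 1)) :
    cap (cz i.castSucc j.castSucc ψ) = cz i j (cap ψ) := by
  by_cases h : i = j
  · simp [cz, h]
  have h' : i ≠ j := h
  have h'' : i.castSucc ≠ j.castSucc := fun e => h (Fin.castSucc_injective n e)
  have := Circuit.run_eq (.cons (nCZ i.castSucc j.castSucc h'' 0 1 2 3) (.cons (nCap n) .nil))
    (.cons (nCap n) (.cons (nCZ i j h' 0 1 2 3) .nil)) (by simp) (by simp) (fun N o => ?_)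
    (fun N o => ?_) ψ
  · simpa using this
  · simp only [outs_cons, outs_nil, nCZ_name_out, nCap_name_out]
    rw [Function.update_comp_eq_of_injective _ (Fin.castSucc_injective n),
      Function.update_comp_eq_of_injective _ (Fin.castSucc_injective n)]
  · simp only [frag_cons, frag_nil, nCZ_frag, nCZ_name_out, nCap_frag, nCap_name_out,
      Function.update_of_ne (Fin.castSucc_lt_last i).ne',
      Function.update_of_ne (Fin.castSucc_lt_last j).ne', Function.comp_apply]
    exact LEq.of_eq (by abel)

theorem cap_ph_last (p : Phase) (ψ : St (n + 1)) : cap (𝐆 (Fin.last n) p ψ) = cap ψ := by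
  refine Circuit.run_eq (.cons (nOp (Fin.last n) (.phase .green p) 0) (.cons (nCap n) .nil))
    (.cons (nCap n) .nil) (by simp) (by simp) (fun N o => ?_)
    (fun N o => ?_) ψ
  · simp only [outs_cons, outs_nil, nOp_name_out, nCap_name_out]
    funext i
    exact Function.update_of_ne (Fin.castSucc_lt_last i).ne _ _
  · simp only [frag_cons, frag_nil, nOp_frag, nOp_name_out, nCap_frag, Function.update_self,
      Op.node]
    exact (LEq.copy_phase .green p (N + 0) (o (Fin.last n))).sub 0

/-- The red state is copied through the green node at the last output. The copy on the edge turns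
green at H and fuses into the node at `j`, which is left with two legs. -/
theorem cap_cz_last (j : Fin (n + 1)) (ψ : St (n + 1)) : cap (cz (Fin.last n) j ψ) = cap ψ := by
  refine Fin.lastCases ?_ (fun j => ?_) j
  · simp [cz]
  have h : Fin.last n ≠ j.castSucc := (Fin.castSucc_lt_last j).ne'
  have := Circuit.run_eq (.cons (nCZ (Fin.last n) j.castSucc h 0 1 2 3) (.cons (nCap n) .nil))
    (.cons (nCap n) (.cons (nOp j (.phase .green 0) 1) .nil)) (by simp) (by simp)
    (fun N o => ?_) (fun N o => ?_) ψ
  · simpa [ph_zero] using this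
  · simp only [outs_cons, outs_nil, nCZ_name_out, nCap_name_out, nOp_name_out]
    rw [Function.update_comp_eq_of_injective _ (Fin.castSucc_injective n)]
    congr 1
    funext i
    exact Function.update_of_ne (Fin.castSucc_lt_last i).ne _ _
  · simp only [frag_cons, frag_nil, nCZ_frag, nCZ_name_out, nCap_frag, nCap_name_out, nOp_frag,
      Function.update_of_ne h, Function.update_self, Op.node, Function.comp_apply]
    refine LEq.step₀ (B := {.spider .red 0 {N + 2}, .spider .red 0 {o (Fin.last n)}})
      (LEq.copy .green (N + 2) (o (Fin.last n)) (N + 0))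
      {.had s(N + 2, N + 3), .spider .green 0 {o j.castSucc, N + 1, N + 3}} {N + 0} ?_
    refine LEq.step₀ (LEq.colour₁ .green 0 (N + 3) (N + 2)).symm
      {.spider .red 0 {o (Fin.last n)}, .spider .green 0 {o j.castSucc, N + 1, N + 3}} {N + 2} ?_
    exact (LEq.fuse .green 0 0 (N + 3) 0 {o j.castSucc, N + 1}).sub
      {.spider .red 0 {o (Fin.last n)}}

theorem cap_cls (D : Diagram 0 (n + 1)) : ∃ D' : Diagram 0 n, cap (cls D) = cls D' ∧
    D'.output = D.output ∘ Fin.castSucc ∧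
    D'.nodes = {.spider .red 0 {D.output (Fin.last n)}} + D.nodes ∧ D'.circles = D.circles := by
  obtain ⟨E, h1, h2, h3, h4⟩ := (cons (nCap n) nil).exists_run D 0 (by simp) (by simp)
  exact ⟨E, h1, by simpa using h2, by simpa using h3, h4⟩

/-- The outputs in `B` other than the last one. -/
def initial (B : Finset (Fin (n + 1))) : Finset (Fin n) := Finset.univ.filter fun i => i.castSucc ∈ B

@[simp] theorem mem_initial {B : Finset (Fin (n + 1))} {i : Fin n} :
    i ∈ initial B ↔ i.castSucc ∈ B := by simp [initial]

theorem baseD_nodes_last (B : Finset (Fin (n + 1))) : (baseD B).nodes =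
    {Node.spider (if Fin.last n ∈ B then .red else .green) 0 {n}} + (baseD (initial B)).nodes := by
  rw [baseD_nodes_eq, baseD_nodes_eq, Fin.univ_castSuccEmb, Finset.cons_val, Multiset.map_cons, Multiset.singleton_add,
    Finset.map_val, Multiset.map_map]
  congr 1
  refine Multiset.map_congr rfl fun i _ => ?_
  simp

theorem cap_base {B : Finset (Fin (n + 1))} (h : Fin.last n ∉ B) :
    cap (base B) = base (initial B) := by
  obtain ⟨E, h1, h2, h3, h4⟩ := cap_cls (baseD B)
  rw [base, h1]
  refine LEq.scalar_pair .green 0 n E _ (baseD (initial B)).nodes ?_ (zero_add _).symm h2.symm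
    h4.symm
  rw [h3, baseD_nodes_last, if_neg h, ← add_assoc]
  rfl

end ToyCalculus

namespace ToyCalculus

variable {n : ℕ}

/-! ### Commutation relations -/

theorem Phase.cases (p : Phase) : p = 0 ∨ p = (0, 1) ∨ p = (1, 1) ∨ p = (1, 1) + (0, 1) := by
  revert p; decide

theorem ph_ph_self (i : Fin n) (ψ : St n) : 𝐆 i (0, 1) (𝐆 i (0, 1) ψ) = ψ := by
  rw [ph_ph, zero_one_add_zero_one, ph_zero]

theorem ph_ph_comm (i : Fin n) (p q : Phase) (ψ : St n) :
    𝐆 i p (𝐆 i q ψ) = 𝐆 i q (𝐆 i p ψ) := by rw [ph_ph, ph_ph, add_comm]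

theorem ph_comm (i j : Fin n) (p q : Phase) (ψ : St n) :
    𝐆 i p (𝐆 j q ψ) = 𝐆 j q (𝐆 i p ψ) := by
  by_cases h : i = j
  · rw [h, ph_ph_comm]
  · exact op_comm h _ _ ψ

theorem ph_cz_comm (k i j : Fin n) (p : Phase) (ψ : St n) :
    𝐆 k p (cz i j ψ) = cz i j (𝐆 k p ψ) := by
  by_cases hi : k = i
  · rw [hi, ph_cz]
  by_cases hj : k = j
  · rw [hj, cz_symm, ph_cz, cz_symm]
  · exact op_cz hi hj _ ψ

theorem hd_cx (i j : Fin n) (ψ : St n) : 𝐇 j (cx i j ψ) = cz i j (𝐇 j ψ) := by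
  rw [cx_eq, hd_hd]

theorem hd_rph (i : Fin n) (p : Phase) (ψ : St n) : 𝐇 i (𝐑 i p ψ) = 𝐆 i p (𝐇 i ψ) := by
  rw [rph_eq, hd_hd]

theorem rph_hd (i : Fin n) (p : Phase) (ψ : St n) : 𝐑 i p (𝐇 i ψ) = 𝐇 i (𝐆 i p ψ) := by
  rw [rph_eq, hd_hd]

theorem rph_rph (i : Fin n) (p q : Phase) (ψ : St n) :
    𝐑 i p (𝐑 i q ψ) = 𝐑 i (p + q) ψ := by
  rw [rph_eq, hd_rph, ph_ph, ← rph_eq]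

theorem rph_zero (i : Fin n) (ψ : St n) : 𝐑 i 0 ψ = ψ := by rw [rph_eq, ph_zero, hd_hd]

theorem cx_cx (i j : Fin n) (ψ : St n) : cx i j (cx i j ψ) = ψ := by
  rw [cx_eq, hd_cx, cz_cz, hd_hd]

theorem op_cx {i j k : Fin n} (hi : k ≠ i) (hj : k ≠ j) (a : Op) (ψ : St n) :
    op k a (cx i j ψ) = cx i j (op k a ψ) := by
  rw [cx_eq, cx_eq, op_comm hj, op_cz hi hj, op_comm hj]

theorem ph_cx_control {i j : Fin n} (h : i ≠ j) (p : Phase) (ψ : St n) :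
    𝐆 i p (cx i j ψ) = cx i j (𝐆 i p ψ) := by
  rw [cx_eq, cx_eq, op_comm h, ph_cz, op_comm h]

theorem ph_cx_comm {k i j : Fin n} (h : k ≠ j) (p : Phase) (ψ : St n) :
    𝐆 k p (cx i j ψ) = cx i j (𝐆 k p ψ) := by
  by_cases hi : k = i
  · subst hi; exact ph_cx_control h p ψ
  · exact op_cx hi h _ ψ

theorem cz_cx_comm {i j k l : Fin n} (hk : j ≠ k) (hl : j ≠ l) (ψ : St n) :
    cz k l (cx i j ψ) = cx i j (cz k l ψ) := by
  rw [cx_eq, cx_eq, ← op_cz hk hl, cz_comm, ← op_cz hk hl]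

theorem cx_cx_comm {i j k l : Fin n} (hjk : j ≠ k) (hli : l ≠ i) (ψ : St n) :
    cx i j (cx k l ψ) = cx k l (cx i j ψ) := by
  by_cases h : j = l
  · subst h
    rw [cx_eq, hd_cx, cz_comm, cx_eq k, hd_cx]
  · rw [cx_eq k l, cx_eq k l, ← op_cx hli (Ne.symm h), ← cz_cx_comm hjk h,
      ← op_cx hli (Ne.symm h)]

/-- This is `cz_cx` conjugated by H at `k`. -/
theorem cx_cx_chain {i j k : Fin n} (hij : i ≠ j) (hjk : j ≠ k) (hik : i ≠ k) (ψ : St n) :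
    cx j k (cx i j ψ) = cx i j (cx i k (cx j k ψ)) := by
  rw [cx_eq j k, op_cx hik.symm hjk.symm, cz_cx hij hjk hik, op_cx hik.symm hjk.symm,
    cz_comm, cx_eq i k, hd_cx]

/-- Solving `ph_cx_target` for `cz` writes it as a word in `cx` and phase shifts `01`. All factors
are involutions, and the word commutes with `cx` by applying the relation once more. -/
theorem cz_cx_same {i j : Fin n} (h : i ≠ j) (ψ : St n) :
    cz i j (cx i j ψ) = cx i j (cz i j ψ) := by
  have key : ∀ ψ : St n, cx i j (𝐆 j (0, 1) (cx i j ψ)) =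
      𝐆 i (0, 1) (𝐆 j (0, 1) (cz i j ψ)) := fun ψ => by rw [ph_cx_target h, cx_cx]
  have h1 : ∀ ψ : St n, cz i j ψ = 𝐆 j (0, 1) (𝐆 i (0, 1) (cx i j (𝐆 j (0, 1) (cx i j ψ)))) :=
    fun ψ => by rw [key, ph_ph_self, ph_ph_self]
  rw [h1 ψ, ph_comm j i, ← ph_cx_control h, key, ph_ph_self, ← ph_cz_comm, ph_ph_self]

/-- The phase `11` is linear in the variable, so there is no cross term. Under H at `j` the claim
turns into `rph_cz`. -/
theorem ph_cx_eleven {i j : Fin n} (h : i ≠ j) (ψ : St n) :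
    𝐆 j (1, 1) (cx i j ψ) = cx i j (𝐆 i (1, 1) (𝐆 j (1, 1) ψ)) := by
  rw [cx_eq, ← hd_rph, cz_symm, rph_cz h.symm, op_comm h, rph_hd, cz_symm, cx_eq, ph_comm j i]

theorem rph_cx_target (i j : Fin n) (p : Phase) (ψ : St n) :
    𝐑 j p (cx i j ψ) = cx i j (𝐑 j p ψ) := by
  rw [rph_eq, hd_cx, ph_cz_comm, cx_eq, hd_rph]

theorem rph_cx_control {i j : Fin n} (h : i ≠ j) (ψ : St n) :
    𝐑 i (1, 1) (cx i j ψ) = cx i j (𝐑 i (1, 1) (𝐑 j (1, 1) ψ)) := by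
  rw [cx_eq, op_comm h, rph_cz h, ← hd_rph,
    op_comm h (.phase .red (1, 1)) .had, ← cx_eq]

theorem cz_rph {i j : Fin n} (h : i ≠ j) (ψ : St n) :
    cz i j (𝐑 i (1, 1) ψ) = 𝐑 i (1, 1) (𝐆 j (1, 1) (cz i j ψ)) := by
  rw [ph_cz_comm, rph_cz h, ph_ph, show ((1, 1) + (1, 1) : Phase) = 0 by decide, ph_zero]

theorem ph_rph (i : Fin n) (x y : ZMod 2) (ψ : St n) :
    𝐆 i (x, y) (𝐑 i (1, 1) ψ) = 𝐑 i (1, 1) (𝐆 i (y, x) ψ) := (rph_ph i y x ψ).symm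

theorem cx_rph_control {i j : Fin n} (h : i ≠ j) (ψ : St n) :
    cx i j (𝐑 i (1, 1) ψ) = 𝐑 i (1, 1) (𝐑 j (1, 1) (cx i j ψ)) := by
  rw [rph_cx_target, rph_cx_control h, rph_rph, show ((1, 1) + (1, 1) : Phase) = 0 by decide,
    rph_zero]

/-! ### Normal forms -/

/-- States given by operations on a product state, where the outputs in `B` are only acted upon as
targets. -/
inductive NF (B : Finset (Fin n)) : St n → Prop
  | base : NF B (base B)
  | cz {a b : Fin n} {ψ : St n} (ha : a ∉ B) (hb : b ∉ B) (h : NF B ψ) : NF B (cz a b ψ)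
  | cx {a b : Fin n} {ψ : St n} (ha : a ∉ B) (hb : b ∈ B) (h : NF B ψ) : NF B (cx a b ψ)
  | ph {a : Fin n} {ψ : St n} (ha : a ∉ B) (p : Phase) (h : NF B ψ) : NF B (𝐆 a p ψ)
  | rph {b : Fin n} {ψ : St n} (hb : b ∈ B) (h : NF B ψ) : NF B (𝐑 b (1, 1) ψ)

theorem ne_of_mem_of_notMem' {B : Finset (Fin n)} {a b : Fin n} (hb : b ∈ B) (ha : a ∉ B) :
    b ≠ a := fun h => ha (h ▸ hb)

namespace NF

variable {B : Finset (Fin n)} {ψ : St n} {a b : Fin n}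

/-- The phase moves inwards until the red state at `b` absorbs it. Each `cx` onto `b` leaves a `11`
phase at its control, which is free. -/
theorem ph_eleven (hb : b ∈ B) (h : NF B ψ) : NF B (𝐆 b (1, 1) ψ) := by
  induction h with
  | base => rw [ph_base hb]; exact .base
  | cz hc hd h ih => rw [ph_cz_comm]; exact .cz hc hd ih
  | @cx c d ψ hc hd h ih =>
    by_cases hbd : b = d
    · subst hbd
      rw [ph_cx_eleven (ne_of_mem_of_notMem' hb hc).symm]
      exact .cx hc hd (.ph hc _ ih)
    · rw [ph_cx_comm hbd]; exact .cx hc hd ih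
  | ph hc p h ih => rw [ph_comm]; exact .ph hc p ih
  | @rph d ψ hd h ih =>
    by_cases hbd : b = d
    · subst hbd
      rw [ph_rph]; exact .rph hd ih
    · rw [op_comm hbd]; exact .rph hd ih

/-- When the edge passes a `cx` onto `b`, it leaves a `cz` between the control and `a`, both free; a
red `11` at `b` leaves a green phase at `a`. -/
theorem cz_mixed (ha : a ∉ B) (hb : b ∈ B) (h : NF B ψ) : NF B (ToyCalculus.cz b a ψ) := by
  induction h with
  | base => rw [cz_base hb]; exact .base
  | cz hc hd h ih => rw [cz_comm]; exact .cz hc hd ih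
  | @cx c d ψ hc hd h ih =>
    by_cases hbd : b = d
    · subst hbd
      by_cases hac : a = c
      · subst hac
        rw [cz_symm, cz_cx_same (ne_of_mem_of_notMem' hb ha).symm, cz_symm]
        exact .cx ha hb ih
      · rw [cz_cx (ne_of_mem_of_notMem' hb hc).symm (ne_of_mem_of_notMem' hb ha) (Ne.symm hac),
          cz_comm]
        exact .cx hc hb (.cz hc ha ih)
    · rw [cz_cx_comm (Ne.symm hbd) (ne_of_mem_of_notMem' hd ha)]
      exact .cx hc hd ih
  | ph hc p h ih => rw [← ph_cz_comm]; exact .ph hc p ih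
  | @rph d ψ hd h ih =>
    by_cases hbd : b = d
    · subst hbd
      rw [cz_rph (ne_of_mem_of_notMem' hb ha)]
      exact .rph hb (.ph ha _ ih)
    · rw [← op_cz (Ne.symm hbd) (ne_of_mem_of_notMem' hd ha)]; exact .rph hd ih

/-- Passing a `cx` onto `b` leaves a phase at the control and an edge from it to `b`, which is why
`cz_mixed` comes first. A red `11` turns the phase into `10`, the sum of `11` and `01`. -/
theorem ph_zero_one (hb : b ∈ B) (h : NF B ψ) : NF B (𝐆 b (0, 1) ψ) := by
  induction h with
  | base => rw [ph_base hb]; exact .base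
  | cz hc hd h ih => rw [ph_cz_comm]; exact .cz hc hd ih
  | @cx c d ψ hc hd h ih =>
    by_cases hbd : b = d
    · subst hbd
      rw [ph_cx_target (ne_of_mem_of_notMem' hb hc).symm, ph_cz_comm, cz_symm]
      exact .cx hc hd (.ph hc _ (cz_mixed hc hb ih))
    · rw [ph_cx_comm hbd]; exact .cx hc hd ih
  | ph hc p h ih => rw [ph_comm]; exact .ph hc p ih
  | @rph d ψ hd h ih =>
    by_cases hbd : b = d
    · subst hbd
      rw [ph_rph, show ((1, 0) : Phase) = (1, 1) + (0, 1) by decide, ← ph_ph]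
      exact .rph hd (ph_eleven hb ih)
    · rw [op_comm hbd]; exact .rph hd ih

theorem ph_any (i : Fin n) (p : Phase) (h : NF B ψ) : NF B (𝐆 i p ψ) := by
  by_cases hi : i ∈ B
  · have hp : p = 0 ∨ p = (0, 1) ∨ p = (1, 1) ∨ p = (1, 1) + (0, 1) := by
      revert p; decide
    rcases hp with rfl | rfl | rfl | rfl
    · rwa [ph_zero]
    · exact ph_zero_one hi h
    · exact ph_eleven hi h
    · rw [← ph_ph]; exact ph_eleven hi (ph_zero_one hi h)
  · exact .ph hi p h

theorem cz_any (i j : Fin n) (h : NF B ψ) : NF B (ToyCalculus.cz i j ψ) := by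
  by_cases hi : i ∈ B
  swap
  · by_cases hj : j ∈ B
    · rw [cz_symm]; exact cz_mixed hi hj h
    · exact .cz hi hj h
  by_cases hj : j ∈ B
  swap
  · exact cz_mixed hj hi h
  by_cases hij : i = j
  · simpa [ToyCalculus.cz, hij] using h
  induction h with
  | base => rw [cz_base hi]; exact .base
  | cz hc hd h ih => rw [cz_comm]; exact .cz hc hd ih
  | @cx c d ψ hc hd h ih =>
    by_cases hid : i = d
    · subst hid
      rw [cz_cx (ne_of_mem_of_notMem' hi hc).symm hij (ne_of_mem_of_notMem' hj hc).symm, cz_comm,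
        cz_symm c]
      exact .cx hc hd (cz_mixed hc hj ih)
    by_cases hjd : j = d
    · subst hjd
      rw [cz_symm i] at *
      rw [cz_cx (ne_of_mem_of_notMem' hj hc).symm (Ne.symm hij)
        (ne_of_mem_of_notMem' hi hc).symm, cz_comm, cz_symm c]
      exact .cx hc hd (cz_mixed hc hi ih)
    · rw [cz_cx_comm (Ne.symm hid) (Ne.symm hjd)]
      exact .cx hc hd ih
  | ph hc p h ih => rw [← ph_cz_comm]; exact .ph hc p ih
  | @rph d ψ hd h ih =>
    by_cases hid : i = d
    · subst hid
      rw [cz_rph hij]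
      exact .rph hi (ph_eleven hj ih)
    by_cases hjd : j = d
    · subst hjd
      rw [cz_symm i] at *
      rw [cz_rph (Ne.symm hij)]
      exact .rph hj (ph_eleven hi ih)
    · rw [← op_cz (Ne.symm hid) (Ne.symm hjd)]; exact .rph hd ih

theorem cx_base {i j : Fin n} (hij : i ≠ j) (hi : i ∈ B) :
    ToyCalculus.cx i j (ToyCalculus.base B) = ToyCalculus.base B := by
  by_cases hj : j ∈ B
  · rw [cx_eq, hd_base hj, cz_base (Finset.mem_erase.2 ⟨hij, hi⟩),
      hd_base_of_notMem (Finset.notMem_erase j B), Finset.insert_erase hj]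
  · rw [cx_eq, hd_base_of_notMem hj, cz_base (Finset.mem_insert_of_mem hi),
      hd_base (Finset.mem_insert_self j B), Finset.erase_insert hj]

/-- Adding one dependent variable to another: whatever was added to `i` is then also added to `j`,
and a red state as control acts trivially. -/
theorem cx_mem {i j : Fin n} (hij : i ≠ j) (hi : i ∈ B) (hj : j ∈ B) (h : NF B ψ) :
    NF B (ToyCalculus.cx i j ψ) := by
  induction h with
  | base => rw [cx_base hij hi]; exact .base
  | @cz c d ψ hc hd h ih =>
    rw [← cz_cx_comm (ne_of_mem_of_notMem' hj hc) (ne_of_mem_of_notMem' hj hd)]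
    exact .cz hc hd ih
  | @cx c d ψ hc hd h ih =>
    by_cases hid : i = d
    · subst hid
      rw [cx_cx_chain (ne_of_mem_of_notMem' hi hc).symm hij (ne_of_mem_of_notMem' hj hc).symm]
      exact .cx hc hi (.cx hc hj ih)
    · rw [cx_cx_comm (ne_of_mem_of_notMem' hj hc) (Ne.symm hid)]
      exact .cx hc hd ih
  | ph hc p h ih =>
    rw [← ph_cx_comm (ne_of_mem_of_notMem' hj hc).symm]; exact .ph hc p ih
  | @rph d ψ hd h ih =>
    by_cases hid : i = d
    · subst hid
      rw [cx_rph_control hij]; exact .rph hi (.rph hj ih)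
    by_cases hjd : j = d
    · subst hjd
      rw [← rph_cx_target]; exact .rph hd ih
    · rw [← op_cx (Ne.symm hid) (Ne.symm hjd)]; exact .rph hd ih

theorem cx_ph {i j : Fin n} (hij : i ≠ j) (hi : i ∉ B) (hj : j ∉ B)
    (h' : NF B (ToyCalculus.cx i j ψ)) (p : Phase) : NF B (ToyCalculus.cx i j (𝐆 j p ψ)) := by
  have h1 : ∀ φ, NF B (ToyCalculus.cx i j φ) → NF B (ToyCalculus.cx i j (𝐆 j (0, 1) φ)) := by
    intro φ hφ
    have := ph_cx_target hij (ToyCalculus.cx i j φ)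
    rw [cx_cx] at this
    rw [this, cx_cx]
    exact .ph hi _ (.ph hj _ (.cz hi hj hφ))
  have h2 : ∀ φ, NF B (ToyCalculus.cx i j φ) → NF B (ToyCalculus.cx i j (𝐆 j (1, 1) φ)) := by
    intro φ hφ
    have := ph_cx_eleven hij (ToyCalculus.cx i j φ)
    rw [cx_cx] at this
    rw [this, cx_cx]
    exact .ph hi _ (.ph hj _ hφ)
  rcases Phase.cases p with rfl | rfl | rfl | rfl
  · rwa [ph_zero]
  · exact h1 _ h'
  · exact h2 _ h'
  · rw [← ph_ph]; exact h2 _ (h1 _ h')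

/-- A linear change of the free variables. It acts trivially on the product state, because its
target there is green. -/
theorem cx_notMem {i j : Fin n} (hij : i ≠ j) (hi : i ∉ B) (hj : j ∉ B) (h : NF B ψ) :
    NF B (ToyCalculus.cx i j ψ) := by
  induction h with
  | base =>
    rw [cx_eq, hd_base_of_notMem hj, cz_symm, cz_base (Finset.mem_insert_self j B),
      hd_base (Finset.mem_insert_self j B), Finset.erase_insert hj]
    exact .base
  | @cz c d ψ hc hd h ih =>
    -- Here the target `j` is an end of the controlled phase; by symmetry of `cz` this covers both
    -- positions. The relation `cz_cx` is applied to `cz i d φ` so that its extra factor cancels.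
    have key : ∀ d ∉ B, ∀ φ, NF B φ → NF B (ToyCalculus.cx i j φ) →
        NF B (ToyCalculus.cx i j (ToyCalculus.cz j d φ)) := by
      intro d hd φ hφ hφ'
      by_cases hjd : j = d
      · simpa [ToyCalculus.cz, hjd] using hφ'
      by_cases hid : i = d
      · subst hid
        rw [cz_symm, ← cz_cx_same hij]
        exact .cz hi hj hφ'
      · have := cz_cx hij hjd hid (ToyCalculus.cz i d φ)
        rw [cz_cz] at this
        rw [← this, ← cz_cx_comm hij.symm hjd]
        exact .cz hj hd (.cz hi hd hφ')
    by_cases hjc : j = c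
    · subst hjc
      exact key d hd ψ h ih
    by_cases hjd : j = d
    · subst hjd
      rw [cz_symm]
      exact key c hc ψ h ih
    · rw [← cz_cx_comm hjc hjd]
      exact .cz hc hd ih
  | @cx c d ψ hc hd h ih =>
    by_cases hjc : j = c
    · subst hjc
      -- Applied to `cx i d ψ`, the chain relation has a cancelling factor and can be read as a
      -- formula for `cx i j (cx j d ψ)`.
      have := cx_cx_chain hij (ne_of_mem_of_notMem' hd hj).symm
        (ne_of_mem_of_notMem' hd hi).symm (ToyCalculus.cx i d ψ)
      rw [cx_cx_comm (ne_of_mem_of_notMem' hd hj) (ne_of_mem_of_notMem' hd hi), cx_cx] at this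
      rw [← this, cx_cx_comm hij.symm (ne_of_mem_of_notMem' hd hi)]
      exact .cx hj hd (.cx hi hd ih)
    · rw [cx_cx_comm hjc (ne_of_mem_of_notMem' hd hi)]
      exact .cx hc hd ih
  | @ph c ψ hc p h ih =>
    by_cases hjc : j = c
    · subst hjc
      exact cx_ph hij hi hj ih p
    · rw [← ph_cx_comm (Ne.symm hjc)]; exact .ph hc p ih
  | @rph d ψ hd h ih =>
    rw [← op_cx (ne_of_mem_of_notMem' hd hi) (ne_of_mem_of_notMem' hd hj)]; exact .rph hd ih

end NF

end ToyCalculus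

/-! ### Normal forms under H: dependent outputs, pivots and free outputs -/

namespace ToyCalculus

variable {n : ℕ}

namespace NF

variable {B : Finset (Fin n)} {ψ : St n} {a b : Fin n}

theorem rph_notMem {i : Fin n} (hi : i ∉ B) (h : NF B ψ) : NF B (𝐑 i (1, 1) ψ) := by
  induction h with
  | base => rw [rph_base hi]; exact .base
  | @cz c d ψ hc hd h ih =>
    by_cases hcd : c = d
    · simpa [ToyCalculus.cz, hcd] using ih
    by_cases hic : i = c
    · subst hic
      rw [rph_cz hcd, op_comm hcd]
      exact .cz hc hd (.ph hd _ ih)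
    by_cases hid : i = d
    · subst hid
      rw [cz_symm, rph_cz (Ne.symm hcd), op_comm (Ne.symm hcd)]
      exact .cz hd hc (.ph hc _ ih)
    · rw [op_cz hic hid]; exact .cz hc hd ih
  | @cx c d ψ hc hd h ih =>
    have hid := (ne_of_mem_of_notMem' hd hi).symm
    by_cases hic : i = c
    · subst hic
      rw [rph_cx_control hid, op_comm hid]
      exact .cx hc hd (.rph hd ih)
    · rw [op_cx hic hid]; exact .cx hc hd ih
  | @ph c ψ hc p h ih =>
    by_cases hic : i = c
    · subst hic
      obtain ⟨x, y⟩ := p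
      rw [rph_ph]; exact .ph hc _ ih
    · rw [op_comm hic]; exact .ph hc p ih
  | @rph d ψ hd h ih =>
    rw [op_comm (ne_of_mem_of_notMem' hd hi).symm]; exact .rph hd ih

/-- The operator H turns every `cx` onto `b` into a `cz`, every red `11` at `b` into a green `11`,
and the red state into a green one, so `b` becomes free. -/
theorem hd_mem (hb : b ∈ B) (h : NF B ψ) : NF (B.erase b) (𝐇 b ψ) := by
  have sub : ∀ {c}, c ∉ B → c ∉ B.erase b := fun hc h => hc (Finset.mem_of_mem_erase h)
  induction h with
  | base => rw [hd_base hb]; exact .base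
  | @cz c d ψ hc hd h ih =>
    rw [op_cz (ne_of_mem_of_notMem' hb hc) (ne_of_mem_of_notMem' hb hd)]
    exact .cz (sub hc) (sub hd) ih
  | @cx c d ψ hc hd h ih =>
    by_cases hbd : b = d
    · subst hbd
      rw [hd_cx]; exact .cz (sub hc) (Finset.notMem_erase b B) ih
    · rw [op_cx (ne_of_mem_of_notMem' hb hc) hbd]
      exact .cx (sub hc) (Finset.mem_erase.2 ⟨Ne.symm hbd, hd⟩) ih
  | @ph c ψ hc p h ih =>
    rw [op_comm (ne_of_mem_of_notMem' hb hc)]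
    exact .ph (sub hc) p ih
  | @rph d ψ hd h ih =>
    by_cases hbd : b = d
    · subst hbd
      rw [hd_rph]; exact .ph (Finset.notMem_erase b B) _ ih
    · rw [op_comm hbd]; exact .rph (Finset.mem_erase.2 ⟨Ne.symm hbd, hd⟩) ih

end NF

/-- Controlled permutations with a common control. -/
def cxs (a : Fin n) (T : List (Fin n)) (ψ : St n) : St n := T.foldr (cx a) ψ

@[simp] theorem cxs_nil (a : Fin n) (ψ : St n) : cxs a [] ψ = ψ := rfl
@[simp] theorem cxs_cons (a b : Fin n) (T : List (Fin n)) (ψ : St n) :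
    cxs a (b :: T) ψ = cx a b (cxs a T ψ) := rfl

theorem cxs_comm (F : St n → St n) {a : Fin n} {T : List (Fin n)}
    (h : ∀ b ∈ T, ∀ ψ, F (cx a b ψ) = cx a b (F ψ)) (ψ : St n) :
    F (cxs a T ψ) = cxs a T (F ψ) := by
  induction T with
  | nil => rfl
  | cons b T ih =>
    rw [cxs_cons, h b List.mem_cons_self, ih fun c hc => h c (List.mem_cons_of_mem _ hc), cxs_cons]

theorem cxs_erase {a b : Fin n} {T : List (Fin n)} (ha : a ∉ T) (hb : b ∈ T) (ψ : St n) :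
    cxs a T ψ = cx a b (cxs a (T.erase b) ψ) := by
  induction T with
  | nil => simp at hb
  | cons c T ih =>
    rw [List.mem_cons, not_or] at ha
    by_cases hcb : c = b
    · subst hcb; simp
    · have hb' : b ∈ T := by
        rcases List.mem_cons.1 hb with h | h
        · exact absurd h.symm hcb
        · exact h
      rw [List.erase_cons_tail (by simpa using hcb), cxs_cons, cxs_cons, ih ha.2 hb',
        cx_cx_comm (Ne.symm ha.1) (fun h : b = a => ha.2 (h ▸ hb'))]

namespace NF

variable {B : Finset (Fin n)} {ψ : St n} {a b : Fin n}

/-- Everything that uses `a` as a free variable is collected outside: its phase `q` and the set `T`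
of dependent outputs that involve it. An edge at `a` becomes, across H, a `cx` onto `a`, so in the
remaining factor `a` is dependent. -/
theorem exists_cxs (ha : a ∉ B) (h : NF B ψ) :
    ∃ (T : List (Fin n)) (q : Phase) (φ : St n), T.Nodup ∧ (∀ b ∈ T, b ∈ B) ∧
      NF (insert a B) φ ∧ ψ = 𝐆 a q (cxs a T (𝐇 a φ)) := by
  have sub : ∀ {c}, c ≠ a → c ∉ B → c ∉ insert a B := fun hca hc h =>
    (Finset.mem_insert.1 h).elim hca hc
  induction h with
  | base =>
    exact ⟨[], 0, _, List.nodup_nil, by simp, .base, by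
      rw [ph_zero, cxs_nil, hd_base (Finset.mem_insert_self a B), Finset.erase_insert ha]⟩
  | @cz c d ψ hc hd h ih =>
    obtain ⟨T, q, φ, hT, hTB, hφ, rfl⟩ := ih
    have hT' : ∀ x ∉ B, ∀ b ∈ T, b ≠ x := fun x hx b hb => ne_of_mem_of_notMem' (hTB b hb) hx
    by_cases hcd : c = d
    · exact ⟨T, q, φ, hT, hTB, hφ, by simp [ToyCalculus.cz, hcd]⟩
    have key : ∀ d, d ∉ B → d ≠ a → ToyCalculus.cz a d (𝐆 a q (cxs a T (𝐇 a φ))) =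
        𝐆 a q (cxs a T (𝐇 a (ToyCalculus.cx d a φ))) := fun d hd hda => by
      rw [← ph_cz_comm, cxs_comm (ToyCalculus.cz a d)
        (fun b hb ψ => cz_cx_comm (hT' a ha b hb) (hT' d hd b hb) ψ), hd_cx, cz_symm]
    by_cases hca : c = a
    · subst hca
      refine ⟨T, q, ToyCalculus.cx d c φ, hT, hTB, .cx (sub (Ne.symm hcd) hd)
        (Finset.mem_insert_self c B) hφ, key d hd (Ne.symm hcd)⟩
    by_cases hda : d = a
    · subst hda
      refine ⟨T, q, ToyCalculus.cx c d φ, hT, hTB, .cx (sub hcd hc)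
        (Finset.mem_insert_self d B) hφ, (by rw [cz_symm]; exact key c hc hcd)⟩
    · refine ⟨T, q, ToyCalculus.cz c d φ, hT, hTB, .cz (sub hca hc) (sub hda hd) hφ, ?_⟩
      rw [← ph_cz_comm, cxs_comm (ToyCalculus.cz c d)
        (fun b hb ψ => cz_cx_comm (hT' c hc b hb) (hT' d hd b hb) ψ),
        op_cz (Ne.symm hca) (Ne.symm hda)]
  | @cx c d ψ hc hd h ih =>
    obtain ⟨T, q, φ, hT, hTB, hφ, rfl⟩ := ih
    have had := ne_of_mem_of_notMem' hd ha
    have haT : a ∉ T := fun h => ha (hTB a h)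
    by_cases hca : c = a
    · subst hca
      by_cases hdT : d ∈ T
      -- A second `cx` from `a` to `d` cancels the first one, so `T` only records parities.
      · refine ⟨T.erase d, q, φ, hT.erase d, fun b hb => hTB b (List.mem_of_mem_erase hb), hφ, ?_⟩
        rw [← ph_cx_control had.symm, cxs_erase haT hdT, cx_cx]
      · refine ⟨d :: T, q, φ, List.nodup_cons.2 ⟨hdT, hT⟩, ?_, hφ, ?_⟩
        · intro b hb
          rcases List.mem_cons.1 hb with rfl | hb
          · exact hd
          · exact hTB b hb
        · rw [← ph_cx_control had.symm, cxs_cons]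
    · refine ⟨T, q, ToyCalculus.cx c d φ, hT, hTB,
        .cx (sub hca hc) (Finset.mem_insert_of_mem hd) hφ, ?_⟩
      rw [← ph_cx_comm had.symm, cxs_comm (ToyCalculus.cx c d)
        (fun b hb ψ => cx_cx_comm had (ne_of_mem_of_notMem' (hTB b hb) hc) ψ),
        op_cx (Ne.symm hca) had.symm]
  | @ph c ψ hc p h ih =>
    obtain ⟨T, q, φ, hT, hTB, hφ, rfl⟩ := ih
    by_cases hca : c = a
    · subst hca
      exact ⟨T, p + q, φ, hT, hTB, hφ, by rw [ph_ph]⟩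
    · refine ⟨T, q, 𝐆 c p φ, hT, hTB, .ph (sub hca hc) p hφ, ?_⟩
      rw [ph_comm, cxs_comm (𝐆 c p)
        (fun b hb ψ => ph_cx_comm (ne_of_mem_of_notMem' (hTB b hb) hc).symm p ψ), op_comm hca]
  | @rph d ψ hd h ih =>
    obtain ⟨T, q, φ, hT, hTB, hφ, rfl⟩ := ih
    have hda := ne_of_mem_of_notMem' hd ha
    refine ⟨T, q, 𝐑 d (1, 1) φ, hT, hTB, .rph (Finset.mem_insert_of_mem hd) hφ, ?_⟩
    rw [op_comm hda, cxs_comm (𝐑 d (1, 1)) (fun b hb ψ => ?_), op_comm hda]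
    by_cases hdb : d = b
    · subst hdb; exact rph_cx_target ..
    · exact op_cx hda hdb _ ψ

/-- On these two outputs both sides are the bare wire joining `a` and `b`, by `hd_cz_base`. -/
theorem cx_base_notMem (ha : a ∉ B) (hb : b ∈ B) : ToyCalculus.cx a b (ToyCalculus.base B) =
    ToyCalculus.cx b a (ToyCalculus.base (insert a (B.erase b))) := by
  have hab := (ne_of_mem_of_notMem' hb ha).symm
  have ha' : a ∉ B.erase b := fun h => ha (Finset.mem_of_mem_erase h)
  rw [cx_eq, hd_base hb, hd_cz_base hab ha' (Finset.notMem_erase b B), cx_eq b a,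
    hd_base (Finset.mem_insert_self ..), Finset.erase_insert ha', cz_symm]

/-- The exchange step of Gaussian elimination: the equation that expresses `b` through `a` is solved
for `a`. On the product state this is `cx_base_notMem`. Operations at `a` become phases or edges at
a free place after H, and those onto `b` become operations at a free output, so the closure
properties apply. -/
theorem pivot (ha : a ∉ B) (hb : b ∈ B) (h : NF (insert a B) ψ) :
    NF (insert a (B.erase b)) (ToyCalculus.cx a b (𝐇 a ψ)) := by
  have hba := ne_of_mem_of_notMem' hb ha
  have hbB : b ∉ insert a (B.erase b) := by simp [hba]
  have haB : a ∈ insert a (B.erase b) := Finset.mem_insert_self ..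
  have sub : ∀ {c}, c ∉ insert a B → c ∉ insert a (B.erase b) ∧ c ≠ a ∧ b ≠ c := by
    intro c hc
    rw [Finset.mem_insert, not_or] at hc
    exact ⟨by simp [hc], hc.1, ne_of_mem_of_notMem' hb hc.2⟩
  have hmem : ∀ {d}, d ∈ insert a B → d ≠ a → d ≠ b → d ∈ insert a (B.erase b) := by
    intro d hd hda hdb
    simp only [Finset.mem_insert, Finset.mem_erase] at hd ⊢
    tauto
  induction h with
  | base =>
    rw [hd_base (Finset.mem_insert_self ..), Finset.erase_insert ha, cx_base_notMem ha hb]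
    exact .cx hbB haB .base
  | @cz c d ψ hc hd h ih =>
    obtain ⟨hc1, hc2, hc3⟩ := sub hc
    obtain ⟨hd1, hd2, hd3⟩ := sub hd
    rw [op_cz hc2.symm hd2.symm, ← cz_cx_comm hc3 hd3]
    exact .cz hc1 hd1 ih
  | @cx c d ψ hc hd h ih =>
    obtain ⟨hc1, hc2, hc3⟩ := sub hc
    by_cases hda : d = a
    · subst hda
      rw [hd_cx, ← cz_cx_comm hc3 hba]
      exact cz_any _ _ ih
    rw [op_cx hc2.symm (Ne.symm hda), cx_cx_comm hc3 hda]
    by_cases hdb : d = b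
    · subst hdb
      exact cx_notMem hc3.symm hc1 hbB ih
    · exact .cx hc1 (hmem hd hda hdb) ih
  | @ph c ψ hc p h ih =>
    obtain ⟨hc1, hc2, hc3⟩ := sub hc
    rw [op_comm hc2.symm, ← ph_cx_comm hc3.symm]
    exact .ph hc1 p ih
  | @rph d ψ hd h ih =>
    by_cases hda : d = a
    · subst hda
      rw [hd_rph, ← ph_cx_control hba.symm]
      exact ph_any _ _ ih
    rw [op_comm (Ne.symm hda)]
    by_cases hdb : d = b
    · subst hdb
      rw [← rph_cx_target]
      exact rph_notMem hbB ih
    · rw [← op_cx hda hdb]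
      exact .rph (hmem hd hda hdb) ih

end NF

/-- The state has a normal form. -/
def IsNF (ψ : St n) : Prop := ∃ B, NF B ψ

namespace IsNF

variable {ψ : St n}

theorem ph (i : Fin n) (p : Phase) (h : IsNF ψ) : IsNF (𝐆 i p ψ) :=
  h.imp fun _ h => h.ph_any i p

theorem cz (i j : Fin n) (h : IsNF ψ) : IsNF (cz i j ψ) := h.imp fun _ h => h.cz_any i j

theorem hd (a : Fin n) (h : IsNF ψ) : IsNF (𝐇 a ψ) := by
  obtain ⟨B, h⟩ := h
  by_cases ha : a ∈ B
  · exact ⟨_, h.hd_mem ha⟩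
  obtain ⟨T, q, φ, hT, hTB, hφ, rfl⟩ := h.exists_cxs ha
  have haT : a ∉ T := fun h => ha (hTB a h)
  match T with
  | b :: T =>
    have hbT := List.nodup_cons.1 hT
    have hb := hTB b List.mem_cons_self
    -- The `cx` to `b` is moved innermost, where it is used for the pivot. Afterwards `a` is
    -- dependent, so the remaining `cx` run between dependent outputs, and the last H makes `a` free
    -- again.
    have h1 : cxs a (b :: T) (𝐇 a φ) = cxs a T (cx a b (𝐇 a φ)) :=
      cxs_comm (cx a b) (fun c hc ψ => cx_cx_comm (ne_of_mem_of_notMem' hb ha)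
        (ne_of_mem_of_notMem' (hTB c (List.mem_cons_of_mem _ hc)) ha) ψ) _
    have h2 : ∀ T' : List (Fin n), (∀ c ∈ T', c ∈ T) →
        NF (insert a (B.erase b)) (cxs a T' (cx a b (𝐇 a φ))) := by
      intro T' hT'
      induction T' with
      | nil => exact NF.pivot ha hb hφ
      | cons c T' ih =>
        have hcT := hT' c List.mem_cons_self
        have hcB := hTB c (List.mem_cons_of_mem _ hcT)
        refine NF.cx_mem (ne_of_mem_of_notMem' hcB ha).symm (Finset.mem_insert_self ..)
          (Finset.mem_insert_of_mem (Finset.mem_erase.2 ⟨fun h => hbT.1 (h ▸ hcT), hcB⟩))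
          (ih fun d hd => hT' d (List.mem_cons_of_mem _ hd))
    rw [h1]
    exact ⟨_, ((h2 T fun _ h => h).ph_any a q).hd_mem (Finset.mem_insert_self ..)⟩
  | [] =>
    -- No dependent output involves `a`, so the two H around the phase `q` combine to a red phase
    -- shift at the dependent output `a`. The shift `01` is handled by its decomposition into green
    -- `01`, H, green `01`.
    rw [cxs_nil, ← rph_eq]
    have h01 : NF ((insert a B).erase a) (𝐑 a (0, 1) φ) := by
      rw [rph_zero_one]
      exact ((hφ.ph_any a (0, 1)).hd_mem (Finset.mem_insert_self ..)).ph_any a _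
    rcases Phase.cases q with rfl | rfl | rfl | rfl
    · rw [rph_zero]; exact ⟨_, hφ⟩
    · exact ⟨_, h01⟩
    · exact ⟨_, .rph (Finset.mem_insert_self ..) hφ⟩
    · rw [← rph_rph]; exact ⟨_, h01.rph_notMem (Finset.notMem_erase a _)⟩

theorem rph (i : Fin n) (p : Phase) (h : IsNF ψ) : IsNF (𝐑 i p ψ) := by
  rw [rph_eq]; exact ((h.hd i).ph i p).hd i

theorem cx (i j : Fin n) (h : IsNF ψ) : IsNF (cx i j ψ) := by
  rw [cx_eq]; exact ((h.hd j).cz i j).hd j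

end IsNF

end ToyCalculus

namespace ToyCalculus

variable {n : ℕ}

/-! ### Soundness -/

theorem greenSpider_singleton (s : Ontic) : GreenSpider 0 {s} ↔ s.2 = 0 := by
  simp [GreenSpider]

theorem greenSpider_pair (p : Phase) (s t : Ontic) : GreenSpider p {s, t} ↔
    s.1 = t.1 ∧ s.2 + t.2 = if s.1 = 0 then p.1 else p.2 := by
  simp only [GreenSpider, Multiset.insert_eq_cons, Multiset.mem_cons, Multiset.mem_singleton,
    Multiset.map_cons, Multiset.map_singleton, Multiset.sum_cons, Multiset.sum_singleton]
  constructor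
  · rintro ⟨u, h, h'⟩
    rw [h s (.inl rfl), h t (.inr rfl)]
    exact ⟨rfl, h'⟩
  · rintro ⟨h, h'⟩
    exact ⟨s.1, by rintro r (rfl | rfl); exacts [rfl, h.symm], h'⟩

theorem greenSpider_triple (s t r : Ontic) : GreenSpider 0 {s, t, r} ↔
    s.1 = t.1 ∧ s.1 = r.1 ∧ s.2 + (t.2 + r.2) = 0 := by
  simp only [GreenSpider, Multiset.insert_eq_cons, Multiset.mem_cons, Multiset.mem_singleton,
    Multiset.map_cons, Multiset.map_singleton, Multiset.sum_cons, Multiset.sum_singleton,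
    Prod.fst_zero, Prod.snd_zero, ite_self]
  constructor
  · rintro ⟨u, h, h'⟩
    rw [h s (.inl rfl), h t (.inr (.inl rfl)), h r (.inr (.inr rfl))]
    exact ⟨rfl, rfl, h'⟩
  · rintro ⟨h, h', h''⟩
    exact ⟨s.1, by rintro r (rfl | rfl | rfl); exacts [rfl, h.symm, h'.symm], h''⟩

/-- The states on the legs of a spider of colour `c`, as seen from a green spider. -/
def Colour.view : Colour → Ontic → Ontic
  | .green, s => s
  | .red, s => s.swap

@[simp] theorem Colour.view_view (c : Colour) (s : Ontic) : c.view (c.view s) = s := by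
  cases c <;> rfl

theorem Colour.view_swap (c : Colour) (s : Ontic) : c.swap.view s = (c.view s).swap := by
  cases c <;> rfl

theorem Colour.swap_view (c : Colour) (s : Ontic) : (c.view s).swap = c.view s.swap := by
  cases c <;> rfl

theorem Node.holds_spider (c : Colour) (p : Phase) (l : Multiset ℕ) (f : ℕ → Ontic) :
    (Node.spider c p l).Holds f ↔ GreenSpider p (l.map fun e => c.view (f e)) := by
  cases c <;> rfl

theorem Node.holds_had (a b : ℕ) (f : ℕ → Ontic) :
    (Node.had s(a, b)).Holds f ↔ f b = (f a).swap := by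
  simp only [Node.Holds, Sym2.map_mk, Sym2.eq_iff]
  constructor
  · rintro ⟨s, (⟨h, h'⟩ | ⟨h, h'⟩)⟩
    · rw [h, h']
    · rw [h, h', Prod.swap_swap]
  · intro h
    exact ⟨f a, .inl ⟨rfl, h⟩⟩

/-- Each solution of the conditions in `A` becomes a solution of those in `B` when only inner wires
of `B` are changed. -/
def Entails (A B : Multiset Node) : Prop :=
  (∀ e, (legsOf B).count e ≤ 2) → ∀ f : ℕ → Ontic, (∀ N ∈ A, N.Holds f) →
    ∃ f' : ℕ → Ontic, (∀ N ∈ B, N.Holds f') ∧ ∀ e, (legsOf B).count e ≤ 1 → f' e = f e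

theorem Entails.of_imp {A B : Multiset Node}
    (h : ∀ f : ℕ → Ontic, (∀ N ∈ A, N.Holds f) → ∀ N ∈ B, N.Holds f) : Entails A B :=
  fun _ f hf => ⟨f, h f hf, fun _ _ => rfl⟩

theorem add_self_zmod_two (x : ZMod 2) : x + x = 0 := CharTwo.add_self_eq_zero x

theorem greenSpider_fuse {p q : Phase} {t : Ontic} {S T : Multiset Ontic}
    (hS : GreenSpider p (t ::ₘ S)) (hT : GreenSpider q (t ::ₘ T)) : GreenSpider (p + q) (S + T) := by
  obtain ⟨u, h1, h2⟩ := hS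
  obtain ⟨v, h3, h4⟩ := hT
  have huv : u = v := (h1 t (Multiset.mem_cons_self ..)).symm.trans (h3 t (Multiset.mem_cons_self ..))
  subst huv
  refine ⟨u, fun s hs => (Multiset.mem_add.1 hs).elim
    (fun h => h1 s (Multiset.mem_cons_of_mem h)) (fun h => h3 s (Multiset.mem_cons_of_mem h)), ?_⟩
  rw [Multiset.map_cons, Multiset.sum_cons] at h2 h4
  rw [Multiset.map_add, Multiset.sum_add]
  have := add_self_zmod_two t.2
  split_ifs at * <;> simp only [Prod.fst_add, Prod.snd_add] <;> rw [← h2, ← h4] <;>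
    linear_combination -this

/-- The connecting wire carries the common first bit and, as second bit, the parity still missing in
the first spider; the second condition then follows from the total parity. -/
theorem greenSpider_unfuse {p q : Phase} {S T : Multiset Ontic}
    (h : GreenSpider (p + q) (S + T)) :
    ∃ t, GreenSpider p (t ::ₘ S) ∧ GreenSpider q (t ::ₘ T) := by
  obtain ⟨u, h1, h2⟩ := h
  rw [Multiset.map_add, Multiset.sum_add] at h2
  refine ⟨(u, (if u = 0 then p.1 else p.2) + (S.map Prod.snd).sum),
    ⟨u, ?_, ?_⟩, ⟨u, ?_, ?_⟩⟩
  · intro s hs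
    rcases Multiset.mem_cons.1 hs with rfl | hs
    exacts [rfl, h1 s (Multiset.mem_add.2 (.inl hs))]
  · rw [Multiset.map_cons, Multiset.sum_cons]
    linear_combination add_self_zmod_two (S.map Prod.snd).sum
  · intro s hs
    rcases Multiset.mem_cons.1 hs with rfl | hs
    exacts [rfl, h1 s (Multiset.mem_add.2 (.inr hs))]
  · rw [Multiset.map_cons, Multiset.sum_cons]
    split_ifs at * <;> simp only [Prod.fst_add, Prod.snd_add] at h2
    · linear_combination h2 + add_self_zmod_two p.1
    · linear_combination h2 + add_self_zmod_two p.2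

end ToyCalculus

/-! ### Soundness of the single rules, in both directions -/

namespace ToyCalculus

variable {n : ℕ}

theorem forall_mem_insert {P : Node → Prop} {a : Node} {s : Multiset Node} :
    (∀ N ∈ insert a s, P N) ↔ P a ∧ ∀ N ∈ s, P N := by
  simp [Multiset.insert_eq_cons]

theorem forall_mem_singleton {P : Node → Prop} {a : Node} :
    (∀ N ∈ ({a} : Multiset Node), P N) ↔ P a := by
  simp

theorem Node.holds_spider₁ (c : Colour) (a : ℕ) (f : ℕ → Ontic) :
    (Node.spider c 0 {a}).Holds f ↔ (c.view (f a)).2 = 0 := by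
  rw [Node.holds_spider, Multiset.map_singleton, greenSpider_singleton]

theorem Node.holds_spider₂ (c : Colour) (p : Phase) (a b : ℕ) (f : ℕ → Ontic) :
    (Node.spider c p {a, b}).Holds f ↔ (c.view (f a)).1 = (c.view (f b)).1 ∧
      (c.view (f a)).2 + (c.view (f b)).2 = if (c.view (f a)).1 = 0 then p.1 else p.2 := by
  rw [Node.holds_spider, ← greenSpider_pair]
  rfl

theorem Node.holds_spider₃ (c : Colour) (a b d : ℕ) (f : ℕ → Ontic) :
    (Node.spider c 0 {a, b, d}).Holds f ↔ (c.view (f a)).1 = (c.view (f b)).1 ∧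
      (c.view (f a)).1 = (c.view (f d)).1 ∧
      (c.view (f a)).2 + ((c.view (f b)).2 + (c.view (f d)).2) = 0 := by
  rw [Node.holds_spider, ← greenSpider_triple]
  rfl

theorem Entails.update {A B : Multiset Node} (e : ℕ) (he : 2 ≤ (legsOf B).count e)
    (v : (ℕ → Ontic) → Ontic)
    (h : (∀ e, (legsOf B).count e ≤ 2) → ∀ f : ℕ → Ontic, (∀ N ∈ A, N.Holds f) →
      ∀ f' : ℕ → Ontic, f' e = v f → (∀ x ≠ e, f' x = f x) → ∀ N ∈ B, N.Holds f') :
    Entails A B := fun hB f hf =>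
  ⟨Function.update f e (v f), h hB f hf _ (Function.update_self ..) fun x hx =>
    Function.update_of_ne hx _ _, fun x hx => Function.update_of_ne (by rintro rfl; omega) _ _⟩

theorem entails_spider (c : Colour) (p q : Phase) (e : ℕ) (S T : Multiset ℕ) :
    Entails {.spider c p (e ::ₘ S), .spider c q (e ::ₘ T)} {.spider c (p + q) (S + T)} := by
  refine .of_imp fun f hf => ?_
  simp only [forall_mem_insert, forall_mem_singleton, Node.holds_spider, Multiset.map_cons] at hf
  simp only [Multiset.mem_singleton, forall_eq, Node.holds_spider, Multiset.map_add]
  exact greenSpider_fuse hf.1 hf.2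

theorem map_update_of_notMem {f f' : ℕ → Ontic} {e : ℕ} {S : Multiset ℕ} (c : Colour)
    (h : ∀ x ≠ e, f' x = f x) (he : e ∉ S) :
    S.map (fun x => c.view (f' x)) = S.map fun x => c.view (f x) :=
  Multiset.map_congr rfl fun x hx => by rw [h x (by rintro rfl; exact he hx)]

theorem spider_entails (c : Colour) (p q : Phase) (e : ℕ) (S T : Multiset ℕ) :
    Entails {.spider c (p + q) (S + T)} {.spider c p (e ::ₘ S), .spider c q (e ::ₘ T)} := by
  intro hB f hf
  have he := hB e
  simp only [Multiset.insert_eq_cons, legsOf_cons, legsOf_singleton, legs_spider,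
    Multiset.count_add, Multiset.count_cons_self] at he
  have hS : e ∉ S := Multiset.count_eq_zero.1 (by omega)
  have hT : e ∉ T := Multiset.count_eq_zero.1 (by omega)
  simp only [Multiset.mem_singleton, forall_eq, Node.holds_spider, Multiset.map_add] at hf
  obtain ⟨t, h1, h2⟩ := greenSpider_unfuse hf
  have hf' : ∀ x ≠ e, Function.update f e (c.view t) x = f x :=
    fun x hx => Function.update_of_ne hx _ _
  refine ⟨Function.update f e (c.view t), ?_, fun x hx => hf' x ?_⟩
  · simp only [forall_mem_insert, forall_mem_singleton, Node.holds_spider, Multiset.map_cons, Function.update_self,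
      Colour.view_view, map_update_of_notMem c hf' hS, map_update_of_notMem c hf' hT]
    exact ⟨h1, h2⟩
  · rintro rfl
    simp only [Multiset.insert_eq_cons, legsOf_cons, legsOf_singleton, legs_spider,
      Multiset.count_add, Multiset.count_cons_self] at hx
    omega

theorem greenSpider_loop {p : Phase} {t : Ontic} {S : Multiset Ontic}
    (h : GreenSpider p (t ::ₘ t ::ₘ S)) : GreenSpider p S := by
  obtain ⟨u, h1, h2⟩ := h
  refine ⟨u, fun s hs => h1 s (by simp [hs]), ?_⟩
  rw [Multiset.map_cons, Multiset.map_cons, Multiset.sum_cons, Multiset.sum_cons] at h2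
  rw [← h2]
  linear_combination -add_self_zmod_two t.2

theorem greenSpider_unloop {p : Phase} {S : Multiset Ontic} (h : GreenSpider p S) :
    ∃ t, GreenSpider p (t ::ₘ t ::ₘ S) := by
  obtain ⟨u, h1, h2⟩ := h
  refine ⟨(u, 0), u, fun s hs => ?_, ?_⟩
  · rcases Multiset.mem_cons.1 hs with rfl | hs
    · rfl
    rcases Multiset.mem_cons.1 hs with rfl | hs
    exacts [rfl, h1 s hs]
  · simpa using h2

theorem entails_loop (c : Colour) (p : Phase) (e : ℕ) (S : Multiset ℕ) :
    Entails {.spider c p (e ::ₘ e ::ₘ S)} {.spider c p S} := by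
  refine .of_imp fun f hf => ?_
  simp only [Multiset.mem_singleton, forall_eq, Node.holds_spider, Multiset.map_cons] at hf ⊢
  exact greenSpider_loop hf

theorem loop_entails (c : Colour) (p : Phase) (e : ℕ) (S : Multiset ℕ) :
    Entails {.spider c p S} {.spider c p (e ::ₘ e ::ₘ S)} := by
  intro hB f hf
  have he := hB e
  simp only [legsOf_singleton, legs_spider, Multiset.count_cons_self] at he
  have hS : e ∉ S := Multiset.count_eq_zero.1 (by omega)
  simp only [Multiset.mem_singleton, forall_eq, Node.holds_spider] at hf
  obtain ⟨t, h1⟩ := greenSpider_unloop hf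
  have hf' : ∀ x ≠ e, Function.update f e (c.view t) x = f x :=
    fun x hx => Function.update_of_ne hx _ _
  refine ⟨Function.update f e (c.view t), ?_, fun x hx => hf' x ?_⟩
  · simp only [Multiset.mem_singleton, forall_eq, Node.holds_spider, Multiset.map_cons,
      Function.update_self, Colour.view_view, map_update_of_notMem c hf' hS]
    exact h1
  · rintro rfl
    simp only [legsOf_singleton, legs_spider, Multiset.count_cons_self] at hx
    omega

theorem entails_bialgebra (c : Colour) (a₁ a₂ b₁ b₂ e₁₁ e₁₂ e₂₁ e₂₂ e : ℕ) :
    Entails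
        {.spider c 0 {a₁, e₁₁, e₁₂}, .spider c 0 {a₂, e₂₁, e₂₂},
          .spider c.swap 0 {e₁₁, e₂₁, b₁}, .spider c.swap 0 {e₁₂, e₂₂, b₂}}
        {.spider c.swap 0 {a₁, a₂, e}, .spider c 0 {e, b₁, b₂}} := by
  -- Seen from colour `c`, spiders of that colour share first bits and add second bits, the others
  -- conversely; this determines both bits of `e`.
  refine .update e (by simp [Multiset.count_cons, Multiset.count_singleton]; omega) (fun f => c.view
    ((c.view (f a₁)).1 + (c.view (f a₂)).1, (c.view (f a₁)).2)) fun hB f hf f' he hf' => ?_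
  have hc := hB e
  simp only [Multiset.insert_eq_cons, legsOf_cons, legsOf_singleton, legs_spider,
    Multiset.count_add, Multiset.count_cons, Multiset.count_singleton] at hc
  have h1 := hf' a₁ (by grind)
  have h2 := hf' a₂ (by grind)
  have h3 := hf' b₁ (by grind)
  have h4 := hf' b₂ (by grind)
  simp only [forall_mem_insert, forall_mem_singleton, Node.holds_spider₁, Node.holds_spider₂, Node.holds_spider₃, Colour.view_swap, Prod.fst_swap, Prod.snd_swap, he, h1, h2, h3, h4,
    Colour.view_view] at hf ⊢
  grind

theorem bialgebra_entails (c : Colour) (a₁ a₂ b₁ b₂ e₁₁ e₁₂ e₂₁ e₂₂ e : ℕ) :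
    Entails {.spider c.swap 0 {a₁, a₂, e}, .spider c 0 {e, b₁, b₂}}
        {.spider c 0 {a₁, e₁₁, e₁₂}, .spider c 0 {a₂, e₂₁, e₂₂},
          .spider c.swap 0 {e₁₁, e₂₁, b₁}, .spider c.swap 0 {e₁₂, e₂₂, b₂}} := by
  intro hB f hf
  have h11 := hB e₁₁
  have h12 := hB e₁₂
  have h21 := hB e₂₁
  have h22 := hB e₂₂
  simp only [Multiset.insert_eq_cons, legsOf_cons, legsOf_singleton, legs_spider,
    Multiset.count_add, Multiset.count_cons, Multiset.count_singleton] at h11 h12 h21 h22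
  -- Each of the four inner wires takes its first bit from the input and its second bit from the
  -- output that it connects, as seen from colour `c`.
  refine ⟨fun x => if x = e₁₁ then c.view ((c.view (f a₁)).1, (c.view (f b₁)).2) else
    if x = e₁₂ then c.view ((c.view (f a₁)).1, (c.view (f b₂)).2) else
    if x = e₂₁ then c.view ((c.view (f a₂)).1, (c.view (f b₁)).2) else
    if x = e₂₂ then c.view ((c.view (f a₂)).1, (c.view (f b₂)).2) else f x, ?_, fun x hx => ?_⟩
  · have k1 : a₁ ≠ e₁₁ ∧ a₁ ≠ e₁₂ ∧ a₁ ≠ e₂₁ ∧ a₁ ≠ e₂₂ := by grind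
    have k2 : a₂ ≠ e₁₁ ∧ a₂ ≠ e₁₂ ∧ a₂ ≠ e₂₁ ∧ a₂ ≠ e₂₂ := by grind
    have k3 : b₁ ≠ e₁₁ ∧ b₁ ≠ e₁₂ ∧ b₁ ≠ e₂₁ ∧ b₁ ≠ e₂₂ := by grind
    have k4 : b₂ ≠ e₁₁ ∧ b₂ ≠ e₁₂ ∧ b₂ ≠ e₂₁ ∧ b₂ ≠ e₂₂ := by grind
    have k5 : e₁₂ ≠ e₁₁ ∧ e₂₁ ≠ e₁₁ ∧ e₂₂ ≠ e₁₁ ∧ e₂₁ ≠ e₁₂ ∧ e₂₂ ≠ e₁₂ ∧ e₂₂ ≠ e₂₁ := by grind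
    simp only [forall_mem_insert, forall_mem_singleton, Node.holds_spider₁, Node.holds_spider₂, Node.holds_spider₃, Colour.view_swap, Prod.fst_swap, Prod.snd_swap, Colour.view_view,
      if_true, k1, k2, k3, k4, k5, if_false] at hf ⊢
    grind
  · simp only [Multiset.insert_eq_cons, legsOf_cons, legsOf_singleton, legs_spider,
      Multiset.count_add, Multiset.count_cons, Multiset.count_singleton] at hx
    grind

theorem entails_copy (c : Colour) (a b e : ℕ) :
    Entails {.spider c.swap 0 {e}, .spider c 0 {e, a, b}}
      {.spider c.swap 0 {a}, .spider c.swap 0 {b}} := by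
  refine .of_imp fun f hf => ?_
  simp only [forall_mem_insert, forall_mem_singleton, Node.holds_spider₁, Node.holds_spider₂, Node.holds_spider₃, Colour.view_swap, Prod.fst_swap, Prod.snd_swap,
    Colour.view_view] at hf ⊢
  grind

theorem copy_entails (c : Colour) (a b e : ℕ) :
    Entails {.spider c.swap 0 {a}, .spider c.swap 0 {b}}
      {.spider c.swap 0 {e}, .spider c 0 {e, a, b}} := by
  refine .update e (by simp [Multiset.count_cons, Multiset.count_singleton]; omega) (fun f => c.view
    (0, (c.view (f a)).2 + (c.view (f b)).2)) fun hB f hf f' he hf' => ?_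
  have hc := hB e
  simp only [Multiset.insert_eq_cons, legsOf_cons, legsOf_singleton, legs_spider,
    Multiset.count_add, Multiset.count_cons, Multiset.count_singleton] at hc
  have h1 := hf' a (by grind)
  have h2 := hf' b (by grind)
  simp only [forall_mem_insert, forall_mem_singleton, Node.holds_spider₁, Node.holds_spider₂, Node.holds_spider₃, Colour.view_swap, Prod.fst_swap, Prod.snd_swap,
    Colour.view_view, he, h1, h2] at hf ⊢
  have := add_self_zmod_two (c.view (f a)).2
  have := add_self_zmod_two (c.view (f b)).2
  grind

theorem entails_comm11 (c : Colour) (x y : ZMod 2) (a b e e' : ℕ) :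
    Entails {.spider c (x, y) {a, e}, .spider c.swap (1, 1) {e, b}}
      {.spider c.swap (1, 1) {a, e'}, .spider c (y, x) {e', b}} := by
  refine .update e' (by simp [Multiset.count_cons, Multiset.count_singleton]; omega) (fun f => c.view
    ((c.view (f b)).1, (c.view (f a)).2)) fun hB f hf f' he hf' => ?_
  have hc := hB e'
  simp only [Multiset.insert_eq_cons, legsOf_cons, legsOf_singleton, legs_spider,
    Multiset.count_add, Multiset.count_cons, Multiset.count_singleton] at hc
  have h1 := hf' a (by grind)
  have h2 := hf' b (by grind)
  simp only [forall_mem_insert, forall_mem_singleton, Node.holds_spider₁, Node.holds_spider₂, Node.holds_spider₃, Colour.view_swap, Prod.fst_swap, Prod.snd_swap,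
    Colour.view_view, he, h1, h2, ite_self, true_and] at hf ⊢
  generalize c.view (f a) = A at *
  generalize c.view (f b) = B at *
  generalize c.view (f e) = E at *
  revert hf; clear * -
  revert A B E x y; decide

theorem entails_euler (c : Colour) (a b e e' : ℕ) :
    Entails {.had s(a, b)}
      {.spider c (0, 1) {a, e}, .spider c.swap (0, 1) {e, e'}, .spider c (0, 1) {e', b}} := by
  intro hB f hf
  have h1 := hB e
  have h2 := hB e'
  simp only [Multiset.insert_eq_cons, legsOf_cons, legsOf_singleton, legs_spider,
    Multiset.count_add, Multiset.count_cons, Multiset.count_singleton] at h1 h2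
  -- A `01` shift of colour `c` adds the first bit to the second, which gives the value on `e`. The
  -- wire `e'` shares its second bit with `e` and its first bit with `b`.
  refine ⟨fun x => if x = e then c.view ((c.view (f a)).1, (c.view (f a)).2 + (c.view (f a)).1) else
    if x = e' then c.view ((c.view (f b)).1, (c.view (f a)).2 + (c.view (f a)).1) else f x, ?_,
    fun x hx => ?_⟩
  · have k1 : a ≠ e ∧ a ≠ e' := by grind
    have k2 : b ≠ e ∧ b ≠ e' := by grind
    have k3 : e' ≠ e := by grind
    simp only [Multiset.mem_singleton, forall_eq, Node.holds_had] at hf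
    simp only [forall_mem_insert, forall_mem_singleton, Node.holds_spider₁, Node.holds_spider₂, Node.holds_spider₃, Colour.view_swap, Prod.fst_swap, Prod.snd_swap, Colour.view_view,
      if_true, k1, k2, k3, if_false, hf, ← Colour.swap_view]
    generalize c.view (f a) = A
    revert A; decide
  · simp only [Multiset.insert_eq_cons, legsOf_cons, legsOf_singleton, legs_spider,
      Multiset.count_add, Multiset.count_cons, Multiset.count_singleton] at hx
    grind

theorem euler_entails (c : Colour) (a b e e' : ℕ) :
    Entails {.spider c (0, 1) {a, e}, .spider c.swap (0, 1) {e, e'}, .spider c (0, 1) {e', b}}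
      {.had s(a, b)} := by
  refine .of_imp fun f hf => ?_
  simp only [forall_mem_insert, forall_mem_singleton, Node.holds_spider₁, Node.holds_spider₂, Node.holds_spider₃, Node.holds_had, Colour.view_swap, Prod.fst_swap, Prod.snd_swap, Colour.view_view] at hf ⊢
  rw [← c.view_view (f a), Colour.swap_view, ← c.view_view (f b)]
  congr 1
  generalize c.view (f a) = A at *
  generalize c.view (f b) = B at *
  generalize c.view (f e) = E at *
  generalize c.view (f e') = E' at *
  obtain ⟨⟨h1, h2⟩, ⟨h3, h4⟩, h5, h6⟩ := hf
  obtain ⟨x, y⟩ := A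
  obtain ⟨z, w⟩ := B
  obtain ⟨p, q⟩ := E
  obtain ⟨r, s⟩ := E'
  simp only [Prod.swap_prod_mk, Prod.mk.injEq] at *
  subst h1 h3 h5
  revert h2 h4 h6; clear * -
  revert x y r q w; decide

end ToyCalculus

/-! ### Soundness of rules with a new wire on each leg, and invariance of satisfiability -/

namespace ToyCalculus

variable {n : ℕ}

/-- The action of the phase `11` of the other colour on the states seen from a green spider. -/
def flip (s : Ontic) : Ontic := (s.1 + 1, s.2)

theorem flip_flip (s : Ontic) : flip (flip s) = s := by
  revert s; decide

theorem Node.holds_eleven (c : Colour) (a b : ℕ) (f : ℕ → Ontic) :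
    (Node.spider c (1, 1) {a, b}).Holds f ↔
      c.swap.view (f a) = flip (c.swap.view (f b)) := by
  rw [Node.holds_spider₂, Colour.view_swap, Colour.view_swap]
  generalize c.view (f a) = A
  generalize c.view (f b) = B
  revert A B; decide

theorem GreenSpider.flip {p : Phase} {S : Multiset Ontic} (h : GreenSpider p S) :
    GreenSpider p.swap (S.map ToyCalculus.flip) := by
  obtain ⟨u, h1, h2⟩ := h
  refine ⟨u + 1, fun s hs => ?_, ?_⟩
  · obtain ⟨t, ht, rfl⟩ := Multiset.mem_map.1 hs
    exact congrArg (· + 1) (h1 t ht)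
  · rw [Multiset.map_map]
    refine h2.trans ?_
    clear * -
    revert u p; decide

theorem exists_extend (L : Multiset (ℕ × ℕ)) (g : Ontic → Ontic) (f : ℕ → Ontic)
    (h : (L.map Prod.fst).Nodup) : ∃ f' : ℕ → Ontic, (∀ l ∈ L, f' l.1 = g (f l.2)) ∧
      ∀ x ∉ L.map Prod.fst, f' x = f x := by
  induction L using Multiset.induction with
  | empty => exact ⟨f, by simp, fun _ _ => rfl⟩
  | cons l L ih =>
    rw [Multiset.map_cons, Multiset.nodup_cons] at h
    obtain ⟨f', h1, h2⟩ := ih h.2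
    refine ⟨Function.update f' l.1 (g (f l.2)), fun l' hl' => ?_, fun x hx => ?_⟩
    · rcases Multiset.mem_cons.1 hl' with rfl | hl'
      · exact Function.update_self ..
      · rw [Function.update_of_ne (fun he : l'.1 = l.1 => h.1 (he ▸ Multiset.mem_map_of_mem _ hl')), h1 l' hl']
    · rw [Multiset.map_cons, Multiset.mem_cons, not_or] at hx
      rw [Function.update_of_ne hx.1, h2 x hx.2]

theorem legsOf_map_pair (L : Multiset (ℕ × ℕ)) (F : ℕ × ℕ → Node)
    (h : ∀ l, (F l).legs = {l.1} + {l.2}) :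
    legsOf (L.map F) = L.map Prod.fst + L.map Prod.snd := by
  induction L using Multiset.induction with
  | empty => rfl
  | cons l L ih =>
    rw [Multiset.map_cons, legsOf_cons, ih, h, Multiset.map_cons, Multiset.map_cons,
      ← Multiset.singleton_add, ← Multiset.singleton_add l.2]
    abel

/-- The new wires in the rules with arbitrarily many legs are distinct from each other and from the
outer wires. -/
theorem nodup_of_count {K F S : Multiset ℕ} (h : ∀ e, (K + F + (F + S)).count e ≤ 2) :
    F.Nodup ∧ (∀ x ∈ F, x ∉ K ∧ x ∉ S) := by
  simp only [Multiset.count_add] at h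
  constructor
  · rw [Multiset.nodup_iff_count_le_one]
    intro e
    have := h e
    omega
  · intro x hx
    have h1 := h x
    have h2 := Multiset.one_le_count_iff_mem.2 hx
    rw [← Multiset.count_eq_zero, ← Multiset.count_eq_zero]
    omega

theorem entails_copy11 (c : Colour) (a e : ℕ) (L : Multiset (ℕ × ℕ)) :
    Entails {.spider c (1, 1) {a, e}, .spider c.swap 0 (e ::ₘ L.map Prod.snd)}
      (.spider c.swap 0 (a ::ₘ L.map Prod.fst) ::ₘ
        L.map fun l => .spider c (1, 1) {l.1, l.2}) := by
  have hleg : legsOf (.spider c.swap 0 (a ::ₘ L.map Prod.fst) ::ₘ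
      L.map fun l => .spider c (1, 1) {l.1, l.2}) =
      {a} + L.map Prod.fst + (L.map Prod.fst + L.map Prod.snd) := by
    rw [legsOf_cons, legsOf_map_pair L _ fun l => rfl, legs_spider, ← Multiset.singleton_add]
  intro hB f hf
  rw [hleg] at hB ⊢
  obtain ⟨h1, h2⟩ := nodup_of_count hB
  obtain ⟨f', h3, h4⟩ := exists_extend L (fun s => c.swap.view (flip (c.swap.view s))) f h1
  have h5 : ∀ l ∈ L, f' l.2 = f l.2 := fun l hl =>
    h4 _ fun h => (h2 _ h).2 (Multiset.mem_map_of_mem _ hl)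
  have h6 : f' a = f a := h4 _ fun h => (h2 _ h).1 (Multiset.mem_singleton_self a)
  rw [forall_mem_insert, forall_mem_singleton, Node.holds_eleven] at hf
  refine ⟨f', fun N hN => ?_, fun x hx => h4 x fun h => ?_⟩
  · rcases Multiset.mem_cons.1 hN with rfl | hN
    · have := ((Node.holds_spider ..).1 hf.2).flip
      rw [Node.holds_spider]
      refine (congrArg (GreenSpider 0) ?_).mpr this
      rw [Multiset.map_cons, Multiset.map_cons, Multiset.map_cons, h6, hf.1, Multiset.map_map,
        Multiset.map_map, Multiset.map_map]
      congr 1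
      refine Multiset.map_congr rfl fun l hl => ?_
      simp only [Function.comp_apply, h3 l hl, Colour.view_view]
    · obtain ⟨l, hl, rfl⟩ := Multiset.mem_map.1 hN
      rw [Node.holds_eleven, h3 l hl, h5 l hl, Colour.view_view]
  · have := Multiset.one_le_count_iff_mem.2 h
    simp only [Multiset.count_add] at hx
    omega

theorem copy11_entails (c : Colour) (a e : ℕ) (L : Multiset (ℕ × ℕ)) :
    Entails (.spider c.swap 0 (a ::ₘ L.map Prod.fst) ::ₘ
        L.map fun l => .spider c (1, 1) {l.1, l.2})
      {.spider c (1, 1) {a, e}, .spider c.swap 0 (e ::ₘ L.map Prod.snd)} := by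
  intro hB f hf
  have hc := hB e
  simp only [Multiset.insert_eq_cons, legsOf_cons, legsOf_singleton, legs_spider,
    Multiset.count_add, Multiset.count_cons, Multiset.count_singleton, if_true] at hc
  have hae : a ≠ e := by rintro rfl; simp at hc
  have hL : e ∉ L.map Prod.snd := by
    rw [← Multiset.count_eq_zero]
    omega
  have h0 := (Node.holds_spider ..).1 (hf _ (Multiset.mem_cons_self ..))
  have h1 : ∀ l ∈ L, c.swap.view (f l.1) = flip (c.swap.view (f l.2)) := fun l hl =>
    (Node.holds_eleven ..).1 (hf _ (Multiset.mem_cons_of_mem (Multiset.mem_map_of_mem _ hl)))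
  have hf' : ∀ x ≠ e, Function.update f e (c.swap.view (flip (c.swap.view (f a)))) x = f x :=
    fun x hx => Function.update_of_ne hx _ _
  refine ⟨_, ?_, fun x hx => hf' x ?_⟩
  · rw [forall_mem_insert, forall_mem_singleton, Node.holds_eleven, hf' a hae,
      Function.update_self, Colour.view_view, flip_flip]
    refine ⟨rfl, ?_⟩
    rw [Node.holds_spider, Multiset.map_cons, map_update_of_notMem _ hf' hL, Function.update_self,
      Colour.view_view]
    refine (congrArg (GreenSpider 0) ?_).mpr h0.flip
    rw [Multiset.map_cons, Multiset.map_cons, Multiset.map_map,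
        Multiset.map_map, Multiset.map_map]
    congr 1
    refine Multiset.map_congr rfl fun l hl => ?_
    simp only [Function.comp_apply, h1 l hl, flip_flip]
  · rintro rfl
    simp only [Multiset.insert_eq_cons, legsOf_cons, legsOf_singleton, legs_spider,
      Multiset.count_add, Multiset.count_cons, Multiset.count_singleton, if_true] at hx
    omega

theorem entails_colour (c : Colour) (p : Phase) (L : Multiset (ℕ × ℕ)) :
    Entails {.spider c p (L.map Prod.snd)}
      (.spider c.swap p (L.map Prod.fst) ::ₘ L.map fun l => .had s(l.1, l.2)) := by
  have hleg : legsOf (.spider c.swap p (L.map Prod.fst) ::ₘ L.map fun l => .had s(l.1, l.2)) =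
      0 + L.map Prod.fst + (L.map Prod.fst + L.map Prod.snd) := by
    rw [legsOf_cons, legsOf_map_pair L _ fun l => legs_had .., legs_spider, zero_add]
  intro hB f hf
  rw [hleg] at hB ⊢
  obtain ⟨h1, h2⟩ := nodup_of_count hB
  obtain ⟨f', h3, h4⟩ := exists_extend L Prod.swap f h1
  have h5 : ∀ l ∈ L, f' l.2 = f l.2 := fun l hl =>
    h4 _ fun h => (h2 _ h).2 (Multiset.mem_map_of_mem _ hl)
  rw [forall_mem_singleton, Node.holds_spider, Multiset.map_map] at hf
  refine ⟨f', fun N hN => ?_, fun x hx => h4 x fun h => ?_⟩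
  · rcases Multiset.mem_cons.1 hN with rfl | hN
    · rw [Node.holds_spider, Multiset.map_map]
      convert hf using 1
      refine Multiset.map_congr rfl fun l hl => ?_
      simp only [Function.comp_apply, h3 l hl, Colour.view_swap, Colour.swap_view, Prod.swap_swap]
    · obtain ⟨l, hl, rfl⟩ := Multiset.mem_map.1 hN
      rw [Node.holds_had, h3 l hl, h5 l hl, Prod.swap_swap]
  · have := Multiset.one_le_count_iff_mem.2 h
    simp only [Multiset.count_add] at hx
    omega

theorem colour_entails (c : Colour) (p : Phase) (L : Multiset (ℕ × ℕ)) :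
    Entails (.spider c.swap p (L.map Prod.fst) ::ₘ L.map fun l => .had s(l.1, l.2))
      {.spider c p (L.map Prod.snd)} := by
  refine .of_imp fun f hf => ?_
  have h0 := (Node.holds_spider ..).1 (hf _ (Multiset.mem_cons_self ..))
  rw [forall_mem_singleton, Node.holds_spider, Multiset.map_map]
  rw [Multiset.map_map] at h0
  convert h0 using 1
  refine Multiset.map_congr rfl fun l hl => ?_
  have := (Node.holds_had ..).1
    (hf _ (Multiset.mem_cons_of_mem (Multiset.mem_map_of_mem (fun l => Node.had s(l.1, l.2)) hl)))
  simp only [Function.comp_apply, this, Colour.view_swap, Colour.swap_view]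

theorem LocalRule.entails {A B : Multiset Node} (h : LocalRule A B) :
    Entails A B ∧ Entails B A := by
  cases h with
  | spider c p q e S T => exact ⟨entails_spider c p q e S T, spider_entails c p q e S T⟩
  | loop c p e S => exact ⟨entails_loop c p e S, loop_entails c p e S⟩
  | bialgebra c a₁ a₂ b₁ b₂ e₁₁ e₁₂ e₂₁ e₂₂ e =>
    exact ⟨entails_bialgebra c a₁ a₂ b₁ b₂ e₁₁ e₁₂ e₂₁ e₂₂ e,
      bialgebra_entails c a₁ a₂ b₁ b₂ e₁₁ e₁₂ e₂₁ e₂₂ e⟩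
  | copy c a b e => exact ⟨entails_copy c a b e, copy_entails c a b e⟩
  | copy11 c a e L => exact ⟨entails_copy11 c a e L, copy11_entails c a e L⟩
  | comm11 c x y a b e e' =>
    -- The converse is the same rule read from `b` to `a`, with the two phase bits exchanged.
    refine ⟨entails_comm11 c x y a b e e', ?_⟩
    have := entails_comm11 c y x b a e' e
    rwa [Multiset.pair_comm b e', Multiset.pair_comm e' a, Multiset.pair_comm b e,
      Multiset.pair_comm e a, Multiset.pair_comm (Node.spider _ _ _),
      Multiset.pair_comm (Node.spider c.swap (1, 1) {e, b})] at this
  | colour c p L => exact ⟨entails_colour c p L, colour_entails c p L⟩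
  | euler c a b e e' => exact ⟨entails_euler c a b e e', euler_entails c a b e e'⟩

/-- The conditions of all nodes can be satisfied. -/
def Diagram.Sat (D : Diagram 0 n) : Prop := ∃ f : ℕ → Ontic, ∀ N ∈ D.nodes, N.Holds f

theorem Diagram.sat_of_nonempty {D : Diagram 0 n} (h : D.interp.Nonempty) : D.Sat := by
  obtain ⟨_, f, _, _, h⟩ := h
  exact ⟨f, h⟩

theorem Diagram.count_legsOf (D : Diagram 0 n) (e : ℕ) : (legsOf D.nodes).count e ≤ 2 := by
  have := D.count_wires e
  rw [Diagram.wires, Multiset.count_add] at this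
  omega

/-- A wire that meets the rest `C` has at most one end in `B`, so the values changed by the local
solution are invisible to `C`. -/
theorem sat_of_entails {D D' : Diagram 0 n} {A B C : Multiset Node} (h : Entails A B)
    (hA : D.nodes = A + C) (hB : D'.nodes = B + C) (hD : D.Sat) : D'.Sat := by
  obtain ⟨f, hf⟩ := hD
  have hc := D'.count_legsOf
  simp only [hB, legsOf_add, Multiset.count_add] at hc
  simp only [hA, Multiset.mem_add] at hf
  obtain ⟨f', h1, h2⟩ := h (fun e => (Nat.le_add_right ..).trans (hc e)) f fun N hN => hf N (.inl hN)
  refine ⟨f', fun N hN => ?_⟩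
  rw [hB, Multiset.mem_add] at hN
  rcases hN with hN | hN
  · exact h1 N hN
  · refine (Node.holds_congr fun x hx => h2 x ?_).2 (hf N (.inr hN))
    have h3 := Multiset.one_le_count_iff_mem.2 (mem_legsOf hN hx)
    have := hc x
    omega

theorem Node.holds_identity (c : Colour) (a b : ℕ) (f : ℕ → Ontic) :
    (Node.spider c 0 {a, b}).Holds f ↔ f a = f b := by
  rw [Node.holds_spider₂]
  have h : f a = f b ↔ c.view (f a) = c.view (f b) :=
    ⟨fun h => by rw [h], fun h => by rw [← c.view_view (f a), h, c.view_view]⟩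
  rw [h]
  generalize c.view (f a) = A
  generalize c.view (f b) = B
  revert A B; decide

theorem Step.sat_iff {D D' : Diagram 0 n} (h : Step D D') : D.Sat ↔ D'.Sat := by
  cases h with
  | relabel f hi ho hn hc =>
    simp only [Diagram.Sat, hn, Multiset.mem_map, forall_exists_index, and_imp,
      forall_apply_eq_imp_iff₂, Node.holds_rename]
    constructor
    · rintro ⟨g, hg⟩
      exact ⟨g ∘ f.symm, by simpa [Function.comp_assoc] using hg⟩
    · rintro ⟨g, hg⟩
      exact ⟨_, hg⟩
  | rule A B C h hi ho hA hB hc =>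
    exact ⟨sat_of_entails h.entails.1 hA hB, sat_of_entails h.entails.2 hB hA⟩
  | identity c a b C hab hi ho hn hn' hc =>
    simp only [Diagram.Sat, hn, hn', Multiset.mem_map, forall_exists_index, and_imp,
      forall_apply_eq_imp_iff₂, Node.holds_rename, Multiset.mem_cons, forall_eq_or_imp,
      Node.holds_identity]
    constructor
    · rintro ⟨g, hg, hg'⟩
      refine ⟨g, fun N hN => ?_⟩
      convert hg' N hN using 1
      funext x
      by_cases hx : x = b
      · subst hx; simp [hg]
      · simp [hx]
    · rintro ⟨g, hg⟩
      exact ⟨_, by simp [hab], hg⟩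
  | scalar s hs hi ho hn hc =>
    constructor
    · rintro ⟨f, hf⟩
      exact ⟨f, fun N hN => hf N (hn ▸ Multiset.mem_add.2 (.inr hN))⟩
    · rintro ⟨f, hf⟩
      obtain ⟨g, hg⟩ := Diagram.sat_of_nonempty hs
      classical
      -- All wires of the scalar have both ends inside it, so the two solutions live on disjoint
      -- sets of wires.
      refine ⟨fun x => if x ∈ legsOf s.nodes then g x else f x, fun N hN => ?_⟩
      rw [hn, Multiset.mem_add] at hN
      rcases hN with hN | hN
      · exact (Node.holds_congr fun x hx => if_pos (mem_legsOf hN hx)).2 (hg N hN)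
      · refine (Node.holds_congr fun x hx => if_neg fun hx' => ?_).2 (hf N hN)
        have h1 := Multiset.one_le_count_iff_mem.2 (mem_legsOf hN hx)
        have h2 := Multiset.one_le_count_iff_mem.2 hx'
        have h3 := s.count_wires x
        have h4 := D.count_legsOf x
        rw [hn, legsOf_add, Multiset.count_add] at h4
        have h5 : ends s.output = 0 := by simp [ends]
        rw [Diagram.wires, h5, zero_add] at h3
        omega

theorem Diagram.sat_congr {D D' : Diagram 0 n} (h : cls D = cls D') : D.Sat ↔ D'.Sat :=
  iff_of_eq (congrArg (Quot.lift Diagram.Sat fun _ _ h => propext h.sat_iff) h)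

end ToyCalculus

/-! ### Projecting the last output of a normal form -/

namespace ToyCalculus

variable {n m : ℕ}

open Circuit

/-- The state has a diagram with a scalar node that denotes the empty relation. -/
def Vanishes (ψ : St n) : Prop :=
  ∃ (D : Diagram 0 n) (c : Colour), ψ = cls D ∧ Node.spider c (1, 1) 0 ∈ D.nodes

theorem Vanishes.act {ψ : St n} (h : Vanishes ψ) (K : Gate n m) : Vanishes (K.act ψ) := by
  obtain ⟨D, c, rfl, h⟩ := h
  refine ⟨K.comp D, c, rfl, ?_⟩
  rw [K.comp_nodes]
  exact Multiset.mem_add.2 (.inr (Multiset.mem_map.2 ⟨_, h, rfl⟩))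

theorem Vanishes.not_sat {D : Diagram 0 n} (h : Vanishes (cls D)) : ¬ D.Sat := by
  obtain ⟨D', c, h, h'⟩ := h
  rw [Diagram.sat_congr h]
  rintro ⟨f, hf⟩
  obtain ⟨u, -, hu⟩ := (Node.holds_spider ..).1 (hf _ h')
  revert hu
  simp

/-- The state has a normal form or denotes the empty relation. -/
def Good (ψ : St n) : Prop := IsNF ψ ∨ Vanishes ψ

namespace Good

variable {ψ : St n}

theorem op (i : Fin n) (a : Op) (h : Good ψ) : Good (op i a ψ) := by
  rcases h with h | h
  · refine .inl ?_
    match a with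
    | .phase .green p => exact h.ph i p
    | .phase .red p => exact h.rph i p
    | .had => exact h.hd i
  · exact .inr (h.act _)

theorem cz (i j : Fin n) (h : Good ψ) : Good (cz i j ψ) := by
  refine h.imp (IsNF.cz i j) fun h => ?_
  unfold ToyCalculus.cz
  split_ifs
  · exact h.act _
  · exact h

theorem cx (i j : Fin n) (h : Good ψ) : Good (cx i j ψ) := by
  rw [cx_eq]
  exact ((h.op j .had).cz i j).op j .had

end Good

theorem cap_cx (i j : Fin n) (ψ : St (n + 1)) :
    cap (cx i.castSucc j.castSucc ψ) = cx i j (cap ψ) := by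
  rw [cx_eq, cap_op, cap_cz, cap_op, cx_eq]

theorem cap_cx_last (j : Fin n) (ψ : St (n + 1)) :
    cap (cx (Fin.last n) j.castSucc ψ) = cap ψ := by
  rw [cx_eq, cap_op, cap_cz_last, cap_op, hd_hd]

theorem exists_eq_castSucc {i : Fin (n + 1)} (h : i ≠ Fin.last n) : ∃ j : Fin n, i = j.castSucc :=
  ⟨i.castPred h, (Fin.castSucc_castPred i h).symm⟩

/-- The projection sets a free variable to zero. As this output is never a target, all operations on
it are absorbed and the others pass through. -/
theorem NF.cap_notMem {B : Finset (Fin (n + 1))} {ψ : St (n + 1)} (hB : Fin.last n ∉ B)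
    (h : NF B ψ) : IsNF (cap ψ) := by
  induction h with
  | base => rw [cap_base hB]; exact ⟨_, .base⟩
  | @cz a b ψ ha hb h ih =>
    by_cases hal : a = Fin.last n
    · rwa [hal, cap_cz_last]
    by_cases hbl : b = Fin.last n
    · rwa [hbl, cz_symm, cap_cz_last]
    obtain ⟨a, rfl⟩ := exists_eq_castSucc hal
    obtain ⟨b, rfl⟩ := exists_eq_castSucc hbl
    rw [cap_cz]; exact ih.cz a b
  | @cx a b ψ ha hb h ih =>
    obtain ⟨b, rfl⟩ := exists_eq_castSucc fun h => hB (h ▸ hb)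
    by_cases hal : a = Fin.last n
    · rwa [hal, cap_cx_last]
    obtain ⟨a, rfl⟩ := exists_eq_castSucc hal
    rw [cap_cx]; exact ih.cx a b
  | @ph a ψ ha p h ih =>
    by_cases hal : a = Fin.last n
    · rwa [hal, cap_ph_last]
    obtain ⟨a, rfl⟩ := exists_eq_castSucc hal
    rw [cap_op]; exact ih.ph a p
  | @rph b ψ hb h ih =>
    obtain ⟨b, rfl⟩ := exists_eq_castSucc fun h => hB (h ▸ hb)
    rw [cap_op]; exact ih.rph b _

theorem LEq.scalar_same (c : Colour) (e : ℕ) : LEq {.spider c 0 {e}, .spider c 0 {e}} 0 := by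
  refine LEq.step₀ (LEq.fuse c 0 0 e 0 0) 0 {e} ?_
  exact (LEq.scalar_spider c 0 (by decide)).sub 0

theorem cap_base_mem {B : Finset (Fin (n + 1))} (h : Fin.last n ∈ B) :
    cap (base B) = base (initial B) := by
  obtain ⟨E, h1, h2, h3, h4⟩ := cap_cls (baseD B)
  rw [base, h1]
  refine LEq.scalar_same .red n E _ (baseD (initial B)).nodes ?_ (zero_add _).symm h2.symm
    h4.symm
  rw [h3, baseD_nodes_last, if_pos h, ← add_assoc]
  rfl

/-- The red state, the red `11` shift and the red projection fuse to a legless red spider of phase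
`11`: the constant one is projected to zero. -/
theorem vanishes_cap_rph_base {B : Finset (Fin (n + 1))} (h : Fin.last n ∈ B) :
    Vanishes (cap (𝐑 (Fin.last n) (1, 1) (base B))) := by
  obtain ⟨N, hN⟩ := exists_fresh (baseD B).wires
  obtain ⟨E, h1, h2, h3, h4⟩ := (cons (nOp (Fin.last n) (.phase .red (1, 1)) 0)
    (cons (nCap n) nil)).exists_run (baseD B) N (by simp) fun j _ hj => by
      have := hN _ hj
      omega
  simp only [frag_cons, frag_nil, nOp_frag, nOp_name_out, nCap_frag, Function.update_self,
    baseD_nodes_last, if_pos h] at h3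
  have key : ∀ x y : ℕ, LEq {.spider .red (1, 1) {x, y}, .spider .red 0 {y}, .spider .red 0 {x}}
      {.spider .red (1, 1) 0} := by
    intro x y
    refine LEq.step₀ (LEq.fuse .red (1, 1) 0 y {x} 0) {.spider .red 0 {x}} {y} ?_
    exact (LEq.fuse .red (1, 1) 0 x 0 0).sub 0
  obtain ⟨E', h1', -, -, h2'⟩ := (key n (N + 0)).exists_rewrite E (baseD (initial B)).nodes
    (by
      rw [h3]
      simp only [Multiset.insert_eq_cons, ← Multiset.singleton_add, add_zero, add_assoc]
      rfl) 0 {n, N + 0}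
    (by
      simp only [Multiset.insert_eq_cons, ← Multiset.singleton_add, legsOf_add, legsOf_singleton,
        legsOf_zero, legs_spider]
      abel) Multiset.nodup_zero (by simp)
  refine ⟨E', .red, ?_, ?_⟩
  · exact (show _ = cls E from h1).trans h2'
  · rw [h1']
    simp

theorem foldr_comm {α β : Type*} (f : α → β → β) (F : β → β) {T : List α}
    (h : ∀ b ∈ T, ∀ x, F (f b x) = f b (F x)) (x : β) : F (T.foldr f x) = T.foldr f (F x) := by
  induction T with
  | nil => rfl
  | cons b T ih =>
    rw [List.foldr_cons, h b List.mem_cons_self, ih fun c hc => h c (List.mem_cons_of_mem _ hc),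
      List.foldr_cons]

theorem foldr_erase {α β : Type*} [BEq α] [LawfulBEq α] (f : α → β → β) {T : List α} {b : α}
    (h : ∀ a ∈ T, ∀ b ∈ T, ∀ x, f a (f b x) = f b (f a x)) (hb : b ∈ T) (x : β) :
    T.foldr f x = f b ((T.erase b).foldr f x) := by
  refine ((List.perm_cons_erase hb).foldr_eq' (fun a ha b hb x => h b hb a ha x) x).trans ?_
  rw [List.foldr_cons]

/-- The induction carries the affine function at the last output: `T` lists its free variables and
`p` its constant. Operations with another target or position move out through the projection; those
on the last output update `T` modulo two or `p`. -/
theorem NF.cap_mem {B : Finset (Fin (n + 1))} {ψ : St (n + 1)} (hB : Fin.last n ∈ B)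
    (h : NF B ψ) : ∀ T : List (Fin (n + 1)), T.Nodup → (∀ a ∈ T, a ∉ B) → ∀ p : Phase,
      p = 0 ∨ p = (1, 1) →
      Good (cap (T.foldr (fun a => ToyCalculus.cx a (Fin.last n)) (𝐑 (Fin.last n) p ψ))) := by
  have hl : ∀ {a}, a ∉ B → a ≠ Fin.last n := fun ha h => ha (h ▸ hB)
  induction h with
  | base =>
    intro T hT hTB p hp
    match T with
    -- The last output is constant, and the projection either succeeds or leaves the empty scalar.
    | [] =>
      rcases hp with rfl | rfl
      · rw [rph_zero]
        rw [List.foldr_nil, cap_base_mem hB]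
        exact .inl ⟨_, .base⟩
      · exact .inr (vanishes_cap_rph_base hB)
    -- The function is not constant. Pivoting at `a` makes the last output free, the other controls
    -- only change free variables, and the projection of a free output applies.
    | a :: T =>
      have haT := List.nodup_cons.1 hT
      have haB := hTB a List.mem_cons_self
      have hB' : Fin.last n ∉ insert a (B.erase (Fin.last n)) := by
        simp [(hl haB).symm]
      rw [List.foldr_cons, foldr_comm (fun a => ToyCalculus.cx a (Fin.last n))
        (ToyCalculus.cx a (Fin.last n)) fun b hb ψ => cx_cx_comm
          (hl (hTB b (List.mem_cons_of_mem _ hb))).symm (hl haB).symm ψ]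
      rw [← rph_cx_target, cx_base_notMem haB hB]
      refine .inl (NF.cap_notMem hB' ?_)
      have h0 : NF (insert a (B.erase (Fin.last n))) (𝐑 (Fin.last n) p (ToyCalculus.cx (Fin.last n) a
          (ToyCalculus.base (insert a (B.erase (Fin.last n)))))) := by
        have h1 := NF.cx hB' (Finset.mem_insert_self ..) (.base (B := insert a (B.erase (Fin.last n))))
        rcases hp with rfl | rfl
        · rwa [rph_zero]
        · exact h1.rph_notMem hB'
      have h2 : ∀ b ∈ T, b ≠ Fin.last n ∧ b ∉ insert a (B.erase (Fin.last n)) := by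
        intro b hb
        have hbB := hTB b (List.mem_cons_of_mem _ hb)
        refine ⟨hl hbB, fun h => ?_⟩
        rcases Finset.mem_insert.1 h with rfl | h
        · exact haT.1 hb
        · exact hbB (Finset.mem_of_mem_erase h)
      clear hT hTB haT
      induction T with
      | nil => exact h0
      | cons b T ih =>
        have := h2 b List.mem_cons_self
        exact NF.cx_notMem this.1 this.2 hB' (ih fun c hc => h2 c (List.mem_cons_of_mem _ hc))
  | @cz c d ψ hc hd h ih =>
    intro T hT hTB p hp
    obtain ⟨c', rfl⟩ := exists_eq_castSucc (hl hc)
    obtain ⟨d', rfl⟩ := exists_eq_castSucc (hl hd)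
    rw [op_cz (hl hc).symm (hl hd).symm, ← foldr_comm (fun a => ToyCalculus.cx a (Fin.last n)) (ToyCalculus.cz _ _)
      fun b _ ψ => cz_cx_comm (hl hc).symm (hl hd).symm ψ, cap_cz]
    exact (ih T hT hTB p hp).cz ..
  | @cx c d ψ hc hd h ih =>
    intro T hT hTB p hp
    by_cases hdl : d = Fin.last n
    · subst hdl
      rw [rph_cx_target, ← foldr_comm (fun a => ToyCalculus.cx a (Fin.last n))
        (ToyCalculus.cx c (Fin.last n)) fun b hb ψ =>
          cx_cx_comm (hl (hTB b hb)).symm (hl hc).symm ψ]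
      by_cases hcT : c ∈ T
      · rw [foldr_erase (fun a => ToyCalculus.cx a (Fin.last n))
          (fun a ha b hb ψ => cx_cx_comm (hl (hTB b hb)).symm (hl (hTB a ha)).symm ψ) hcT, cx_cx]
        exact ih _ (hT.erase c) (fun b hb => hTB b (List.mem_of_mem_erase hb)) p hp
      · refine ih (c :: T) (List.nodup_cons.2 ⟨hcT, hT⟩) (fun b hb => ?_) p hp
        rcases List.mem_cons.1 hb with rfl | hb
        exacts [hc, hTB b hb]
    · obtain ⟨c', rfl⟩ := exists_eq_castSucc (hl hc)
      obtain ⟨d', rfl⟩ := exists_eq_castSucc hdl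
      rw [op_cx (hl hc).symm (Ne.symm hdl), ← foldr_comm (fun a => ToyCalculus.cx a (Fin.last n)) (ToyCalculus.cx _ _)
        fun b hb ψ => (cx_cx_comm (hl hc).symm (ne_of_mem_of_notMem' hd (hTB b hb)) ψ).symm, cap_cx]
      exact (ih T hT hTB p hp).cx ..
  | @ph c ψ hc q h ih =>
    intro T hT hTB p hp
    obtain ⟨c', rfl⟩ := exists_eq_castSucc (hl hc)
    rw [op_comm (hl hc).symm, ← foldr_comm (fun a => ToyCalculus.cx a (Fin.last n)) (𝐆 c'.castSucc q)
      fun b _ ψ => ph_cx_comm (hl hc) q ψ, cap_op]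
    exact (ih T hT hTB p hp).op ..
  | @rph d ψ hd h ih =>
    intro T hT hTB p hp
    by_cases hdl : d = Fin.last n
    · subst hdl
      rw [rph_rph]
      refine ih T hT hTB _ ?_
      rcases hp with rfl | rfl
      · exact .inr (by decide)
      · exact .inl (by decide)
    · obtain ⟨d', rfl⟩ := exists_eq_castSucc hdl
      rw [op_comm (Ne.symm hdl), ← foldr_comm (fun a => ToyCalculus.cx a (Fin.last n)) (𝐑 d'.castSucc (1, 1))
        fun b hb ψ => op_cx (ne_of_mem_of_notMem' hd (hTB b hb)) hdl _ ψ, cap_op]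
      exact (ih T hT hTB p hp).op ..

theorem Good.cap {ψ : St (n + 1)} (h : Good ψ) : Good (cap ψ) := by
  rcases h with ⟨B, h⟩ | h
  · by_cases hB : Fin.last n ∈ B
    · simpa [rph_zero] using h.cap_mem hB [] List.nodup_nil (by simp) 0 (.inl rfl)
    · exact .inl (h.cap_notMem hB)
  · exact .inr (h.act _)

end ToyCalculus

/-! ### Spiders on outputs as composites of gates -/

namespace ToyCalculus

variable {n m : ℕ}

open Circuit

theorem ends_succ (o : Fin (n + 1) → ℕ) :
    ends o = o (Fin.last n) ::ₘ ends (o ∘ Fin.castSucc) := by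
  rw [ends, Fin.univ_castSuccEmb, Finset.cons_val, Multiset.map_cons, Finset.map_val,
    Multiset.map_map]
  rfl

/-- A spider on the last `k` outputs. -/
def spiderGate (c : Colour) (p : Phase) (n k : ℕ) : Gate (n + k) n where
  out := fun i => i
  nodes := {.spider c p (ends fun i : Fin k => n + i)}
  inner := ∅
  le_inner := by simp
  bal := by
    have h : ends (fun i : Fin k => n + (i : ℕ)) = (Multiset.range k).map (n + ·) := by
      rw [← ends_val, ← ends_comp]
      rfl
    rw [legsOf_singleton, legs_spider, h, Multiset.range_add]
    change ends (Fin.val : Fin n → ℕ) + _ = _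
    rw [ends_val]
    simp

def nSpider (c : Colour) (p : Phase) (n k : ℕ) : NamedGate (n + k) n where
  toGate := spiderGate c p n k
  ν := []
  inner_eq := by simp [spiderGate]

@[simp] theorem nSpider_ν (c : Colour) (p : Phase) (k : ℕ) : (nSpider c p n k).ν = [] := rfl

@[simp] theorem nSpider_name_out (c : Colour) (p : Phase) (k N : ℕ) (o : Fin (n + k) → ℕ) :
    (nSpider c p n k).name N o ∘ (nSpider c p n k).out = o ∘ Fin.castAdd k :=
  funext fun i => (nSpider c p n k).name_val N o (i.castAdd k)

@[simp] theorem nSpider_frag (c : Colour) (p : Phase) (k N : ℕ) (o : Fin (n + k) → ℕ) :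
    (nSpider c p n k).nodes.map (Node.rename ((nSpider c p n k).name N o)) =
      {.spider c p (ends (o ∘ Fin.natAdd n))} := by
  change Multiset.map _ {_} = _
  rw [Multiset.map_singleton, Node.rename, ← ends_comp]
  exact congrArg (fun x => ({.spider c p (ends x)} : Multiset Node))
    (funext fun i => (nSpider c p n k).name_val N o (i.natAdd n))

/-- A green `00` state is H on a red one, so closing with a green state is H followed by the red
projection. -/
theorem spider_one_green (p : Phase) (ψ : St (n + 1)) : (nSpider .green p n 1).act ψ =
    cap (𝐇 (Fin.last n) (𝐆 (Fin.last n) p ψ)) := by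
  refine Circuit.run_eq (.cons (nSpider .green p n 1) .nil)
    (.cons (nOp (Fin.last n) (.phase .green p) 0) (.cons (nOp (Fin.last n) .had 1)
      (.cons (nCap n) .nil))) (by simp) (by simp) (fun N o => ?_) (fun N o => ?_) ψ
  · simp only [outs_cons, outs_nil, nOp_name_out, nCap_name_out, nSpider_name_out,
      Function.update_idem]
    funext i
    exact (Function.update_of_ne (Fin.castSucc_lt_last i).ne _ _).symm
  · have h : ends (o ∘ Fin.natAdd n) = {o (Fin.last n)} := by
      rw [ends_succ]; rfl
    simp only [frag_cons, frag_nil, nSpider_frag, nOp_frag, nOp_name_out, nCap_frag, Op.node,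
      Function.update_self, h]
    refine LEq.symm ?_
    rw [Sym2.eq_swap]
    refine LEq.step₀ (LEq.colour₁ .green 0 (N + 0) (N + 1)).symm
      {.spider .green p {o (Fin.last n), N + 0}} {N + 1} ?_
    exact (LEq.fuse .green p 0 (N + 0) {o (Fin.last n)} 0).sub 0

theorem spider_one_red (p : Phase) (ψ : St (n + 1)) : (nSpider .red p n 1).act ψ =
    cap (𝐑 (Fin.last n) p ψ) := by
  refine Circuit.run_eq (.cons (nSpider .red p n 1) .nil)
    (.cons (nOp (Fin.last n) (.phase .red p) 0) 
      (.cons (nCap n) .nil)) (by simp) (by simp) (fun N o => ?_) (fun N o => ?_) ψ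
  · simp only [outs_cons, outs_nil, nOp_name_out, nCap_name_out, nSpider_name_out]
    funext i
    exact (Function.update_of_ne (Fin.castSucc_lt_last i).ne _ _).symm
  · have h : ends (o ∘ Fin.natAdd n) = {o (Fin.last n)} := by
      rw [ends_succ]; rfl
    simp only [frag_cons, frag_nil, nSpider_frag, nOp_frag, nOp_name_out, nCap_frag, Op.node,
      Function.update_self, h]
    exact (LEq.fuse .red p 0 (N + 0) {o (Fin.last n)} 0).symm.sub 0

theorem ends_succ_succ (k : ℕ) (o : Fin (n + (k + 2)) → ℕ) : ends (o ∘ Fin.natAdd n) =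
    o (Fin.last (n + k + 1)) ::ₘ o (Fin.last (n + k)).castSucc ::ₘ
      ends fun i : Fin k => o (i.natAdd n).castSucc.castSucc := by
  rw [ends_succ, ends_succ]; rfl

theorem ends_update_update (k : ℕ) (o : Fin (n + (k + 2)) → ℕ) (x y : ℕ) :
    ends (Function.update (Function.update o (Fin.last (n + k + 1)) y)
        (Fin.last (n + k)).castSucc x ∘ Fin.castSucc ∘ Fin.natAdd (m := k + 1) n) =
      x ::ₘ ends fun i : Fin k => o (i.natAdd n).castSucc.castSucc := by
  rw [ends_succ]
  congr 1
  · exact Function.update_self ..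
  · refine congrArg ends (funext fun i => ?_)
    have h : (i.natAdd n).castSucc.castSucc ≠ (Fin.last (n + k)).castSucc := fun h =>
      (Fin.castSucc_lt_last (i.natAdd n)).ne (Fin.castSucc_injective _ h)
    exact (Function.update_of_ne h _ _).trans
      (Function.update_of_ne (Fin.castSucc_lt_last (i.natAdd n).castSucc).ne _ _)

theorem update_update_castAdd (k : ℕ) (o : Fin (n + (k + 2)) → ℕ) (x y : ℕ) :
    Function.update (Function.update o (Fin.last (n + k + 1)) y)
        (Fin.last (n + k)).castSucc x ∘ Fin.castSucc ∘ Fin.castAdd (n := n) (k + 1) =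
      o ∘ Fin.castAdd (k + 2) := by
  funext i
  have h : (i.castAdd (k + 1)).castSucc ≠ (Fin.last (n + k)).castSucc := fun h => by
    have := congrArg Fin.val h
    simp at this
    omega
  exact (Function.update_of_ne h _ _).trans
    (Function.update_of_ne (Fin.castSucc_lt_last (i.castAdd (k + 1))).ne _ _)

/-- Projecting the target of a `cx` onto the red state turns its red node into an identity, so two
outputs merge in a green node. This lowers the number of legs by one. -/
theorem spider_succ_succ_green (p : Phase) (k : ℕ) (ψ : St (n + (k + 2))) :
    (nSpider .green p n (k + 2)).act ψ = (nSpider .green p n (k + 1)).act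
      (cap (cx (Fin.last (n + k)).castSucc (Fin.last (n + k + 1)) ψ)) := by
  have h : (Fin.last (n + k)).castSucc ≠ Fin.last (n + k + 1) := (Fin.castSucc_lt_last _).ne
  have := Circuit.run_eq (.cons (nSpider .green p n (k + 2)) .nil)
    (.cons (nCX (Fin.last (n + k)).castSucc (Fin.last (n + k + 1)) h 0 1 2)
      (.cons (nCap (n + k + 1)) (.cons (nSpider .green p n (k + 1)) .nil)))
    (by simp) (by simp) (fun N o => ?_) (fun N o => ?_) ψ
  · rw [← nCX_act _ _ h 0 1 2]; exact this
  · simp only [outs_cons, outs_nil, nCX_name_out, nCap_name_out, nSpider_name_out]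
    rw [Function.update_comm h, Function.comp_assoc]
    exact (update_update_castAdd k o _ _).symm
  · simp only [frag_cons, frag_nil, nSpider_frag, nCX_frag, nCX_name_out, nCap_frag,
      nCap_name_out, Function.update_self]
    rw [Function.update_comm h, Function.comp_assoc, ends_update_update, ends_succ_succ]
    generalize ends (fun i : Fin k => o (i.natAdd n).castSucc.castSucc) = S
    generalize o (Fin.last (n + k)).castSucc = a
    generalize o (Fin.last (n + k + 1)) = b
    refine LEq.symm ?_
    refine LEq.step₀ (LEq.fuse .red 0 0 (N + 1) {N + 2, b} 0)
      {.spider .green 0 {a, N + 0, N + 2}, .spider .green p ((N + 0) ::ₘ S)} {N + 1} ?_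
    refine LEq.step₀ (LEq.identity_swap .red .green (N + 2) b)
      {.spider .green 0 {a, N + 0, N + 2}, .spider .green p ((N + 0) ::ₘ S)} 0 ?_
    refine LEq.step₀ (LEq.fuse .green 0 0 (N + 2) {a, N + 0} {b})
      {.spider .green p ((N + 0) ::ₘ S)} {N + 2} ?_
    exact (LEq.fuse .green 0 p (N + 0) {a, b} S).sub 0

/-- Here the two outputs must merge in a red node, so the last one is the control and is closed with
a green state, that is, with H and the red projection. -/
theorem spider_succ_succ_red (p : Phase) (k : ℕ) (ψ : St (n + (k + 2))) :
    (nSpider .red p n (k + 2)).act ψ = (nSpider .red p n (k + 1)).act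
      (cap (𝐇 (Fin.last (n + k + 1))
        (cx (Fin.last (n + k + 1)) (Fin.last (n + k)).castSucc ψ))) := by
  have h : (Fin.last (n + k)).castSucc ≠ Fin.last (n + k + 1) := (Fin.castSucc_lt_last _).ne
  have := Circuit.run_eq (.cons (nSpider .red p n (k + 2)) .nil)
    (.cons (nCX (Fin.last (n + k + 1)) (Fin.last (n + k)).castSucc h.symm 0 1 2)
      (.cons (nOp (Fin.last (n + k + 1)) .had 3)
        (.cons (nCap (n + k + 1)) (.cons (nSpider .red p n (k + 1)) .nil))))
    (by simp) (by simp) (fun N o => ?_) (fun N o => ?_) ψ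
  · rw [← nCX_act _ _ h.symm 0 1 2]; exact this
  · simp only [outs_cons, outs_nil, nCX_name_out, nCap_name_out, nSpider_name_out, nOp_name_out]
    rw [Function.update_comm h.symm, Function.update_idem, Function.update_comm h,
      Function.comp_assoc]
    exact (update_update_castAdd k o _ _).symm
  · simp only [frag_cons, frag_nil, nSpider_frag, nCX_frag, nCX_name_out, nCap_frag,
      nCap_name_out, nOp_frag, nOp_name_out, Function.update_self, Op.node]
    rw [Function.update_of_ne h.symm, Function.update_comm h.symm, Function.update_idem,
      Function.update_comm h, Function.update_self,
      Function.comp_assoc, ends_update_update, ends_succ_succ]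
    generalize ends (fun i : Fin k => o (i.natAdd n).castSucc.castSucc) = S
    generalize o (Fin.last (n + k)).castSucc = a
    generalize o (Fin.last (n + k + 1)) = b
    refine LEq.symm ?_
    rw [Sym2.eq_swap]
    refine LEq.step₀ (LEq.colour₁ .green 0 (N + 0) (N + 3)).symm
      {.spider .green 0 {b, N + 0, N + 2}, .spider .red 0 {N + 2, a, N + 1},
        .spider .red p ((N + 1) ::ₘ S)} {N + 3} ?_
    refine LEq.step₀ (LEq.fuse .green 0 0 (N + 0) {b, N + 2} 0)
      {.spider .red 0 {N + 2, a, N + 1}, .spider .red p ((N + 1) ::ₘ S)} {N + 0} ?_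
    refine LEq.step₀ (LEq.identity_swap .green .red b (N + 2))
      {.spider .red 0 {N + 2, a, N + 1}, .spider .red p ((N + 1) ::ₘ S)} 0 ?_
    refine LEq.step₀ (LEq.fuse .red 0 0 (N + 2) {b} {a, N + 1})
      {.spider .red p ((N + 1) ::ₘ S)} {N + 2} ?_
    exact (LEq.fuse .red 0 p (N + 1) {a, b} S).sub 0

end ToyCalculus

/-! ### Induction over the nodes of a diagram -/

namespace ToyCalculus

variable {n m : ℕ}

open Circuit

theorem nSpider_zero (c : Colour) (p : Phase) (hp : p ≠ (1, 1)) (ψ : St n) :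
    (nSpider c p n 0).act ψ = ψ := by
  refine Circuit.run_eq (.cons (nSpider c p n 0) .nil) .nil (by simp) (by simp)
    (fun N o => ?_) (fun N o => ?_) ψ
  · simp only [outs_cons, outs_nil, nSpider_name_out]
    rfl
  · simp only [frag_cons, frag_nil, nSpider_frag]
    exact (LEq.scalar_spider c p hp).sub 0

theorem vanishes_nSpider_zero (c : Colour) (ψ : St n) :
    Vanishes ((nSpider c (1, 1) n 0).act ψ) := by
  induction ψ using Quot.ind with
  | _ D =>
  refine ⟨_, c, (nSpider c (1, 1) n 0).act_cls D, ?_⟩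
  rw [Gate.comp_nodes]
  exact Multiset.mem_add.2 (.inl (Multiset.mem_map.2 ⟨_, Multiset.mem_singleton_self _, rfl⟩))

theorem Good.spider (c : Colour) (p : Phase) (k : ℕ) {ψ : St (n + k)} (h : Good ψ) :
    Good ((nSpider c p n k).act ψ) := by
  match k with
  | 0 =>
    by_cases hp : p = (1, 1)
    · rw [hp]
      exact .inr (vanishes_nSpider_zero c _)
    · rw [nSpider_zero c p hp]
      exact h
  | 1 =>
    match c with
    | .green => rw [spider_one_green]; exact ((h.op _ _).op _ _).cap
    | .red => rw [spider_one_red]; exact (h.op _ _).cap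
  | k + 2 =>
    match c with
    | .green => rw [spider_succ_succ_green]; exact Good.spider .green p (k + 1) (h.cx _ _).cap
    | .red => rw [spider_succ_succ_red]; exact Good.spider .red p (k + 1) ((h.cx _ _).op _ _).cap

theorem exists_ends (L : Multiset ℕ) : ∃ (k : ℕ) (l : Fin k → ℕ), ends l = L := by
  induction L using Quot.ind with
  | _ L =>
  refine ⟨L.length, L.get, ?_⟩
  rw [ends, Fin.univ_val_map, List.ofFn_get]
  rfl

theorem ends_append {k : ℕ} (o : Fin n → ℕ) (l : Fin k → ℕ) :
    ends (Fin.append o l) = ends o + ends l := by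
  rw [ends, ends, ends, Fin.univ_val_map, Fin.univ_val_map, Fin.univ_val_map, Multiset.coe_add,
    List.ofFn_fin_append]

/-- All state diagrams with the given nodes have normal forms or denote the empty relation. -/
def AllGood (C : Multiset Node) : Prop := ∀ ⦃n : ℕ⦄ (D : Diagram 0 n), D.nodes = C → Good (cls D)

/-- The legs of the spider are cut and become additional outputs of a diagram without it; the spider
gate restores the original. A self-loop yields two outputs on the same wire, which is allowed. -/
theorem AllGood.spider {C : Multiset Node} (h : AllGood C) (c : Colour) (p : Phase)
    (L : Multiset ℕ) : AllGood (.spider c p L ::ₘ C) := by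
  intro n D hD
  obtain ⟨k, l, rfl⟩ := exists_ends L
  let E : Diagram 0 (n + k) := .state (Fin.append D.output l) C D.circles fun e => by
    have := D.count_wires e
    rwa [Diagram.wires, hD, legsOf_cons, legs_spider, ← add_assoc, ← ends_append] at this
  have hE : (nSpider c p n k).act (cls E) = cls D := by
    rw [(nSpider c p n k).act_eq_glue E ((nSpider c p n k).name 0 E.output)
      ((nSpider c p n k).name_val 0 E.output) (by simp [nSpider, spiderGate])
      (by simp [nSpider, spiderGate])]
    refine congrArg cls (Diagram.ext_state ?_ ?_ rfl)
    · refine (nSpider_name_out c p k 0 E.output).trans ?_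
      funext i
      exact Fin.append_left _ _ i
    · rw [hD]
      change Multiset.map (Node.rename _) _ + C = _
      rw [nSpider_frag, Multiset.singleton_add]
      congr 3
      funext i
      exact Fin.append_right _ _ i
  rw [← hE]
  exact (h E rfl).spider c p k

theorem AllGood.had {C : Multiset Node} (h : AllGood C) (s : Sym2 ℕ) :
    AllGood (.had s ::ₘ C) := by
  intro n D hD
  induction s using Sym2.ind with
  | _ a b =>
  obtain ⟨N, hN⟩ := exists_fresh D.wires
  obtain ⟨D', h1, -, -, h2⟩ := (LEq.euler .green a b N (N + 1)).exists_rewrite D C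
    (by rw [hD, Multiset.singleton_add]) {N, N + 1} 0
    (by
      simp only [Multiset.insert_eq_cons, ← Multiset.singleton_add, legsOf_add, legsOf_singleton,
        legs_spider, legs_had]
      abel) (by simp) (by
      intro e he hw
      have := hN e hw
      simp only [Multiset.insert_eq_cons, Multiset.mem_cons, Multiset.mem_singleton] at he
      omega)
  rw [h2]
  refine (((h.spider .green (0, 1) {N + 1, b}).spider .red (0, 1) {N, N + 1}).spider
    .green (0, 1) {a, N}) D' (h1.trans ?_)
  simp only [Multiset.insert_eq_cons, Multiset.cons_add, Multiset.singleton_add,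
    Colour.swap_green]

/-- Circles are droppable scalars. Each output wire also ends at its own green node, so the output
wires are distinct and can be renamed. -/
theorem cls_eq_base {D : Diagram 0 n}
    (hD : D.nodes = Finset.univ.val.map fun v => .spider .green 0 {D.output v}) :
    cls D = base ∅ := by
  have hw : D.wires = 2 • ends D.output := by
    rw [Diagram.wires, hD, legsOf_map_singleton _ (fun _ => Colour.green) (fun _ => (0 : Phase)),
      two_nsmul]
    rfl
  let E : Diagram 0 n := .state D.output D.nodes 0 D.count_wires
  have hE : cls D = cls E := by
    refine cls_scalar (.state Fin.elim0 0 D.circles fun e => by simp [ends]) ?_ rfl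
      (zero_add _).symm (add_zero _).symm
    exact ⟨(Fin.elim0, Fin.elim0), fun _ => 0, fun i => i.elim0, fun i => i.elim0,
      fun N hN => absurd hN (Multiset.notMem_zero N)⟩
  rw [hE]
  have hnd : (ends D.output).Nodup := by
    rw [Multiset.nodup_iff_count_le_one]
    intro e
    have := D.count_wires e
    rw [hw, Multiset.count_nsmul] at this
    omega
  have hinj : Function.Injective D.output := fun i j h =>
    Multiset.inj_on_of_nodup_map hnd i (Finset.mem_univ i) j (Finset.mem_univ j) h
  symm
  refine cls_relabel (fun x => if h : x < n then D.output ⟨x, h⟩ else x) ?_ ?_ ?_ rfl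
  · have : ∀ x ∈ (baseD (∅ : Finset (Fin n))).wires, x < n := by
      intro x hx
      have hx : x ∈ ends (Fin.val : Fin n → ℕ) + legsOf (baseD ∅).nodes := hx
      rw [baseD_nodes_eq, legsOf_map_singleton, ← ends, ends_val] at hx
      simpa using hx
    intro x hx y hy hxy
    have hx := this x hx
    have hy := this y hy
    simp only [hx, hy, dif_pos] at hxy
    exact congrArg Fin.val (hinj hxy)
  · funext i
    simp [E, Diagram.state, baseD]
  · change D.nodes = _
    rw [hD, baseD_nodes_eq, Multiset.map_map]
    refine Multiset.map_congr rfl fun v _ => ?_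
    simp [Node.rename]

end ToyCalculus

/-! ### Diagrams consisting of green states and bare wires -/

namespace ToyCalculus

variable {n m : ℕ}

open Circuit

/-- A bare wire between two outputs is obtained from two green states. -/
theorem exists_bell {D : Diagram 0 n} {i j : Fin n} (hij : i ≠ j) (h : D.output i = D.output j) :
    ∃ (E : Diagram 0 n) (x y : ℕ), cls D = 𝐇 j (cz i j (cls E)) ∧
      E.output = Function.update (Function.update D.output i x) j y ∧
      E.nodes = .spider .green 0 {x} ::ₘ .spider .green 0 {y} ::ₘ D.nodes := by
  obtain ⟨N, hN⟩ := exists_fresh D.wires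
  have hcD : ∀ x, N ≤ x → D.wires.count x = 0 := fun x hx =>
    Multiset.count_eq_zero.2 fun h => absurd (hN x h) (not_lt.2 hx)
  have he : D.output i < N := hN _ (Multiset.mem_add.2 (.inl (mem_ends _ i)))
  have hout : ∀ v, D.output v < N := fun v => hN _ (Multiset.mem_add.2 (.inl (mem_ends _ v)))
  have h1 : ends (Function.update (Function.update D.output i N) j (N + 1)) + {D.output i} +
      {D.output i} = ends D.output + {N} + {N + 1} := by
    have h1 := ends_update (Function.update D.output i N) j (N + 1)
    rw [Function.update_of_ne hij.symm, ← h] at h1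
    rw [h1, add_right_comm, ends_update]
  have hw : ends (Function.update (Function.update D.output i N) j (N + 1)) +
      legsOf (.spider .green 0 {N} ::ₘ .spider .green 0 {N + 1} ::ₘ D.nodes) +
      2 • {D.output i} = D.wires + 2 • {N} + 2 • {N + 1} := by
    calc _ = ends (Function.update (Function.update D.output i N) j (N + 1)) + {D.output i} +
      {D.output i} + ({N} + {N + 1} + legsOf D.nodes) := by
          simp only [legsOf_cons, legs_spider]; abel
      _ = _ := by rw [h1, Diagram.wires]; abel
  have hDe : D.wires.count (D.output i) = 2 := (D.count_wires _).resolve_left fun h0 =>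
    Multiset.count_eq_zero.1 h0 (Multiset.mem_add.2 (.inl (mem_ends _ i)))
  have hcount : ∀ e, (ends (Function.update (Function.update D.output i N) j (N + 1)) +
      legsOf (.spider .green 0 {N} ::ₘ .spider .green 0 {N + 1} ::ₘ D.nodes)).count e =
      if e = D.output i then 0 else if e = N ∨ e = N + 1 then 2 else D.wires.count e := by
    intro e
    have h2 := congrArg (Multiset.count e) hw
    generalize ends (Function.update (Function.update D.output i N) j (N + 1)) +
      legsOf (.spider .green 0 {N} ::ₘ .spider .green 0 {N + 1} ::ₘ D.nodes) = W at h2 ⊢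
    simp only [Multiset.count_add, Multiset.count_nsmul, Multiset.count_singleton] at h2
    by_cases h3 : e = D.output i
    · subst h3
      rw [if_pos rfl, if_neg he.ne, if_neg (by omega), hDe] at h2
      rw [if_pos rfl]
      omega
    · rw [if_neg h3] at h2 ⊢
      by_cases h4 : e = N
      · rw [if_pos h4, if_neg (by omega), hcD e (by omega)] at h2
        rw [if_pos (.inl h4)]
        omega
      · by_cases h5 : e = N + 1
        · rw [if_neg h4, if_pos h5, hcD e (by omega)] at h2
          rw [if_pos (.inr h5)]
          omega
        · rw [if_neg h4, if_neg h5] at h2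
          rw [if_neg (by tauto)]
          omega
  let E : Diagram 0 n := .state (Function.update (Function.update D.output i N) j (N + 1))
    (.spider .green 0 {N} ::ₘ .spider .green 0 {N + 1} ::ₘ D.nodes) D.circles fun e => by
      rw [hcount]
      split_ifs
      exacts [.inl rfl, .inr rfl, D.count_wires e]
  have hE : ∀ x, x = D.output i ∨ N + 2 ≤ x → x ∉ E.wires := fun x hx => by
    rw [← Multiset.count_eq_zero]
    refine (hcount x).trans ?_
    rcases hx with hx | hx
    · rw [if_pos hx]
    · rw [if_neg (by omega), if_neg (by omega), hcD x (by omega)]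
  refine ⟨E, N, N + 1, ?_, rfl, rfl⟩
  -- The old wire `D.output i` no longer occurs in `E`, so it may serve as the new output at `i`.
  -- What remains is an identity node from it to the output `N + 5`, and contracting that node gives
  -- back `D`.
  obtain ⟨F, f1, f2, f3, f4⟩ := (cons (nCZ i j hij (D.output i) (N + 2) (N + 3) (N + 4))
    (cons (nOp j .had (N + 5)) nil)).exists_run E 0
    (by
      simp only [names_cons, nCZ_ν, nOp_ν, names_nil, List.cons_append, List.nil_append,
        List.nodup_cons, List.mem_cons, List.not_mem_nil, not_false_eq_true, List.nodup_nil]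
      grind)
    (fun x hx => hE _ (by
      simp only [names_cons, nCZ_ν, nOp_ν, names_nil, List.cons_append, List.nil_append,
        List.mem_cons, List.not_mem_nil] at hx
      grind))
  have g1 : E.output i = N := (Function.update_of_ne hij _ _).trans (Function.update_self ..)
  have g2 : E.output j = N + 1 := Function.update_self ..
  simp only [frag_cons, frag_nil, nOp_frag, nOp_name_out, nCZ_frag, nCZ_name_out, Op.node,
    Function.update_self, zero_add, g1, g2] at f3
  simp only [outs_cons, outs_nil, nOp_name_out, nCZ_name_out, zero_add,
    Function.update_idem] at f2
  have key : LEq ({.spider .green 0 {N, D.output i, N + 3}, .had s(N + 3, N + 4),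
      .spider .green 0 {N + 1, N + 2, N + 4}} + {.had s(N + 2, N + 5)} +
      {.spider .green 0 {N}, .spider .green 0 {N + 1}})
      {.spider .green 0 {D.output i, N + 5}} := by
    refine LEq.step₀ (LEq.cz_green N (N + 1) (N + 3) (N + 4) (D.output i) (N + 2))
      {.had s(N + 2, N + 5)} {N, N + 1, N + 3, N + 4} ?_
    exact (LEq.had_had .green (D.output i) (N + 2) (N + 5)).sub 0
  obtain ⟨F', k1, k2, k3, k4⟩ := key.exists_rewrite F D.nodes
    (by
      rw [f3]
      change _ + (Node.spider .green 0 {N} ::ₘ .spider .green 0 {N + 1} ::ₘ D.nodes) = _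
      simp only [Multiset.insert_eq_cons, ← Multiset.singleton_add, add_zero, add_assoc])
    0 {N, N + 1, N + 2, N + 3, N + 4}
    (by
      simp only [Multiset.insert_eq_cons, ← Multiset.singleton_add, legsOf_add, legsOf_singleton,
        legs_spider, legs_had]
      abel) Multiset.nodup_zero (by simp)
  have hF : cls F = 𝐇 j (cz i j (cls E)) := by rw [← f1]; simp
  rw [← hF, k4]
  refine (cls_step (Step.identity F' D .green (D.output i) (N + 5) D.nodes (by omega)
    (input_eq _ _) ?_ (by rw [k1, Multiset.singleton_add]) ?_ (k3.trans f4).symm)).symm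
  · rw [k2, f2]
    funext v
    by_cases hv : v = j
    · subst hv
      simp [h]
    · by_cases hv' : v = i
      · subst hv'
        simp only [Function.comp_apply, Function.update_of_ne hv, Function.update_self]
        rw [Function.update_of_ne (by omega)]
        rfl
      · have := hout v
        rw [Function.comp_apply, Function.update_of_ne hv, Function.update_of_ne hv',
          show E.output v = D.output v from
            (Function.update_of_ne hv _ _).trans (Function.update_of_ne hv' _ _),
          Function.update_of_ne (by omega)]
        rfl
  · refine (map_rename_id fun x hx => ?_).symm
    have := hN x (Multiset.mem_add.2 (.inr hx))
    rw [Function.update_of_ne (by omega)]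
    rfl

/-- Outputs outside `S` are joined in pairs by bare wires. Each use of `exists_bell` replaces such a
wire by two green states, so the complement of `S` shrinks. -/
theorem good_of_bare {S : Finset (Fin n)} {D : Diagram 0 n}
    (hD : D.nodes = S.val.map fun v => .spider .green 0 {D.output v}) : Good (cls D) := by
  induction hk : Sᶜ.card using Nat.strong_induction_on generalizing S D with
  | _ k ih =>
  by_cases hS : S = Finset.univ
  · subst hS
    rw [cls_eq_base hD]
    exact .inl ⟨_, .base⟩
  obtain ⟨i, hi⟩ : ∃ i, i ∉ S := by
    by_contra! h
    exact hS (Finset.eq_univ_iff_forall.2 h)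
  obtain ⟨j, hj, hji, hij⟩ : ∃ j ∉ S, j ≠ i ∧ D.output i = D.output j := by
    have h1 : D.wires = 2 • S.val.map D.output + Sᶜ.val.map D.output := by
      rw [Diagram.wires, hD, legsOf_map_singleton _ (fun _ => Colour.green) (fun _ => (0 : Phase)),
        ends, ← Finset.union_compl S, ← Finset.disjUnion_eq_union _ _ disjoint_compl_right,
        Finset.disjUnion_val, Multiset.map_add, two_nsmul]
      abel
    have h2 : Sᶜ.val = i ::ₘ (Sᶜ.erase i).val := by
      rw [Finset.erase_val, Multiset.cons_erase]
      exact Finset.mem_compl.2 hi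
    have h3 := D.count_wires (D.output i)
    rw [h1, h2, Multiset.map_cons, Multiset.count_add, Multiset.count_nsmul,
      Multiset.count_cons_self] at h3
    have h4 : D.output i ∈ (Sᶜ.erase i).val.map D.output :=
      Multiset.one_le_count_iff_mem.1 (by omega)
    obtain ⟨j, hj, hij⟩ := Multiset.mem_map.1 h4
    have hj := Finset.mem_erase.1 hj
    exact ⟨j, Finset.mem_compl.1 hj.2, hj.1, hij.symm⟩
  obtain ⟨E, x, y, h1, h2, h3⟩ := exists_bell hji.symm hij
  rw [h1]
  refine ((ih _ ?_ (S := insert i (insert j S)) ?_ rfl).cz i j).op j .had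
  · rw [← hk]
    refine Finset.card_lt_card ((Finset.compl_ssubset_compl).2 ⟨?_, fun h => ?_⟩)
    · exact (Finset.subset_insert ..).trans (Finset.subset_insert ..)
    · exact hi (h (Finset.mem_insert_self ..))
  · have h4 : i ∉ insert j S := by simp [hi, hji.symm]
    rw [h3, hD, Finset.insert_val_of_notMem h4, Finset.insert_val_of_notMem hj, Multiset.map_cons,
      Multiset.map_cons, h2, Function.update_self, Function.update_of_ne hji.symm,
      Function.update_self]
    congr 2
    refine Multiset.map_congr rfl fun v hv => ?_
    have hv : v ∈ S := hv
    rw [Function.update_of_ne (by rintro rfl; exact hj hv),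
      Function.update_of_ne (by rintro rfl; exact hi hv)]

theorem allGood (C : Multiset Node) : AllGood C := by
  induction C using Multiset.induction with
  | empty => exact fun n D hD => good_of_bare (S := ∅) hD
  | cons N C ih =>
    match N with
    | .spider c p L => exact ih.spider c p L
    | .had s => exact ih.had s

end ToyCalculus

namespace ToyCalculus

variable {n : ℕ}

/-! ### Graph states -/

theorem foldr_foldr {α β : Type*} {f g : α → β → β} {L : List α} (hL : L.Nodup)
    (h : ∀ a b, a ≠ b → ∀ x, g a (f b x) = f b (g a x)) (x : β) :
    L.foldr f (L.foldr g x) = L.foldr (fun a y => f a (g a y)) x := by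
  induction L with
  | nil => rfl
  | cons a L ih =>
    have hL := List.nodup_cons.1 hL
    rw [List.foldr_cons, List.foldr_cons, List.foldr_cons, ← ih hL.2,
      foldr_comm f (g a) fun b hb => h a b (by rintro rfl; exact hL.1 hb)]

/-- The operators `o v` at the outputs `v` in `L`. -/
def ops (L : List (Fin n)) (o : Fin n → Op) (ψ : St n) : St n :=
  L.foldr (fun v => op v (o v)) ψ

@[simp] theorem ops_nil (o : Fin n → Op) (ψ : St n) : ops [] o ψ = ψ := rfl
@[simp] theorem ops_cons (v : Fin n) (L : List (Fin n)) (o : Fin n → Op) (ψ : St n) :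
    ops (v :: L) o ψ = op v (o v) (ops L o ψ) := rfl

theorem ops_erase {L : List (Fin n)} {v : Fin n} (hv : v ∈ L) (o : Fin n → Op) (ψ : St n) :
    ops L o ψ = op v (o v) (ops (L.erase v) o ψ) :=
  foldr_erase (fun v => op v (o v)) (fun a _ b _ x => by
    by_cases h : a = b
    · rw [h]
    · exact op_comm h _ _ x) hv ψ

theorem ops_congr {L : List (Fin n)} {o o' : Fin n → Op} (h : ∀ v ∈ L, o v = o' v) (ψ : St n) :
    ops L o ψ = ops L o' ψ := by
  induction L with
  | nil => rfl
  | cons v L ih =>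
    rw [ops_cons, ops_cons, h v List.mem_cons_self, ih fun u hu => h u (List.mem_cons_of_mem _ hu)]

theorem ops_comm (F : St n → St n) {L : List (Fin n)} {o : Fin n → Op}
    (h : ∀ v ∈ L, ∀ ψ, F (op v (o v) ψ) = op v (o v) (F ψ)) (ψ : St n) :
    F (ops L o ψ) = ops L o (F ψ) := foldr_comm _ F h ψ

/-- Controlled phases for the pairs in `T`. -/
def czs (T : List (Fin n × Fin n)) (ψ : St n) : St n := T.foldr (fun e => cz e.1 e.2) ψ

/-- Phase shifts at all outputs. -/
def phs (q : Fin n → Phase) (ψ : St n) : St n :=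
  ops (List.finRange n) (fun v => .phase .green (q v)) ψ

theorem ph_phs (v : Fin n) (p : Phase) (q : Fin n → Phase) (ψ : St n) :
    𝐆 v p (phs q ψ) = phs (Function.update q v (p + q v)) ψ := by
  rw [phs, phs, ops_erase (List.mem_finRange v), ops_erase (List.mem_finRange v), ph_ph,
    Function.update_self]
  congr 1
  refine ops_congr (fun u hu => ?_) ψ
  rw [Function.update_of_ne]
  rintro rfl
  exact (List.nodup_finRange n).not_mem_erase hu

theorem cz_phs (i j : Fin n) (q : Fin n → Phase) (ψ : St n) :
    cz i j (phs q ψ) = phs q (cz i j ψ) :=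
  ops_comm (cz i j) (fun v _ ψ => (ph_cz_comm v i j (q v) ψ).symm) ψ

/-- Graph states with phase shifts, where the vertices in `B` are independent and have phases `00`
or `11`. -/
def IsDiag (B : Finset (Fin n)) (ψ : St n) : Prop :=
  ∃ (q : Fin n → Phase) (T : List (Fin n × Fin n)), T.Nodup ∧
    (∀ e ∈ T, e.1 < e.2 ∧ ¬ (e.1 ∈ B ∧ e.2 ∈ B)) ∧ (∀ b ∈ B, (q b).1 = (q b).2) ∧
    ψ = phs q (czs T (base ∅))

namespace IsDiag

variable {B : Finset (Fin n)} {ψ : St n}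

theorem base : IsDiag B (base ∅) := by
  refine ⟨fun _ => 0, [], List.nodup_nil, by simp, by simp, ?_⟩
  have : ∀ L : List (Fin n), ToyCalculus.base ∅ =
      ops L (fun _ => .phase .green 0) (czs [] (ToyCalculus.base ∅)) := by
    intro L
    induction L with
    | nil => rfl
    | cons v L ih => rw [ops_cons, ← ih, ph_zero]
  exact this _

theorem ph (h : IsDiag B ψ) (v : Fin n) (p : Phase) (hp : v ∈ B → p.1 = p.2) :
    IsDiag B (𝐆 v p ψ) := by
  obtain ⟨q, T, hT, hTB, hq, rfl⟩ := h
  refine ⟨_, T, hT, hTB, fun b hb => ?_, ph_phs ..⟩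
  by_cases hbv : b = v
  · subst hbv
    rw [Function.update_self, Prod.fst_add, Prod.snd_add, hp hb, hq b hb]
  · rw [Function.update_of_ne hbv, hq b hb]

theorem cz_of_lt (h : IsDiag B ψ) {i j : Fin n} (hij : i < j) (hB : ¬ (i ∈ B ∧ j ∈ B)) :
    IsDiag B (cz i j ψ) := by
  obtain ⟨q, T, hT, hTB, hq, rfl⟩ := h
  rw [cz_phs]
  by_cases he : (i, j) ∈ T
  · refine ⟨q, T.erase (i, j), hT.erase _, fun e h => hTB e (List.mem_of_mem_erase h), hq, ?_⟩
    rw [czs, foldr_erase (fun e : Fin n × Fin n => ToyCalculus.cz e.1 e.2)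
      (fun a _ b _ x => cz_comm ..) he, cz_cz]
    rfl
  · refine ⟨q, (i, j) :: T, List.nodup_cons.2 ⟨he, hT⟩, fun e h => ?_, hq, rfl⟩
    rcases List.mem_cons.1 h with rfl | h
    exacts [⟨hij, hB⟩, hTB e h]

theorem cz (h : IsDiag B ψ) {i j : Fin n} (hB : ¬ (i ∈ B ∧ j ∈ B)) :
    IsDiag B (cz i j ψ) := by
  rcases lt_trichotomy i j with hij | rfl | hij
  · exact h.cz_of_lt hij hB
  · simpa [ToyCalculus.cz] using h
  · rw [cz_symm]
    exact h.cz_of_lt hij fun h => hB ⟨h.2, h.1⟩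

end IsDiag

theorem hds_base (L : List (Fin n)) : ∀ B : Finset (Fin n), L.Nodup → (∀ v, v ∈ L ↔ v ∈ B) →
    ops L (fun _ => .had) (base B) = base ∅ := by
  induction L with
  | nil =>
    intro B _ hB
    have h : B = ∅ := Finset.eq_empty_of_forall_notMem fun v hv => by simpa using (hB v).2 hv
    rw [ops_nil, h]
  | cons b L ih =>
    intro B hL hB
    have hL := List.nodup_cons.1 hL
    rw [ops_cons, ops_comm (𝐇 b) fun v hv ψ => op_comm (by rintro rfl; exact hL.1 hv) _ _ ψ,
      hd_base ((hB b).1 List.mem_cons_self)]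
    refine ih _ hL.2 fun v => ?_
    rw [Finset.mem_erase, ← hB, List.mem_cons]
    constructor
    · exact fun hv => ⟨by rintro rfl; exact hL.1 hv, .inr hv⟩
    · exact fun hv => hv.2.resolve_left hv.1

/-- Under H on all of `B`, a `cx` becomes an edge from outside `B` into `B`, and a red `11` becomes
a green `11`. No edge inside `B` can arise. -/
theorem NF.isDiag {B : Finset (Fin n)} {ψ : St n} (h : NF B ψ) {L : List (Fin n)} (hL : L.Nodup)
    (hB : ∀ v, v ∈ L ↔ v ∈ B) : IsDiag B (ops L (fun _ => .had) ψ) := by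
  have hne : ∀ {a}, a ∉ B → ∀ v ∈ L, v ≠ a := fun ha v hv =>
    ne_of_mem_of_notMem' ((hB v).1 hv) ha
  induction h with
  | base => rw [hds_base L B hL hB]; exact .base
  | @cz a b ψ ha hb h ih =>
    rw [← ops_comm (ToyCalculus.cz a b) fun v hv ψ => (op_cz (hne ha v hv) (hne hb v hv) _ ψ).symm]
    exact ih.cz fun h => ha h.1
  | @cx a b ψ ha hb h ih =>
    rw [ops_erase ((hB b).2 hb), ← ops_comm (ToyCalculus.cx a b) (fun v hv ψ =>
      (op_cx (hne ha v (List.mem_of_mem_erase hv)) (by rintro rfl; exact hL.not_mem_erase hv)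
        _ ψ).symm), hd_cx, ← ops_erase ((hB b).2 hb) fun _ => Op.had]
    exact ih.cz fun h => ha h.1
  | @ph a ψ ha p h ih =>
    rw [← ops_comm (𝐆 a p) fun v hv ψ => op_comm (hne ha v hv).symm _ _ ψ]
    exact ih.ph a p fun h => absurd h ha
  | @rph b ψ hb h ih =>
    rw [ops_erase ((hB b).2 hb), ← ops_comm (𝐑 b (1, 1)) (fun v hv ψ =>
      op_comm (by rintro rfl; exact hL.not_mem_erase hv) _ _ ψ), hd_rph,
      ← ops_erase ((hB b).2 hb) fun _ => Op.had]
    exact ih.ph b _ fun _ => rfl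

theorem NF.ops_ph {B : Finset (Fin n)} {ψ : St n} (h : NF B ψ) (L : List (Fin n)) (p : Phase) :
    NF B (ops L (fun _ => .phase .green p) ψ) := by
  induction L with
  | nil => exact h
  | cons v L ih => exact ih.ph_any v p

theorem ops_phs (L : List (Fin n)) (hL : L.Nodup) (p : Phase) (q : Fin n → Phase) (ψ : St n) :
    ops L (fun _ => .phase .green p) (phs q ψ) = phs (fun v => if v ∈ L then p + q v else q v) ψ := by
  induction L with
  | nil => simp
  | cons v L ih =>
    have hL := List.nodup_cons.1 hL
    rw [ops_cons, ih hL.2, ph_phs, if_neg hL.1]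
    congr 1
    funext u
    by_cases hu : u = v
    · subst hu; simp
    · simp [hu]

theorem ops_red (L : List (Fin n)) (hL : L.Nodup) (ψ : St n) :
    ops L (fun _ => .phase .red (0, 1)) ψ = ops L (fun _ => .phase .green (0, 1))
      (ops L (fun _ => .had) (ops L (fun _ => .phase .green (0, 1)) ψ)) := by
  have h1 := foldr_foldr (f := fun v : Fin n => op v .had)
    (g := fun v => op v (.phase .green (0, 1))) hL (fun a b h x => op_comm h _ _ x) ψ
  have h2 := foldr_foldr (f := fun v : Fin n => op v (.phase .green (0, 1)))
    (g := fun v x => op v .had (op v (.phase .green (0, 1)) x)) hL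
    (fun a b h x => by rw [op_comm h, op_comm h]) ψ
  rw [ops, ops, ops, ops, h1, h2]
  congr 1
  funext v x
  exact rph_zero_one v x

theorem ops_red_red (L : List (Fin n)) (hL : L.Nodup) (ψ : St n) :
    ops L (fun _ => .phase .red (0, 1)) (ops L (fun _ => .phase .red (0, 1)) ψ) = ψ := by
  rw [ops, ops, foldr_foldr hL fun a b h x => op_comm h _ _ x]
  simp only [rph_rph, zero_one_add_zero_one, rph_zero]
  clear hL
  induction L with
  | nil => rfl
  | cons a L ih => exact ih

/-- Each normal form is a graph state with phase shifts, some of which are red. -/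
theorem NF.exists_graph {B : Finset (Fin n)} {ψ : St n} (h : NF B ψ) :
    ∃ (q : Fin n → Phase) (T : List (Fin n × Fin n)), T.Nodup ∧
      (∀ e ∈ T, e.1 < e.2 ∧ ¬ (e.1 ∈ B ∧ e.2 ∈ B)) ∧ (∀ b ∈ B, (q b).2 = (q b).1 + 1) ∧
      ψ = ops B.toList (fun _ => .phase .red (0, 1)) (phs q (czs T (ToyCalculus.base ∅))) := by
  have hL := B.nodup_toList
  -- The extra phases `01` on `B`, applied before H, are those of the decomposition of the red
  -- shift; they keep the same `B` by `NF.ops_ph`.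
  obtain ⟨q, T, hT, hTB, hq, hψ⟩ := (h.ops_ph B.toList (0, 1)).isDiag hL fun v => Finset.mem_toList
  refine ⟨fun v => if v ∈ B.toList then (0, 1) + q v else q v, T, hT, hTB, fun b hb => ?_, ?_⟩
  · simp only [if_pos (Finset.mem_toList.2 hb)]
    rw [Prod.snd_add, Prod.fst_add, hq b hb]
    ring
  -- A second round of phases `01` completes the red shift on `B`, which the outer red shift
  -- cancels. These phases turn `00` and `11` into `01` and `10`.
  · rw [← ops_phs B.toList hL, ← hψ, ← ops_red _ hL, ops_red_red _ hL]

end ToyCalculus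

/-! ### Assembling reduced GS-LO diagrams -/

namespace ToyCalculus

variable {n : ℕ}

open Circuit

/-- The state is the class of a GS-LO diagram with graph `G` and vertex operators `U`. -/
def IsGSLO (G : SimpleGraph (Fin n)) (U : Fin n → List Op) (ψ : St n) : Prop :=
  ∃ D : Diagram 0 n, IsGSLOWith D G U ∧ ψ = cls D

theorem isGSLO_base : IsGSLO (⊥ : SimpleGraph (Fin n)) (fun _ => []) (base ∅) := by
  refine ⟨baseD ∅, ⟨fun _ _ => 0, fun v _ => v, rfl, fun _ => rfl, ?_⟩, rfl⟩
  rw [baseD_nodes_eq]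
  simp [chain]

theorem chain_append (l : List Op) (o : Op) : ∀ w : ℕ → ℕ,
    chain (l ++ [o]) w = {o.node (w l.length) (w (l.length + 1))} + chain l w := by
  induction l with
  | nil => intro w; rfl
  | cons a l ih =>
    intro w
    rw [List.cons_append, chain, ih, chain, List.length_cons]
    simp only [← Multiset.singleton_add]
    abel

theorem chain_congr (l : List Op) : ∀ w w' : ℕ → ℕ, (∀ k ≤ l.length, w k = w' k) →
    chain l w = chain l w' := by
  induction l with
  | nil => intros; rfl
  | cons a l ih =>
    intro w w' h
    rw [chain, chain, h 0 (Nat.zero_le _), h 1 (by simp), ih _ (fun k => w' (k + 1))]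
    intro k hk
    exact h (k + 1) (by simpa using hk)

theorem IsGSLO.op {G : SimpleGraph (Fin n)} {U : Fin n → List Op} {ψ : St n} (h : IsGSLO G U ψ)
    (v : Fin n) (o : Op) : IsGSLO G (Function.update U v (U v ++ [o])) (op v o ψ) := by
  obtain ⟨D, ⟨h, w, h1, h2, h3⟩, rfl⟩ := h
  obtain ⟨N, hN⟩ := exists_fresh D.wires
  obtain ⟨E, e1, e2, e3, e4⟩ := (cons (nOp v o 0) nil).exists_run D N (by simp) fun j _ hj => by
    have := hN _ hj
    omega
  simp only [outs_cons, outs_nil, nOp_name_out, frag_cons, frag_nil, nOp_frag] at e2 e3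
  -- The wire above the first `length + 1` components is the new output; the wires below keep their
  -- names.
  let w' : Fin n → ℕ → ℕ :=
    Function.update w v (Function.update (w v) ((U v).length + 1) (N + 0))
  have hw : ∀ u, w' u 0 = w u 0 := by
    intro u
    by_cases hu : u = v
    · subst hu; simp [w']
    · simp [w', hu]
  refine ⟨E, ⟨h, w', e4.trans h1, fun u => ?_, ?_⟩, e1⟩
  · rw [e2]
    by_cases hu : u = v
    · subst hu; simp [w']
    · simp [w', hu, h2]
  · have hs : ∑ u, chain (Function.update U v (U v ++ [o]) u) (w' u) =
        {o.node (w v (U v).length) (N + 0)} + ∑ u, chain (U u) (w u) := by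
      rw [← Finset.add_sum_erase _ _ (Finset.mem_univ v),
        ← Finset.add_sum_erase _ (fun u => chain (U u) (w u)) (Finset.mem_univ v), ← add_assoc]
      congr 1
      · simp only [w', Function.update_self]
        rw [chain_append, Function.update_self, Function.update_of_ne (by omega)]
        congr 1
        exact chain_congr _ _ _ fun k hk => Function.update_of_ne (by omega) _ _
      · refine Finset.sum_congr rfl fun u hu => ?_
        have hu := Finset.ne_of_mem_erase hu
        simp only [w', Function.update_of_ne hu]
    simp only [hw]
    rw [hs, e3, h3, h2]
    abel

theorem IsGSLO.ops {G : SimpleGraph (Fin n)} {U : Fin n → List Op} {ψ : St n} (h : IsGSLO G U ψ)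
    {L : List (Fin n)} (hL : L.Nodup) (o : Fin n → Op) :
    IsGSLO G (fun v => if v ∈ L then U v ++ [o v] else U v) (ops L o ψ) := by
  induction L with
  | nil => simpa using h
  | cons v L ih =>
    have hL := List.nodup_cons.1 hL
    have hU : (fun u => if u ∈ v :: L then U u ++ [o u] else U u) =
        Function.update (fun u => if u ∈ L then U u ++ [o u] else U u) v
          ((if v ∈ L then U v ++ [o v] else U v) ++ [o v]) := by
      funext u
      by_cases hu : u = v
      · subst hu; simp [hL.1]
      · simp [hu]
    rw [hU]
    exact (ih hL.2).op v (o v)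

open Classical in
-- Without vertex operators, the two green nodes of the controlled phase fuse directly with the
-- vertices. As `i` and `j` were not adjacent, this adds exactly one simple edge.
theorem IsGSLO.cz {G : SimpleGraph (Fin n)} {ψ : St n} (h : IsGSLO G (fun _ => []) ψ)
    {i j : Fin n} (hij : i < j) (hG : ¬ G.Adj i j) :
    IsGSLO (G ⊔ SimpleGraph.edge i j) (fun _ => []) (cz i j ψ) := by
  obtain ⟨D, ⟨h, w, h1, h2, h3⟩, rfl⟩ := h
  obtain ⟨N, hN⟩ := exists_fresh D.wires
  obtain ⟨E, e1, e2, e3, e4⟩ := (cons (nCZ i j hij.ne 0 1 2 3) nil).exists_run D N (by simp)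
    fun k _ hk => by
      have := hN _ hk
      omega
  simp only [outs_cons, outs_nil, nCZ_name_out, frag_cons, frag_nil, nCZ_frag] at e2 e3
  let S : Fin n → Multiset ℕ := fun v =>
    (Finset.univ.filter fun u => G.Adj v u).val.map (h v)
  let R : Multiset Node := ((Finset.univ.erase i).erase j).val.map fun v =>
    Node.spider .green 0 (w v 0 ::ₘ S v)
  let Q : Multiset Node := (Finset.univ.filter fun e : Fin n × Fin n =>
    e.1 < e.2 ∧ G.Adj e.1 e.2).val.map fun e => Node.had s(h e.1 e.2, h e.2 e.1)
  have huniv : (Finset.univ : Finset (Fin n)).val = i ::ₘ j ::ₘ ((Finset.univ.erase i).erase j).val := by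
    rw [univ_val_eq_cons i, Finset.erase_val _ j, Multiset.cons_erase]
    exact Finset.mem_erase.2 ⟨hij.ne', Finset.mem_univ j⟩
  have hD : D.nodes = {.spider .green 0 (w i 0 ::ₘ S i), .spider .green 0 (w j 0 ::ₘ S j)} +
      (R + Q) := by
    rw [h3, huniv, Multiset.map_cons, Multiset.map_cons]
    simp only [chain, Finset.sum_const_zero, add_zero, Multiset.insert_eq_cons,
      ← Multiset.singleton_add, add_assoc]
    rfl
  have h2' : ∀ v, D.output v = w v 0 := h2
  have key : LEq ({.spider .green 0 {w i 0, N + 0, N + 2}, .had s(N + 2, N + 3),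
      .spider .green 0 {w j 0, N + 1, N + 3}} +
      {.spider .green 0 (w i 0 ::ₘ S i), .spider .green 0 (w j 0 ::ₘ S j)})
      {.spider .green 0 ((N + 0) ::ₘ (N + 2) ::ₘ S i), .spider .green 0 ((N + 1) ::ₘ (N + 3) ::ₘ S j),
        .had s(N + 2, N + 3)} := by
    refine LEq.step₀ (LEq.fuse .green 0 0 (w i 0) {N + 0, N + 2} (S i))
      {.had s(N + 2, N + 3), .spider .green 0 {w j 0, N + 1, N + 3},
        .spider .green 0 (w j 0 ::ₘ S j)} {w i 0} ?_
    exact (LEq.fuse .green 0 0 (w j 0) {N + 1, N + 3} (S j)).sub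
      {.had s(N + 2, N + 3), .spider .green 0 ((N + 0) ::ₘ (N + 2) ::ₘ S i)}
  obtain ⟨F, f1, f2, f3, f4⟩ := key.exists_rewrite E (R + Q)
    (by rw [e3, hD, h2', h2', add_zero, ← add_assoc]) 0 {w i 0, w j 0}
    (by
      simp only [Multiset.insert_eq_cons, ← Multiset.singleton_add, legsOf_add, legsOf_singleton,
        legs_spider, legs_had]
      abel) Multiset.nodup_zero (by simp)
  -- The half-edges of the new edge get the two wires beside the new node H; all other half-edges
  -- are kept.
  let h' : Fin n → Fin n → ℕ := fun v u =>
    if v = i ∧ u = j then N + 2 else if v = j ∧ u = i then N + 3 else h v u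
  let w' : Fin n → ℕ → ℕ := fun v _ => if v = i then N + 0 else if v = j then N + 1 else w v 0
  have hadj : ∀ v u, (G ⊔ SimpleGraph.edge i j).Adj v u ↔
      G.Adj v u ∨ (v = i ∧ u = j) ∨ (v = j ∧ u = i) := by
    intro v u
    rw [SimpleGraph.sup_adj, SimpleGraph.edge_adj]
    constructor
    · rintro (h | h)
      exacts [.inl h, .inr h.1]
    · rintro (h | h)
      · exact .inl h
      · refine .inr ⟨h, ?_⟩
        rintro rfl
        rcases h with ⟨rfl, h⟩ | ⟨rfl, h⟩
        exacts [hij.ne h, hij.ne' h]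
  have hnb : ∀ v, v ≠ i → v ≠ j → ∀ inst, (@Finset.filter _
      (fun u => (G ⊔ SimpleGraph.edge i j).Adj v u) inst Finset.univ).val.map (h' v) = S v := by
    intro v hi hj inst
    have : @Finset.filter _ (fun u => (G ⊔ SimpleGraph.edge i j).Adj v u) inst Finset.univ =
        Finset.univ.filter fun u => G.Adj v u := by
      ext u
      simp [hadj, hi, hj]
    rw [this]
    refine Multiset.map_congr rfl fun u _ => ?_
    simp [h', hi, hj]
  have hnbi : ∀ inst, (@Finset.filter _ (fun u => (G ⊔ SimpleGraph.edge i j).Adj i u) inst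
      Finset.univ).val.map (h' i) = (N + 2) ::ₘ S i := by
    intro inst
    have hj : j ∉ Finset.univ.filter fun u => G.Adj i u := by simpa using hG
    have : @Finset.filter _ (fun u => (G ⊔ SimpleGraph.edge i j).Adj i u) inst Finset.univ =
        insert j (Finset.univ.filter fun u => G.Adj i u) := by
      ext u
      simp [hadj, hij.ne, or_comm]
    rw [this, Finset.insert_val_of_notMem hj, Multiset.map_cons]
    congr 1
    · simp [h']
    · refine Multiset.map_congr rfl fun u hu => ?_
      have : u ≠ j := by rintro rfl; exact hj hu
      simp [h', this, hij.ne]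
  have hnbj : ∀ inst, (@Finset.filter _ (fun u => (G ⊔ SimpleGraph.edge i j).Adj j u) inst
      Finset.univ).val.map (h' j) = (N + 3) ::ₘ S j := by
    intro inst
    have hi : i ∉ Finset.univ.filter fun u => G.Adj j u := by
      simpa using fun h => hG h.symm
    have : @Finset.filter _ (fun u => (G ⊔ SimpleGraph.edge i j).Adj j u) inst Finset.univ =
        insert i (Finset.univ.filter fun u => G.Adj j u) := by
      ext u
      simp [hadj, hij.ne', or_comm]
    rw [this, Finset.insert_val_of_notMem hi, Multiset.map_cons]
    congr 1
    · simp [h', hij.ne']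
    · refine Multiset.map_congr rfl fun u hu => ?_
      have : u ≠ i := by rintro rfl; exact hi hu
      simp [h', this, hij.ne']
  have hedge : ∀ inst, ((@Finset.filter (Fin n × Fin n) (fun e =>
      e.1 < e.2 ∧ (G ⊔ SimpleGraph.edge i j).Adj e.1 e.2) inst Finset.univ).val.map fun e =>
      Node.had s(h' e.1 e.2, h' e.2 e.1)) = {.had s(N + 2, N + 3)} + Q := by
    intro inst
    have hj : (i, j) ∉ Finset.univ.filter fun e : Fin n × Fin n => e.1 < e.2 ∧ G.Adj e.1 e.2 := by
      simp [hG]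
    have : @Finset.filter (Fin n × Fin n) (fun e =>
        e.1 < e.2 ∧ (G ⊔ SimpleGraph.edge i j).Adj e.1 e.2) inst Finset.univ =
        insert (i, j) (Finset.univ.filter fun e : Fin n × Fin n => e.1 < e.2 ∧ G.Adj e.1 e.2) := by
      ext ⟨u, v⟩
      simp only [Finset.mem_filter, Finset.mem_univ, true_and, hadj, Finset.mem_insert,
        Prod.mk.injEq]
      constructor
      · rintro ⟨h, h' | h' | ⟨rfl, rfl⟩⟩
        exacts [.inr ⟨h, h'⟩, .inl h', absurd h hij.le.not_gt]
      · rintro (⟨rfl, rfl⟩ | ⟨h, h'⟩)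
        exacts [⟨hij, .inr (.inl ⟨rfl, rfl⟩)⟩, ⟨h, .inl h'⟩]
    rw [this, Finset.insert_val_of_notMem hj, Multiset.map_cons, Multiset.singleton_add]
    congr 1
    · simp [h', hij.ne']
    · refine Multiset.map_congr rfl fun e he => ?_
      have he := (Finset.mem_filter.1 (Finset.mem_def.2 he)).2
      have h1 : ¬ (e.1 = i ∧ e.2 = j) := fun h => hG (h.1 ▸ h.2 ▸ he.2)
      have h2 : ¬ (e.1 = j ∧ e.2 = i) := fun h => hij.le.not_gt (h.1 ▸ h.2 ▸ he.1)
      simp only [h', if_neg h1, if_neg h2, if_neg (fun h => h1 (And.symm h)),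
        if_neg (fun h => h2 (And.symm h))]
  refine ⟨F, ⟨h', w', f3.trans (e4.trans h1), fun v => ?_, ?_⟩, ?_⟩
  · rw [f2, e2]
    by_cases hv : v = j
    · subst hv; simp [w', hij.ne']
    · by_cases hv' : v = i
      · subst hv'; simp [w', hv]
      · simp [w', hv, hv', h2']
  · rw [f1, hedge, huniv, Multiset.map_cons, Multiset.map_cons, hnbi, hnbj]
    have hR : ∀ f : Fin n → Node, (∀ v, v ≠ i → v ≠ j →
        f v = .spider .green 0 (w v 0 ::ₘ S v)) →
        ((Finset.univ.erase i).erase j).val.map f = R := by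
      intro f hf
      refine Multiset.map_congr rfl fun v hv => ?_
      have hv := Finset.mem_erase.1 (Finset.mem_def.2 hv)
      exact hf v (Finset.ne_of_mem_erase hv.2) hv.1
    rw [hR]
    swap
    · intro v hvi hvj
      rw [hnb v hvi hvj]
      simp [w', hvi, hvj]
    have hwi : w' i 0 = N + 0 := by simp [w']
    have hwj : w' j 0 = N + 1 := by simp [w', hij.ne']
    rw [hwi, hwj]
    simp only [chain, Finset.sum_const_zero, Multiset.insert_eq_cons, ← Multiset.singleton_add]
    abel
  · rw [← f4, ← e1]
    simp

theorem isGSLO_czs {T : List (Fin n × Fin n)} (hT : T.Nodup) (h : ∀ e ∈ T, e.1 < e.2) :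
    ∃ G : SimpleGraph (Fin n), IsGSLO G (fun _ => []) (czs T (base ∅)) ∧
      ∀ u v, G.Adj u v → (u, v) ∈ T ∨ (v, u) ∈ T := by
  induction T with
  | nil => exact ⟨⊥, isGSLO_base, fun _ _ h => h.elim⟩
  | cons e T ih =>
    have hT := List.nodup_cons.1 hT
    obtain ⟨G, h1, h2⟩ := ih hT.2 fun e he => h e (List.mem_cons_of_mem _ he)
    have he := h e List.mem_cons_self
    refine ⟨_, h1.cz he fun hG => ?_, fun u v huv => ?_⟩
    · rcases h2 _ _ hG with h' | h'
      · exact hT.1 h'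
      · exact absurd (h _ (List.mem_cons_of_mem _ h')) he.le.not_gt
    · rw [SimpleGraph.sup_adj, SimpleGraph.edge_adj] at huv
      rcases huv with huv | ⟨⟨rfl, rfl⟩ | ⟨rfl, rfl⟩, -⟩
      · exact (h2 u v huv).imp (List.mem_cons_of_mem _) (List.mem_cons_of_mem _)
      · exact .inl List.mem_cons_self
      · exact .inr List.mem_cons_self

theorem NF.exists_reduced {B : Finset (Fin n)} {ψ : St n} (h : NF B ψ) :
    ∃ D : Diagram 0 n, IsReducedGSLO D ∧ ψ = cls D := by
  obtain ⟨q, T, hT, hTB, hq, rfl⟩ := h.exists_graph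
  obtain ⟨G, hG, hGT⟩ := isGSLO_czs hT fun e he => (hTB e he).1
  obtain ⟨D, hD, hψ⟩ := (hG.ops (List.nodup_finRange n) fun v => .phase .green (q v)).ops
    B.nodup_toList fun _ => .phase .red (0, 1)
  refine ⟨D, ⟨G, _, hD, fun v => ?_, fun u v huv hred => ?_⟩, hψ⟩
  · by_cases hv : v ∈ B
    · refine .inr ⟨(q v).1, ?_⟩
      simp [hv, ← hq v hv]
    · refine .inl ⟨(q v).1, (q v).2, ?_⟩
      simp [hv]
  -- Red nodes occur only at vertices in `B`, and no pair in `T` lies within `B`.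
  · have hB : ∀ v, HasRed (if v ∈ B.toList then (if v ∈ List.finRange n then
        [] ++ [Op.phase .green (q v)] else []) ++ [.phase .red (0, 1)] else
        if v ∈ List.finRange n then [] ++ [Op.phase .green (q v)] else []) → v ∈ B := by
      rintro v ⟨p, hp⟩
      by_contra hv
      simp [hv] at hp
    have hu := hB u hred.1
    have hv := hB v hred.2
    rcases hGT u v huv with h | h
    · exact (hTB _ h).2 ⟨hu, hv⟩
    · exact (hTB _ h).2 ⟨hv, hu⟩

end ToyCalculus

theorem mainTheorem4 (n : ℕ) (D : ToyCalculus.Diagram 0 n) (hD : D.interp.Nonempty) :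
    ∃ D' : ToyCalculus.Diagram 0 n,
      ToyCalculus.IsReducedGSLO D' ∧ ToyCalculus.Derivable D D' := by
  rcases ToyCalculus.allGood D.nodes D rfl with ⟨B, h⟩ | h
  · obtain ⟨D', h1, h2⟩ := h.exists_reduced
    exact ⟨D', h1, ToyCalculus.derivable_of_cls_eq h2⟩
  · exact absurd (ToyCalculus.Diagram.sat_of_nonempty hD) h.not_sat
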